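/- Let $n\ge 1$, let $M$ be a real skew-symmetric $n\times n$ matrix and put $A(x)=Mx$, $x\in\mathbb R^n$. Let $V,\mu:\mathbb R^n\to\mathbb R$ be radial, measurable and bounded on bounded sets; for example $V(x)=\mathrm{sgn}(\gamma)\gamma^2|x|^2$ with $\gamma\in\mathbb R$, and $\mu\equiv-1$. For $1<r<\infty$ let $\mathscr H^{1,r}=\{f\in L^r(\mathbb R^n;\mathbb C):\nabla f\in L^r,\ xf\in L^r\}$ with norm $\|f\|_{L^r}+\|\nabla f\|_{L^r}+\|xf\|_{L^r}$ (weak derivatives), and let $\Sigma=\mathscr H^{1,2}$. Let $q=r=\frac{2n+4}{n}$, $u_0\in\Sigma$, $0<T\le\infty$, and let $u\in C([0,T),\Sigma)\cap L^q_{\mathrm{loc}}([0,T),\mathscr H^{1,r})$ be a solution, in the sense of distributions, of the rotational nonlinear Schrödinger equation $$ i u_t=-\Delta u+V u+\mu\,|u|^{4/n}u+iA\cdot\nabla u,\qquad u(0)=u_0 .$$ Then for every $t\in[0,T)$ the function $\overline{u(t)}\,A\cdot\nabla u(t)$ is integrable on $\mathbb R^n$, and the angular momentum $$\ell_A(u(t)):=i\int_{\mathbb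 R^n}\overline{u(t)}\,A\cdot\nabla u(t)\,dx$$ is real-valued and conserved: $\ell_A(u(t))=\ell_A(u_0)$. Moreover, suppose $M=M_\Omega$ with $\Omega=(\Omega_1,\dots,\Omega_m)\in\mathbb R^m$, $m=\lfloor n/2\rfloor$, is the block-diagonal matrix with diagonal blocks $\Omega_j\begin{pmatrix}0&-1\\1&0\end{pmatrix}$, followed by a zero row and column if $n$ is odd. Write $L_j=-i(x_{2j-1}\partial_{2j}-x_{2j}\partial_{2j-1})$, $\Omega\cdot L=\sum_{j=1}^m\Omega_jL_j$ and $\langle g,f\rangle=\int g\bar f\,dx$. Then $\ell_\Omega(u(t)):=-\langle\Omega\cdot L\,u(t),u(t)\rangle$ equals $\ell_A(u(t))$ for every $t\in[0,T)$. -/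

import Mathlib

open MeasureTheory Filter Topology
open scoped ContDiff Matrix ENNReal InnerProductSpace ComplexConjugate

noncomputable section

namespace RNLS

/-- The space `ℝⁿ` with its Euclidean norm. -/
abbrev Rn (n : ℕ) : Type := EuclideanSpace ℝ (Fin n)

/-- Smooth compactly supported real-valued test functions on `ℝⁿ`. -/
def IsTest {n : ℕ} (φ : Rn n → ℝ) : Prop := ContDiff ℝ ∞ φ ∧ HasCompactSupport φ

/-- `g` is the weak (distributional) partial derivative of `f` in the `i`-th coordinate direction:
`∫ f ∂ᵢφ = - ∫ g φ` for every test function `φ`. -/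
def HasWeakPartial {n : ℕ} (f : Rn n → ℂ) (i : Fin n) (g : Rn n → ℂ) : Prop :=
  LocallyIntegrable f ∧ LocallyIntegrable g ∧
    ∀ φ : Rn n → ℝ, IsTest φ →
      ∫ x, f x * (fderiv ℝ φ x (EuclideanSpace.single i 1) : ℂ) = -∫ x, g x * (φ x : ℂ)

open Classical in
/-- The weak partial derivative `∂ᵢ f` (unique up to a null set), with the value `0` if `f` has no
locally integrable weak derivative in this direction. -/
def weakPartial {n : ℕ} (f : Rn n → ℂ) (i : Fin n) : Rn n → ℂ :=
  if h : ∃ g, HasWeakPartial f i g then Classical.choose h else 0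

/-- The weak gradient `∇ f`. -/
def weakGrad {n : ℕ} (f : Rn n → ℂ) (x : Rn n) : EuclideanSpace ℂ (Fin n) :=
  WithLp.toLp 2 fun i => weakPartial f i x

/-- Membership in the weighted Sobolev space `ℋ^{1,r} = {f ∈ L^r : ∇f ∈ L^r, x f ∈ L^r}`. -/
def MemH {n : ℕ} (r : ℝ≥0∞) (f : Rn n → ℂ) : Prop :=
  MemLp f r ∧ (∀ i, ∃ g, HasWeakPartial f i g ∧ MemLp g r) ∧
    MemLp (fun x => (‖x‖ : ℂ) * f x) r

/-- The norm `‖f‖_r + ‖∇f‖_r + ‖x f‖_r` of `ℋ^{1,r}`; it is used for functions with a weak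
gradient. -/
def normH {n : ℕ} (r : ℝ≥0∞) (f : Rn n → ℂ) : ℝ≥0∞ :=
  eLpNorm f r + eLpNorm (weakGrad f) r + eLpNorm (fun x => (‖x‖ : ℂ) * f x) r

/-- The first order term `A · ∇ f`, where `A(x) = M x`. -/
def rotDeriv {n : ℕ} (M : Matrix (Fin n) (Fin n) ℝ) (f : Rn n → ℂ) (x : Rn n) : ℂ :=
  ∑ j, (((M *ᵥ x.ofLp) j : ℝ) : ℂ) * weakPartial f j x

/-- The time interval `[0, T)`, with `T = ∞` allowed. -/
def timeInterval (T : EReal) : Set ℝ := {t | 0 ≤ t ∧ (t : EReal) < T}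

/-- A real coefficient on `ℝⁿ` that is measurable, bounded on bounded sets, and radial. -/
structure IsRadialCoeff {n : ℕ} (V : Rn n → ℝ) : Prop where
  measurable : Measurable V
  bounded : ∀ R : ℝ, ∃ C : ℝ, ∀ x, ‖x‖ ≤ R → |V x| ≤ C
  radial : ∀ x y, ‖x‖ = ‖y‖ → V x = V y

/-- The potentials `sgn(γ) γ² |x|²`, attractive or repulsive, are admissible. -/
theorem isRadialCoeff_harmonic {n : ℕ} (γ : ℝ) :
    IsRadialCoeff (fun x : Rn n => Real.sign γ * γ ^ 2 * ‖x‖ ^ 2) where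
  measurable := by fun_prop
  bounded R := ⟨|Real.sign γ * γ ^ 2| * R ^ 2, fun x hx => by
    rw [abs_mul, abs_of_nonneg (sq_nonneg ‖x‖)]
    gcongr⟩
  radial x y h := by simp only [h]

/-- Constants (such as the coupling constant `-1` of the focusing equation) are admissible. -/
theorem isRadialCoeff_const {n : ℕ} (c : ℝ) : IsRadialCoeff (fun _ : Rn n => c) where
  measurable := measurable_const
  bounded _ := ⟨|c|, fun _ _ => le_rfl⟩
  radial _ _ _ := rfl

/-- The right-hand side `-Δf + V f + μ |f|^{4/n} f + i A·∇f`, as a distribution evaluated at the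
test function `φ`. -/
def rhs {n : ℕ} (M : Matrix (Fin n) (Fin n) ℝ) (V μ : Rn n → ℝ) (f : Rn n → ℂ)
    (φ : Rn n → ℝ) : ℂ :=
  -(∫ x, f x * ((Laplacian.laplacian φ x : ℝ) : ℂ))
    + (∫ x, (V x : ℂ) * f x * (φ x : ℂ))
    + (∫ x, (μ x : ℂ) * ((‖f x‖ ^ (4 / (n : ℝ)) : ℝ) : ℂ) * f x * (φ x : ℂ))
    + Complex.I * ∫ x, rotDeriv M f x * (φ x : ℂ)

/-- `u` is a solution on `[0, T)` of the Cauchy problem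
`i ∂ₜu = -Δu + V u + μ |u|^{4/n} u + i A·∇u`, `u(0) = u₀`, with `A(x) = M x`, in the class
`C([0,T), Σ) ∩ L^q_loc([0,T), ℋ^{1,r})`, where `Σ = ℋ^{1,2}` and `q = r = (2n+4)/n`.
The equation holds in the sense of distributions, in its time-integrated form. -/
structure IsSolution {n : ℕ} (M : Matrix (Fin n) (Fin n) ℝ) (V μ : Rn n → ℝ) (T : EReal)
    (u₀ : Rn n → ℂ) (u : ℝ → Rn n → ℂ) : Prop where
  initial : u 0 =ᵐ[volume] u₀
  mem : ∀ t ∈ timeInterval T, MemH 2 (u t)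
  continuous : ∀ t ∈ timeInterval T,
    Tendsto (fun s => normH 2 (u s - u t)) (𝓝[timeInterval T] t) (𝓝 0)
  mem_strichartz : ∀ᵐ t, t ∈ timeInterval T →
    MemH (ENNReal.ofReal ((2 * n + 4) / n)) (u t)
  strichartz : ∀ S ∈ timeInterval T,
    ∫⁻ t in Set.Icc 0 S,
      normH (ENNReal.ofReal ((2 * n + 4) / n)) (u t) ^ ((2 * n + 4) / n : ℝ) < ⊤
  equation : ∀ φ : Rn n → ℝ, IsTest φ → ∀ t ∈ timeInterval T,
    IntervalIntegrable (fun s => rhs M V μ (u s) φ) volume 0 t ∧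
      Complex.I * ((∫ x, u t x * (φ x : ℂ)) - ∫ x, u₀ x * (φ x : ℂ))
        = ∫ s in (0 : ℝ)..t, rhs M V μ (u s) φ

/-- The angular momentum `ℓ_A(f) = i ∫ f̄ A·∇f`. -/
def angularMomentum {n : ℕ} (M : Matrix (Fin n) (Fin n) ℝ) (f : Rn n → ℂ) : ℂ :=
  Complex.I * ∫ x, conj (f x) * rotDeriv M f x

/-- The block-diagonal skew-symmetric matrix `M_Ω` with the `2 × 2` diagonal blocks
`Ωⱼ (0 -1; 1 0)`, followed by a zero row and column if `n` is odd. -/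
def blockMatrix (n : ℕ) (Ω : Fin (n / 2) → ℝ) : Matrix (Fin n) (Fin n) ℝ :=
  Matrix.of fun i k => ∑ j : Fin (n / 2), Ω j *
    ((if (i : ℕ) = 2 * j + 1 ∧ (k : ℕ) = 2 * j then 1 else 0)
      - (if (i : ℕ) = 2 * j ∧ (k : ℕ) = 2 * j + 1 then 1 else 0))

/-- The angular momentum operator `Lⱼ = -i (x₁ ∂₂ - x₂ ∂₁)` in the `j`-th coordinate plane,
where `x₁, x₂` stand for the two coordinates of this plane. -/
def planeL {n : ℕ} (j : Fin (n / 2)) (f : Rn n → ℂ) (x : Rn n) : ℂ :=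
  (-Complex.I) * ((x ⟨2 * j, by omega⟩ : ℂ) * weakPartial f ⟨2 * j + 1, by omega⟩ x
    - (x ⟨2 * j + 1, by omega⟩ : ℂ) * weakPartial f ⟨2 * j, by omega⟩ x)

/-- The angular momentum `ℓ_Ω(f) = -⟨Ω·L f, f⟩`, with `⟨g, f⟩ = ∫ g f̄`. -/
def angularMomentumΩ {n : ℕ} (Ω : Fin (n / 2) → ℝ) (f : Rn n → ℂ) : ℂ :=
  -∫ x, (∑ j, (Ω j : ℂ) * planeL j f x) * conj (f x)

end RNLS

end

/-!
Conservation of the angular momentum rests on two facts about the skew field `A(x) = M x`. It is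
divergence free and tangential to spheres, so that `∫ h A·∇G = 0` for every radial weight `h`
(`integral_radial_mul_rotSum`); hence the terms `V u` and `μ |u|^{4/n} u` do not change
`∫ ū A·∇u` (`re_integral_source_eq_zero`), and `ℓ_A` is real (`angularMomentum_im`). And `A·∇`
commutes with the Laplacian, because the commutator `[∇, A·∇] = Mᵀ∇` is skew
(`re_sum_integral_pderiv_weight`).

A solution is too rough to differentiate `∫ ū A·∇u` in time. The operator `A·∇` is replaced by
`K = P (χ A·∇) P`, where `P` is the convolution with an even bump function and `χ` is a smooth
radial cutoff (`angOp`). It is skew and maps `L²` to test functions, so the equation may be tested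
with `conj (K u(t))`. The increments of `∫ ū K u` over short time intervals are then expressed by
the equation with frozen test functions, and a Riemann sum argument gives
`d/dt ∫ ū K u = 2i Re Λ(conj K u)`, where `Λ` is the spatial part of the equation in weak form
(`sub_eq_integral_of_increment`, `IsSolution.integral_conj_mul_angOp_sub`).

As the mollifier shrinks, `Re Λ(conj K u)` converges to the defect `Re ∫ (∇u·∇χ) conj(A·∇u)`
(`tendsto_re_weakForm_conj_angOp`), dominated in time by `‖u‖²_{H¹} + ‖u‖^r_{W^{1,r}}`
(`exists_abs_re_weakForm_conj_angOp_le`, `IsSolution.integrableOn_sobNorm`). This is the point where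
`q = r = (2n+4)/n` enters: `|u|^{4/n} u` lies in the dual of `L^r`, and the resulting bound is
integrable in time. Finally `χ` tends to `1`: `∇χ` is of size `1/|x|`, which compensates the growth
of `A`, and lives far away, so the defect tends to zero (`exists_abs_defect_cutoff_le`), while
`ū A·∇u` is integrable because `|x| u` and `∇u` are in `L²`.
-/

namespace RNLS

variable {n : ℕ}

/-! ### Mollification by bump functions -/

theorem exists_forall_norm_lt_eq_zero {F : Type*} [Zero F] {g : Rn n → F}
    (hg : HasCompactSupport g) : ∃ R : ℝ, ∀ x, R < ‖x‖ → g x = 0 := by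
  obtain ⟨R, hR⟩ := hg.isBounded.subset_closedBall 0
  refine ⟨R, fun x hx => image_eq_zero_of_notMem_tsupport fun h => ?_⟩
  have := hR h
  rw [mem_closedBall_zero_iff] at this
  exact this.not_gt hx

theorem hasCompactSupport_of_forall_norm_lt {F : Type*} [Zero F] {g : Rn n → F} {R : ℝ}
    (hg : ∀ x, R < ‖x‖ → g x = 0) : HasCompactSupport g :=
  HasCompactSupport.of_support_subset_isCompact (isCompact_closedBall (0 : Rn n) R) fun x hx => by
    by_contra h
    exact hx (hg x (by simpa using h))

/-- The mollification `ρ ∗ f` of `f`, where `ρ` is the normalised smooth bump function `φ`. -/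
noncomputable def moll (φ : ContDiffBump (0 : Rn n)) (f : Rn n → ℂ) : Rn n → ℂ :=
  convolution (φ.normed volume) f (ContinuousLinearMap.lsmul ℝ ℝ) volume

theorem moll_apply (φ : ContDiffBump (0 : Rn n)) (f : Rn n → ℂ) (x : Rn n) :
    moll φ f x = ∫ t, (φ.normed volume t : ℂ) * f (x - t) := by
  simp [moll, convolution_lsmul]

theorem moll_apply_swap (φ : ContDiffBump (0 : Rn n)) (f : Rn n → ℂ) (x : Rn n) :
    moll φ f x = ∫ t, f t * (φ.normed volume (x - t) : ℂ) := by
  simp [moll, convolution_lsmul_swap, mul_comm]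

theorem moll_congr_ae (φ : ContDiffBump (0 : Rn n)) {f g : Rn n → ℂ} (h : f =ᵐ[volume] g) :
    moll φ f = moll φ g := by
  ext x
  rw [moll_apply_swap, moll_apply_swap]
  refine integral_congr_ae ?_
  filter_upwards [h] with t ht
  rw [ht]

theorem moll_contDiff (φ : ContDiffBump (0 : Rn n)) {f : Rn n → ℂ} (hf : LocallyIntegrable f) :
    ContDiff ℝ ∞ (moll φ f) :=
  φ.hasCompactSupport_normed.contDiff_convolution_left _ φ.contDiff_normed hf

theorem integrable_moll_integrand (φ : ContDiffBump (0 : Rn n)) {f : Rn n → ℂ}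
    (hf : LocallyIntegrable f) (x : Rn n) :
    Integrable fun t => f t * (φ.normed volume (x - t) : ℂ) := by
  have hc : HasCompactSupport fun t => φ.normed volume (x - t) := by
    simpa [Function.comp_def] using
      (φ.hasCompactSupport_normed (μ := volume)).comp_homeomorph (Homeomorph.subLeft x)
  have := hf.integrable_smul_left_of_hasCompactSupport
    (g := fun t => φ.normed volume (x - t))
    (φ.continuous_normed.comp (continuous_const.sub continuous_id)) hc
  simpa [mul_comm] using this

theorem moll_sub (φ : ContDiffBump (0 : Rn n)) {f g : Rn n → ℂ} (hf : LocallyIntegrable f)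
    (hg : LocallyIntegrable g) : moll φ (f - g) = moll φ f - moll φ g := by
  ext x
  simp only [moll_apply_swap, Pi.sub_apply, sub_mul]
  exact integral_sub (integrable_moll_integrand φ hf x) (integrable_moll_integrand φ hg x)

theorem isTest_normed_sub (φ : ContDiffBump (0 : Rn n)) (x : Rn n) :
    IsTest fun t => φ.normed volume (x - t) := by
  refine ⟨(φ.contDiff_normed (μ := volume)).comp (contDiff_const.sub contDiff_id), ?_⟩
  simpa [Function.comp_def] using
      (φ.hasCompactSupport_normed (μ := volume)).comp_homeomorph (Homeomorph.subLeft x)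

theorem fderiv_moll_apply (φ : ContDiffBump (0 : Rn n)) {f : Rn n → ℂ}
    (hf : LocallyIntegrable f) (x v : Rn n) :
    fderiv ℝ (moll φ f) x v = ∫ t, f t * (fderiv ℝ (φ.normed volume) (x - t) v : ℂ) := by
  have h := (φ.hasCompactSupport_normed (μ := volume)).hasFDerivAt_convolution_left
    (ContinuousLinearMap.lsmul ℝ ℝ) φ.contDiff_normed hf x
  rw [moll, h.fderiv, convolution_eq_swap, ContinuousLinearMap.integral_apply]
  · refine integral_congr_ae (ae_of_all _ fun t => ?_)
    simp [ContinuousLinearMap.precompL_apply, mul_comm]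
  · have := ((φ.hasCompactSupport_normed (μ := volume)).fderiv ℝ).convolutionExists_left
      (ContinuousLinearMap.precompL (Rn n) (ContinuousLinearMap.lsmul ℝ ℝ))
      ((φ.contDiff_normed (n := 1)).continuous_fderiv (by simp)) hf x
    exact this.integrable_swap

/-- Weak derivatives commute with mollification. -/
theorem fderiv_moll_single (φ : ContDiffBump (0 : Rn n)) {f g : Rn n → ℂ} {k : Fin n}
    (h : HasWeakPartial f k g) (x : Rn n) :
    fderiv ℝ (moll φ f) x (EuclideanSpace.single k 1) = moll φ g x := by
  have h2 := h.2.2 _ (isTest_normed_sub φ x)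
  rw [fderiv_moll_apply φ h.1, moll_apply_swap, ← neg_inj, ← h2, ← integral_neg]
  refine integral_congr_ae (ae_of_all _ fun t => ?_)
  have hd : HasFDerivAt (fun t => φ.normed volume (x - t))
      ((fderiv ℝ (φ.normed volume) (x - t)).comp (-ContinuousLinearMap.id ℝ (Rn n))) t := by
    have h1 : DifferentiableAt ℝ (φ.normed volume) (x - t) :=
      (φ.contDiff_normed (μ := volume) (n := 1)).differentiable (by simp) _
    exact h1.hasFDerivAt.comp t ((hasFDerivAt_id t).const_sub x)
  simp only []
  rw [hd.fderiv]
  simp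

theorem moll_eq_zero (φ : ContDiffBump (0 : Rn n)) {f : Rn n → ℂ} {R : ℝ}
    (hf : ∀ x, R < ‖x‖ → f x = 0) {x : Rn n} (hx : R + φ.rOut < ‖x‖) : moll φ f x = 0 := by
  rw [moll_apply_swap]
  refine integral_eq_zero_of_ae (ae_of_all _ fun t => ?_)
  by_cases ht : R < ‖t‖
  · simp [hf t ht]
  · have h1 : φ.rOut ≤ ‖x - t‖ := by
      have := norm_sub_norm_le x t
      linarith [not_lt.1 ht]
    have : φ.normed volume (x - t) = 0 := by
      rw [← Function.notMem_support, φ.support_normed_eq]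
      simpa using h1
    simp [this]

/-- Mollification is symmetric, since the bump function is even. -/
theorem integral_moll_mul (φ : ContDiffBump (0 : Rn n)) {f g : Rn n → ℂ}
    (hf : LocallyIntegrable f) (hg : Continuous g) (hg' : HasCompactSupport g) :
    ∫ x, moll φ f x * g x = ∫ x, f x * moll φ g x := by
  have hgi : Integrable g := hg.integrable_of_hasCompactSupport hg'
  obtain ⟨R, hgR⟩ := exists_forall_norm_lt_eq_zero hg'
  set B := Metric.closedBall (0 : Rn n) (R + φ.rOut)
  have hfB : Integrable (B.indicator f) :=
    (integrable_indicator_iff Metric.isClosed_closedBall.measurableSet).2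
      (hf.integrableOn_isCompact (isCompact_closedBall _ _))
  have key : Integrable (fun z : Rn n × Rn n =>
      f z.2 * (φ.normed volume (z.1 - z.2) : ℂ) * g z.1) (volume.prod volume) := by
    have h1 := hgi.mul_prod hfB
    have hρ : Continuous fun z : Rn n × Rn n => (φ.normed volume (z.1 - z.2) : ℂ) :=
      Complex.continuous_ofReal.comp (φ.continuous_normed.comp (continuous_fst.sub continuous_snd))
    obtain ⟨C, hC⟩ := φ.continuous_normed (μ := volume).bounded_above_of_compact_support
      φ.hasCompactSupport_normed
    refine (h1.bdd_mul (c := C) hρ.aestronglyMeasurable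
      (ae_of_all _ fun z => by simpa using hC _)).congr (ae_of_all _ fun z => ?_)
    simp only []
    by_cases hz : z.2 ∈ B
    · rw [Set.indicator_of_mem hz]; ring
    · rw [Set.indicator_of_notMem hz]
      by_cases hz1 : R < ‖z.1‖
      · simp [hgR _ hz1]
      · have h2 : φ.rOut ≤ ‖z.1 - z.2‖ := by
          have := norm_sub_norm_le z.2 z.1
          rw [norm_sub_rev] at this
          have h3 : R + φ.rOut < ‖z.2‖ := by simpa [B] using hz
          linarith [not_lt.1 hz1]
        have : φ.normed volume (z.1 - z.2) = 0 := by
          rw [← Function.notMem_support, φ.support_normed_eq]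
          simpa using h2
        simp [this]
  calc ∫ x, moll φ f x * g x
      = ∫ x, ∫ t, f t * (φ.normed volume (x - t) : ℂ) * g x := by
        simp_rw [moll_apply_swap, integral_mul_const]
    _ = ∫ t, ∫ x, f t * (φ.normed volume (x - t) : ℂ) * g x := integral_integral_swap key
    _ = ∫ x, f x * moll φ g x := by
        simp_rw [moll_apply_swap, ← integral_const_mul]
        refine integral_congr_ae (ae_of_all _ fun t => integral_congr_ae (ae_of_all _ fun x => ?_))
        simp only []
        rw [← neg_sub x t, φ.normed_neg]
        ring

theorem moll_conj (φ : ContDiffBump (0 : Rn n)) (f : Rn n → ℂ) (x : Rn n) :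
    moll φ (fun y => conj (f y)) x = conj (moll φ f x) := by
  rw [moll_apply, moll_apply, ← integral_conj]
  simp

/-- Mollification is a contraction on `L^p`: Jensen's inequality for the probability density `ρ`,
and Tonelli's theorem. -/
theorem eLpNorm_moll_le (φ : ContDiffBump (0 : Rn n)) {f : Rn n → ℂ} {p : ℝ≥0∞} (hp : 1 ≤ p)
    (hp' : p ≠ ⊤) (hf : AEStronglyMeasurable f) : eLpNorm (moll φ f) p ≤ eLpNorm f p := by
  wlog hm : StronglyMeasurable f generalizing f
  · have := this (f := hf.mk f) hf.stronglyMeasurable_mk.aestronglyMeasurable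
      hf.stronglyMeasurable_mk
    rwa [moll_congr_ae φ hf.ae_eq_mk.symm, eLpNorm_congr_ae hf.ae_eq_mk.symm] at this
  have hp0 : p ≠ 0 := (zero_lt_one.trans_le hp).ne'
  have hr1 : 1 ≤ p.toReal := by
    simpa using (ENNReal.toReal_le_toReal (by simp) hp').2 hp
  have hr : 0 < p.toReal := zero_lt_one.trans_le hr1
  set ρ := fun t => ENNReal.ofReal (φ.normed volume t)
  have hρm : Measurable ρ := φ.continuous_normed.measurable.ennreal_ofReal
  have hρ1 : ∫⁻ t, ρ t = 1 := by
    rw [← ofReal_integral_eq_lintegral_ofReal φ.integrable_normed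
      (ae_of_all _ fun t => φ.nonneg_normed t), φ.integral_normed, ENNReal.ofReal_one]
  have : IsProbabilityMeasure (volume.withDensity ρ) := ⟨by simpa using hρ1⟩
  rw [eLpNorm_eq_eLpNorm' hp0 hp', eLpNorm_eq_eLpNorm' hp0 hp', eLpNorm', eLpNorm']
  refine ENNReal.rpow_le_rpow ?_ (by positivity)
  have hpt : ∀ x, ‖moll φ f x‖ₑ ^ p.toReal ≤ ∫⁻ t, ρ t * ‖f (x - t)‖ₑ ^ p.toReal := by
    intro x
    have hmx : StronglyMeasurable fun t => f (x - t) :=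
      hm.comp_measurable (measurable_const.sub measurable_id)
    have h1 : ‖moll φ f x‖ₑ ≤ ∫⁻ t, ‖f (x - t)‖ₑ ∂(volume.withDensity ρ) := by
      rw [lintegral_withDensity_eq_lintegral_mul _ hρm hmx.enorm, moll_apply]
      refine (enorm_integral_le_lintegral_enorm _).trans (lintegral_mono fun t => ?_)
      have h3 : ‖(φ.normed volume t : ℂ)‖ₑ = ρ t := by
        rw [← ofReal_norm, Complex.norm_real, Real.norm_of_nonneg (φ.nonneg_normed t)]
      simp [enorm_mul, h3]
    have h2 := eLpNorm'_le_eLpNorm'_of_exponent_le one_pos hr1 (volume.withDensity ρ)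
      hmx.aestronglyMeasurable
    simp only [eLpNorm', ENNReal.rpow_one, ne_eq, one_ne_zero, not_false_eq_true, div_self] at h2
    calc ‖moll φ f x‖ₑ ^ p.toReal ≤ _ := ENNReal.rpow_le_rpow (h1.trans h2) hr.le
      _ = ∫⁻ t, ‖f (x - t)‖ₑ ^ p.toReal ∂(volume.withDensity ρ) := by
        rw [← ENNReal.rpow_mul, one_div, inv_mul_cancel₀ hr.ne', ENNReal.rpow_one]
      _ = _ := lintegral_withDensity_eq_lintegral_mul _ hρm (hmx.enorm.pow_const _)
  calc ∫⁻ x, ‖moll φ f x‖ₑ ^ p.toReal ≤ ∫⁻ x, ∫⁻ t, ρ t * ‖f (x - t)‖ₑ ^ p.toReal :=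
        lintegral_mono hpt
    _ = ∫⁻ t, ∫⁻ x, ρ t * ‖f (x - t)‖ₑ ^ p.toReal := by
        refine lintegral_lintegral_swap (Measurable.aemeasurable ?_)
        exact (hρm.comp measurable_snd).mul
          ((hm.comp_measurable (measurable_fst.sub measurable_snd)).enorm.pow_const _)
    _ = ∫⁻ t, ρ t * ∫⁻ x, ‖f x‖ₑ ^ p.toReal := by
        refine lintegral_congr fun t => ?_
        rw [lintegral_const_mul]
        · rw [lintegral_sub_right_eq_self (fun x => ‖f x‖ₑ ^ p.toReal) t]
        · exact ((hm.comp_measurable (measurable_id.sub_const t)).enorm.pow_const _)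
    _ = ∫⁻ x, ‖f x‖ₑ ^ p.toReal := by
        rw [lintegral_mul_const _ hρm, hρ1, one_mul]

theorem memLp_moll (φ : ContDiffBump (0 : Rn n)) {f : Rn n → ℂ} {p : ℝ≥0∞} (hp : 1 ≤ p)
    (hp' : p ≠ ⊤) (hf : MemLp f p) : MemLp (moll φ f) p :=
  ⟨(moll_contDiff φ (hf.locallyIntegrable hp)).continuous.aestronglyMeasurable,
    (eLpNorm_moll_le φ hp hp' hf.1).trans_lt hf.2⟩

theorem eventually_eLpNorm_moll_sub_le {φ : ℕ → ContDiffBump (0 : Rn n)}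
    (hφ : Tendsto (fun i => (φ i).rOut) atTop (𝓝 0)) {g : Rn n → ℂ} {p : ℝ≥0∞}
    (hp' : p ≠ ⊤) (hg : Continuous g) (hgc : HasCompactSupport g) {ε : ℝ≥0∞} (hε : 0 < ε) :
    ∀ᶠ i in atTop, eLpNorm (moll (φ i) g - g) p ≤ ε := by
  obtain ⟨R, hgR⟩ := exists_forall_norm_lt_eq_zero hgc
  set s := Metric.closedBall (0 : Rn n) (R + 1) with hsdef
  have hs : volume s ≠ ⊤ := (isCompact_closedBall (0 : Rn n) (R + 1)).measure_ne_top
  have hsp : volume s ^ (1 / p.toReal) ≠ ⊤ := ENNReal.rpow_ne_top_of_nonneg (by positivity) hs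
  obtain ⟨c, hc0, hc⟩ : ∃ c : ℝ, 0 < c ∧ ENNReal.ofReal c * volume s ^ (1 / p.toReal) ≤ ε := by
    have ht : Tendsto (fun c : ℝ => ENNReal.ofReal c * volume s ^ (1 / p.toReal)) (𝓝[>] 0)
        (𝓝 0) := by
      have : Tendsto (fun c : ℝ => ENNReal.ofReal c * volume s ^ (1 / p.toReal)) (𝓝 0)
        (𝓝 (ENNReal.ofReal 0 * volume s ^ (1 / p.toReal))) :=
        ENNReal.Tendsto.mul_const (ENNReal.continuous_ofReal.tendsto 0) (Or.inr hsp)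
      rw [ENNReal.ofReal_zero, zero_mul] at this
      exact this.mono_left nhdsWithin_le_nhds
    obtain ⟨c, h1, h2⟩ := ((ht.eventually (ge_mem_nhds hε)).and self_mem_nhdsWithin).exists
    exact ⟨c, h2, h1⟩
  have hu : UniformContinuous g := hgc.uniformContinuous_of_continuous hg
  obtain ⟨δ, hδ0, hδ⟩ := Metric.uniformContinuous_iff.1 hu c hc0
  have hev : ∀ᶠ i in atTop, (φ i).rOut < min δ 1 :=
    hφ.eventually (gt_mem_nhds (lt_min hδ0 one_pos))
  filter_upwards [hev] with i hi
  have hi1 : (φ i).rOut < δ := hi.trans_le (min_le_left _ _)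
  have hi2 : (φ i).rOut < 1 := hi.trans_le (min_le_right _ _)
  have hout : ∀ x, x ∉ s → R + 1 < ‖x‖ := fun x hx => by simpa [hsdef] using hx
  refine (eLpNorm_sub_le_of_dist_bdd volume hp' Metric.isClosed_closedBall.measurableSet hc0.le
      (s := s) ?_ ?_ ?_).trans hc
  · intro x
    exact ContDiffBump.dist_normed_convolution_le hg.aestronglyMeasurable fun y hy =>
        (hδ (lt_trans hy hi1)).le
  · intro x hx
    by_contra h
    exact hx (moll_eq_zero (φ i) hgR (by linarith [hout x h]))
  · intro x hx
    by_contra h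
    exact hx (hgR x (by linarith [hout x h]))

/-- Mollifications converge in `L^p` as the radius of the bump functions tends to zero. -/
theorem tendsto_eLpNorm_moll_sub {φ : ℕ → ContDiffBump (0 : Rn n)}
    (hφ : Tendsto (fun i => (φ i).rOut) atTop (𝓝 0)) {f : Rn n → ℂ} {p : ℝ≥0∞} (hp : 1 ≤ p)
    (hp' : p ≠ ⊤) (hf : MemLp f p) :
    Tendsto (fun i => eLpNorm (moll (φ i) f - f) p) atTop (𝓝 0) := by
  rw [ENNReal.tendsto_nhds_zero]
  intro ε hε
  have hε3 : 0 < ε / 3 := ENNReal.div_pos hε.ne' (by simp)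
  obtain ⟨g, hgc, hfg, hg, hgp⟩ := hf.exists_hasCompactSupport_eLpNorm_sub_le hp' hε3.ne'
  filter_upwards [eventually_eLpNorm_moll_sub_le hφ hp' hg hgc hε3] with i hmid
  have hsplit : moll (φ i) f - f = moll (φ i) (f - g) + (moll (φ i) g - g) + (g - f) := by
    rw [moll_sub _ (hf.locallyIntegrable hp) (hgp.locallyIntegrable hp)]
    abel
  have h1 : MemLp (moll (φ i) (f - g)) p := memLp_moll _ hp hp' (hf.sub hgp)
  have h2 : MemLp (moll (φ i) g - g) p := (memLp_moll _ hp hp' hgp).sub hgp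
  have h3 : eLpNorm (moll (φ i) (f - g)) p ≤ ε / 3 :=
    (eLpNorm_moll_le _ hp hp' (hf.sub hgp).1).trans hfg
  have h4 : eLpNorm (g - f) p ≤ ε / 3 := by rwa [eLpNorm_sub_comm]
  rw [hsplit, ← ENNReal.add_thirds ε]
  refine (eLpNorm_add_le (h1.add h2).1 (hgp.sub hf).1 hp).trans (add_le_add ?_ h4)
  exact (eLpNorm_add_le h1.1 h2.1 hp).trans (add_le_add h3 hmid)

/-- A bound of `ρ ∗ f` and of its derivatives, uniform in space, by the `L²` norm of `f`. -/
theorem exists_norm_moll_le (φ : ContDiffBump (0 : Rn n)) :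
    ∃ C : ℝ, 0 ≤ C ∧ ∀ f : Rn n → ℂ, MemLp f 2 → ∀ x,
      ‖moll φ f x‖ ≤ C * (eLpNorm f 2).toReal ∧
      ∀ k, ‖fderiv ℝ (moll φ f) x (EuclideanSpace.single k 1)‖ ≤ C * (eLpNorm f 2).toReal := by
  have key : ∀ ρ : Rn n → ℝ, Continuous ρ → HasCompactSupport ρ → ∀ f : Rn n → ℂ, MemLp f 2 →
      ∀ x, ‖∫ t, f t * (ρ (x - t) : ℂ)‖ ≤ (eLpNorm ρ 2).toReal * (eLpNorm f 2).toReal := by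
    intro ρ hρ hρc f hf x
    have hρ2 : MemLp ρ 2 := hρ.memLp_of_hasCompactSupport hρc
    have hmp : MeasurePreserving (fun t : Rn n => x - t) volume volume :=
      Measure.measurePreserving_sub_left volume x
    have h1 : eLpNorm (fun t => ρ (x - t)) 2 = eLpNorm ρ 2 :=
      eLpNorm_comp_measurePreserving hρ2.1 hmp
    have hρx : MemLp (fun t => ρ (x - t)) 2 := hρ2.comp_measurePreserving hmp
    have h2 : ‖∫ t, f t * (ρ (x - t) : ℂ)‖ₑ ≤ eLpNorm ρ 2 * eLpNorm f 2 := by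
      refine (enorm_integral_le_lintegral_enorm _).trans ?_
      rw [← eLpNorm_one_eq_lintegral_enorm, ← h1]
      have := eLpNorm_smul_le_mul_eLpNorm (p := 2) (q := 2) (r := 1) hf.1 hρx.1
      refine le_trans (le_of_eq ?_) this
      congr 1
      ext t
      simp [mul_comm]
    have := (ENNReal.toReal_le_toReal (by simp)
      (ENNReal.mul_ne_top hρ2.2.ne hf.2.ne)).2 h2
    simpa [ENNReal.toReal_mul] using this
  have hd : ∀ k : Fin n, Continuous fun z : Rn n =>
      fderiv ℝ (φ.normed volume) z (EuclideanSpace.single k (1 : ℝ)) := fun k =>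
    ((φ.contDiff_normed (μ := volume) (n := 1)).continuous_fderiv (by simp)).clm_apply
      continuous_const
  set N : Fin n → ℝ := fun k => (eLpNorm (fun z : Rn n =>
      fderiv ℝ (φ.normed volume) z (EuclideanSpace.single k (1 : ℝ))) 2).toReal with hN
  have hN0 : ∀ k, 0 ≤ N k := fun k => ENNReal.toReal_nonneg
  have hC : (eLpNorm (φ.normed volume) 2 volume).toReal ≤
      (eLpNorm (φ.normed volume) 2 volume).toReal + ∑ k, N k :=
    le_add_of_nonneg_right (Finset.sum_nonneg fun k _ => hN0 k)
  refine ⟨(eLpNorm (φ.normed volume) 2 volume).toReal + ∑ k, N k,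
    ENNReal.toReal_nonneg.trans hC, fun f hf x => ⟨?_, fun k => ?_⟩⟩
  · rw [moll_apply_swap]
    exact (key _ φ.continuous_normed φ.hasCompactSupport_normed f hf x).trans
      (mul_le_mul_of_nonneg_right hC ENNReal.toReal_nonneg)
  · rw [fderiv_moll_apply φ (hf.locallyIntegrable one_le_two)]
    refine (key _ (hd k) ((φ.hasCompactSupport_normed (μ := volume)).fderiv_apply ℝ _) f hf
      x).trans (mul_le_mul_of_nonneg_right ?_ ENNReal.toReal_nonneg)
    exact (Finset.single_le_sum (fun k _ => hN0 k) (Finset.mem_univ k)).trans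
      (le_add_of_nonneg_left ENNReal.toReal_nonneg)

/-! ### The angular derivative and radial weights -/

/-- The classical partial derivative `∂ₖ v`. -/
noncomputable def pderiv (v : Rn n → ℂ) (k : Fin n) (x : Rn n) : ℂ :=
  fderiv ℝ v x (EuclideanSpace.single k 1)

/-- The first order expression `∑ⱼ (M x)ⱼ gⱼ(x)`, that is, `A · g` for `A(x) = M x` and a vector
`g` of functions standing for a weak or classical gradient. -/
noncomputable def rotSum (M : Matrix (Fin n) (Fin n) ℝ) (g : Fin n → Rn n → ℂ) (x : Rn n) : ℂ :=
  ∑ j, (((M *ᵥ x.ofLp) j : ℝ) : ℂ) * g j x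

theorem rotDeriv_eq_rotSum (M : Matrix (Fin n) (Fin n) ℝ) (f : Rn n → ℂ) :
    rotDeriv M f = rotSum M (weakPartial f) := rfl

theorem fderiv_toEuclideanCLM (M : Matrix (Fin n) (Fin n) ℝ) (v : Rn n → ℂ) (x : Rn n) :
    fderiv ℝ v x (Matrix.toEuclideanCLM (𝕜 := ℝ) M x) = rotSum M (pderiv v) x := by
  have h : Matrix.toEuclideanCLM (𝕜 := ℝ) M x
      = ∑ j, (M *ᵥ x.ofLp) j • EuclideanSpace.single j (1 : ℝ) := by
    conv_lhs => rw [← (EuclideanSpace.basisFun (Fin n) ℝ).sum_repr (Matrix.toEuclideanCLM (𝕜 := ℝ) M x)]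
    simp [Matrix.ofLp_toEuclideanCLM]
  rw [h, map_sum, rotSum]
  simp [pderiv]

/-- A bounded measurable weight with bounded support. -/
structure IsWeight (h : Rn n → ℝ) : Prop where
  measurable : Measurable h
  bounded : ∃ C : ℝ, ∀ x, |h x| ≤ C
  support : ∃ R : ℝ, ∀ x, R < ‖x‖ → h x = 0

/-- A bounded measurable radial weight with bounded support. -/
structure IsRadialWeight (h : Rn n → ℝ) : Prop extends IsWeight h where
  radial : ∀ x y, ‖x‖ = ‖y‖ → h x = h y

theorem IsWeight.mul_coeff {χ V : Rn n → ℝ} (hχ : IsWeight χ)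
    (hV : IsRadialCoeff V) : IsWeight fun x => χ x * V x where
  measurable := hχ.measurable.mul hV.measurable
  bounded := by
    obtain ⟨C, hC⟩ := hχ.bounded
    obtain ⟨R, hR⟩ := hχ.support
    obtain ⟨C', hC'⟩ := hV.bounded R
    refine ⟨C * |C'|, fun x => ?_⟩
    have hC0 : 0 ≤ C := (abs_nonneg _).trans (hC x)
    by_cases hx : R < ‖x‖
    · rw [hR x hx, zero_mul, abs_zero]; positivity
    · rw [abs_mul]
      exact mul_le_mul (hC x) ((hC' x (not_lt.1 hx)).trans (le_abs_self _)) (abs_nonneg _) hC0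
  support := by
    obtain ⟨R, hR⟩ := hχ.support
    exact ⟨R, fun x hx => by rw [hR x hx, zero_mul]⟩

theorem IsRadialWeight.mul_coeff {χ V : Rn n → ℝ} (hχ : IsRadialWeight χ)
    (hV : IsRadialCoeff V) : IsRadialWeight fun x => χ x * V x where
  toIsWeight := hχ.toIsWeight.mul_coeff hV
  radial x y hxy := by rw [hχ.radial x y hxy, hV.radial x y hxy]

theorem IsWeight.integrable_mul {h : Rn n → ℝ} (hh : IsWeight h) {f : Rn n → ℂ}
    (hf : LocallyIntegrable f) : Integrable fun x => (h x : ℂ) * f x := by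
  obtain ⟨C, hC⟩ := hh.bounded
  obtain ⟨R, hR⟩ := hh.support
  have h1 : IntegrableOn f (Metric.closedBall 0 R) :=
    hf.integrableOn_isCompact (isCompact_closedBall _ _)
  have h2 : IntegrableOn (fun x => (h x : ℂ) * f x) (Metric.closedBall 0 R) :=
    h1.bdd_mul (c := C) (Complex.measurable_ofReal.comp hh.measurable).aestronglyMeasurable
      (ae_of_all _ fun x => by simpa using hC x)
  refine (integrableOn_iff_integrable_of_support_subset fun x hx => ?_).1 h2
  by_contra hx'
  exact hx (by simp [hR x (by simpa using hx')])

theorem isRadialWeight_indicator_closedBall (R : ℝ) :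
    IsRadialWeight ((Metric.closedBall (0 : Rn n) R).indicator fun _ => (1 : ℝ)) where
  measurable := measurable_const.indicator Metric.isClosed_closedBall.measurableSet
  bounded := ⟨1, fun x => by by_cases hx : x ∈ Metric.closedBall (0 : Rn n) R <;> simp [hx]⟩
  support := ⟨R, fun x hx => Set.indicator_of_notMem (by simpa using hx) _⟩
  radial x y hxy := by
    have hiff : x ∈ Metric.closedBall (0 : Rn n) R ↔ y ∈ Metric.closedBall (0 : Rn n) R := by
      rw [mem_closedBall_zero_iff, mem_closedBall_zero_iff, hxy]
    by_cases hx : x ∈ Metric.closedBall (0 : Rn n) R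
    · rw [Set.indicator_of_mem hx, Set.indicator_of_mem (hiff.1 hx)]
    · rw [Set.indicator_of_notMem hx, Set.indicator_of_notMem (hiff.not.1 hx)]

theorem isWeight_of_continuous {h : Rn n → ℝ} (hh : Continuous h) (hc : HasCompactSupport h) :
    IsWeight h where
  measurable := hh.measurable
  bounded := hh.bounded_above_of_compact_support hc
  support := exists_forall_norm_lt_eq_zero hc

/-- A radial weight is orthogonal to every derivative along a rotation field: the integral of
`h · (g ∘ e^{θM})` does not depend on `θ`, since `e^{θM}` is orthogonal, and its derivative at
`θ = 0` is `∫ h A·∇g`. -/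
theorem integral_radial_mul_rotSum {M : Matrix (Fin n) (Fin n) ℝ} (hM : Mᵀ = -M) {h : Rn n → ℝ}
    (hh : IsRadialWeight h) {g : Rn n → ℂ} (hg : ContDiff ℝ 1 g) :
    ∫ x, (h x : ℂ) * rotSum M (pderiv g) x = 0 := by
  set A : Rn n →L[ℝ] Rn n := Matrix.toEuclideanCLM (𝕜 := ℝ) M with hA
  have hAs : A ∈ skewAdjoint (Rn n →L[ℝ] Rn n) := by
    rw [skewAdjoint.mem_iff, hA, ← map_star, Matrix.star_eq_conjTranspose,
      Matrix.conjTranspose_eq_transpose_of_trivial, hM, map_neg]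
  have hU : ∀ θ : ℝ, NormedSpace.exp (θ • A) ∈ unitary (Rn n →L[ℝ] Rn n) := fun θ =>
    let _ : NormedAlgebra ℚ (Rn n →L[ℝ] Rn n) := NormedAlgebra.restrictScalars ℚ ℝ _
    NormedSpace.exp_mem_unitary_of_mem_skewAdjoint (skewAdjoint.smul_mem θ hAs)
  set U : ℝ → Rn n ≃ₗᵢ[ℝ] Rn n := fun θ => Unitary.linearIsometryEquiv ⟨_, hU θ⟩ with hUdef
  have hUx : ∀ θ x, U θ x = NormedSpace.exp (θ • A) x := fun θ x => rfl
  obtain ⟨C, hC⟩ := hh.bounded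
  obtain ⟨R, hR⟩ := hh.support
  have hconst : ∀ θ : ℝ, ∫ x, (h x : ℂ) * g (NormedSpace.exp (θ • A) x) = ∫ x, (h x : ℂ) * g x := by
    intro θ
    rw [← (U θ).measurePreserving.integral_comp' (f := (U θ).toMeasurableEquiv)
      (g := fun x => (h x : ℂ) * g x)]
    refine integral_congr_ae (ae_of_all _ fun x => ?_)
    have : h (NormedSpace.exp (θ • A) x) = h x := hh.radial _ _ ((U θ).norm_map x)
    simp only [LinearIsometryEquiv.coe_toMeasurableEquiv, hUx, this]
  have hgd : Continuous (fderiv ℝ g) := hg.continuous_fderiv (by simp)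
  obtain ⟨D, hD⟩ := (isCompact_closedBall (0 : Rn n) R).exists_bound_of_continuousOn
    hgd.continuousOn
  have hderiv : ∀ x θ, HasDerivAt (fun θ : ℝ => (h x : ℂ) * g (NormedSpace.exp (θ • A) x))
      ((h x : ℂ) * fderiv ℝ g (NormedSpace.exp (θ • A) x) (NormedSpace.exp (θ • A) (A x))) θ := by
    intro x θ
    have h1 := (hasDerivAt_exp_smul_const A θ).clm_apply (hasDerivAt_const θ x)
    have h2 := ((hg.differentiable (by simp)) (NormedSpace.exp (θ • A) x)).hasFDerivAt
    have h3 := h2.comp_hasDerivAt θ h1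
    simpa using h3.const_mul (h x : ℂ)
  have hmain := hasDerivAt_integral_of_dominated_loc_of_deriv_le (μ := (volume : Measure (Rn n)))
    (F := fun (θ : ℝ) x => (h x : ℂ) * g (NormedSpace.exp (θ • A) x))
    (F' := fun (θ : ℝ) x =>
      (h x : ℂ) * fderiv ℝ g (NormedSpace.exp (θ • A) x) (NormedSpace.exp (θ • A) (A x)))
    (x₀ := 0) (s := Set.univ)
    (bound := (Metric.closedBall (0 : Rn n) R).indicator fun _ => C * (D * (‖A‖ * R)))
    univ_mem ?_ ?_ ?_ ?_ ?_ ?_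
  · have h0 : HasDerivAt (fun θ : ℝ => ∫ x, (h x : ℂ) * g (NormedSpace.exp (θ • A) x)) 0 0 := by
      simp_rw [hconst]
      exact hasDerivAt_const _ _
    have h1 := hmain.2.unique h0
    rw [← h1]
    refine integral_congr_ae (ae_of_all _ fun x => ?_)
    have e0 : NormedSpace.exp ((0 : ℝ) • A) = 1 :=
      (congrArg NormedSpace.exp (zero_smul ℝ A)).trans NormedSpace.exp_zero
    simp only [← fderiv_toEuclideanCLM, ← hA, e0, one_apply_eq_self]
  · exact Eventually.of_forall fun θ =>
      ((Complex.measurable_ofReal.comp hh.measurable).mul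
        (hg.continuous.comp (ContinuousLinearMap.continuous _)).measurable).aestronglyMeasurable
  · exact hh.integrable_mul (hg.continuous.comp (ContinuousLinearMap.continuous _)).locallyIntegrable
  · refine ((Complex.measurable_ofReal.comp hh.measurable).mul (Continuous.measurable
      ((hgd.comp (ContinuousLinearMap.continuous _)).clm_apply
        ((ContinuousLinearMap.continuous _).comp A.continuous)))).aestronglyMeasurable
  · refine ae_of_all _ fun x θ _ => ?_
    by_cases hx : x ∈ Metric.closedBall (0 : Rn n) R
    · rw [Set.indicator_of_mem hx, norm_mul]
      have hx' : ‖x‖ ≤ R := by simpa using hx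
      have hn : ∀ y, ‖NormedSpace.exp (θ • A) y‖ = ‖y‖ := fun y => (U θ).norm_map y
      have hd := hD (NormedSpace.exp (θ • A) x) (by simpa [hn] using hx')
      have hC0 : 0 ≤ C := (abs_nonneg _).trans (hC x)
      have hD0 : 0 ≤ D := (norm_nonneg _).trans hd
      have h1 : ‖(h x : ℂ)‖ ≤ C := by simpa using hC x
      have h2 : ‖NormedSpace.exp (θ • A) (A x)‖ ≤ ‖A‖ * R := by
        rw [hn]
        exact (A.le_opNorm x).trans (by gcongr)
      exact mul_le_mul h1 ((ContinuousLinearMap.le_opNorm _ _).trans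
        (mul_le_mul hd h2 (norm_nonneg _) hD0)) (norm_nonneg _) hC0
    · rw [Set.indicator_of_notMem hx, hR x (by simpa using hx)]
      simp
  · exact (integrable_indicator_iff Metric.isClosed_closedBall.measurableSet).2
      (continuousOn_const.integrableOn_compact (isCompact_closedBall _ _))
  · exact ae_of_all _ fun x θ _ => hderiv x θ

/-! ### Convergence in `L^p` and the radial identity for weakly differentiable functions -/

theorem continuous_pderiv {v : Rn n → ℂ} (hv : ContDiff ℝ 1 v) (k : Fin n) :
    Continuous (pderiv v k) :=
  (hv.continuous_fderiv (by simp)).clm_apply continuous_const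

theorem continuous_rotSum (M : Matrix (Fin n) (Fin n) ℝ) {g : Fin n → Rn n → ℂ}
    (hg : ∀ j, Continuous (g j)) : Continuous (rotSum M g) := by
  refine continuous_finsetSum _ fun j _ => Continuous.mul ?_ (hg j)
  refine Complex.continuous_ofReal.comp ?_
  have : Continuous fun x : Rn n => M *ᵥ x.ofLp :=
    Continuous.matrix_mulVec continuous_const (PiLp.continuous_ofLp 2 _)
  exact (continuous_apply j).comp this

theorem rotSum_sub (M : Matrix (Fin n) (Fin n) ℝ) (g g' : Fin n → Rn n → ℂ) :
    rotSum M (g - g') = rotSum M g - rotSum M g' := by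
  ext x
  simp [rotSum, mul_sub, Finset.sum_sub_distrib]

theorem aestronglyMeasurable_rotSum (M : Matrix (Fin n) (Fin n) ℝ) {g : Fin n → Rn n → ℂ}
    (hg : ∀ j, AEStronglyMeasurable (g j)) : AEStronglyMeasurable (rotSum M g) := by
  have hx : ∀ j, Continuous fun x : Rn n => (((M *ᵥ x.ofLp) j : ℝ) : ℂ) := fun j => by
    refine Complex.continuous_ofReal.comp ?_
    have : Continuous fun x : Rn n => M *ᵥ x.ofLp :=
      Continuous.matrix_mulVec continuous_const (PiLp.continuous_ofLp 2 _)
    exact (continuous_apply j).comp this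
  exact Finset.aestronglyMeasurable_fun_sum _ fun j _ => (hx j).aestronglyMeasurable.mul (hg j)

theorem abs_mulVec_le (M : Matrix (Fin n) (Fin n) ℝ) (x : Rn n) (j : Fin n) :
    |(M *ᵥ x.ofLp) j| ≤ ‖Matrix.toEuclideanCLM (𝕜 := ℝ) M‖ * ‖x‖ := by
  have h1 : |(M *ᵥ x.ofLp) j| ≤ ‖Matrix.toEuclideanCLM (𝕜 := ℝ) M x‖ := by
    have := PiLp.norm_apply_le (Matrix.toEuclideanCLM (𝕜 := ℝ) M x) j
    simpa [Matrix.ofLp_toEuclideanCLM] using this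
  exact h1.trans (ContinuousLinearMap.le_opNorm _ _)

theorem exists_norm_weight_mul_le (M : Matrix (Fin n) (Fin n) ℝ) {h : Rn n → ℝ}
    (hh : IsWeight h) : ∃ C : ℝ, 0 ≤ C ∧
      ∀ x j, ‖(h x : ℂ) * (((M *ᵥ x.ofLp) j : ℝ) : ℂ)‖ ≤ C := by
  obtain ⟨C, hC⟩ := hh.bounded
  obtain ⟨R, hR⟩ := hh.support
  have hC0 : 0 ≤ C := (abs_nonneg _).trans (hC 0)
  refine ⟨C * (‖Matrix.toEuclideanCLM (𝕜 := ℝ) M‖ * |R|), by positivity, fun x j => ?_⟩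
  by_cases hx : R < ‖x‖
  · rw [hR x hx]; simp; positivity
  · rw [norm_mul, Complex.norm_real, Complex.norm_real]
    refine mul_le_mul (hC x) ((abs_mulVec_le M x j).trans ?_) (norm_nonneg _) hC0
    gcongr
    exact (not_lt.1 hx).trans (le_abs_self R)

theorem exists_norm_weight_mul_rotSum_le (M : Matrix (Fin n) (Fin n) ℝ) {h : Rn n → ℝ}
    (hh : IsWeight h) : ∃ C : ℝ, 0 ≤ C ∧
      ∀ (g : Fin n → Rn n → ℂ) x, ‖(h x : ℂ) * rotSum M g x‖ ≤ C * ∑ j, ‖g j x‖ := by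
  obtain ⟨C, hC0, hC⟩ := exists_norm_weight_mul_le M hh
  refine ⟨C, hC0, fun g x => ?_⟩
  rw [rotSum, Finset.mul_sum, Finset.mul_sum]
  refine (norm_sum_le _ _).trans (Finset.sum_le_sum fun j _ => ?_)
  rw [← mul_assoc, norm_mul]
  exact mul_le_mul_of_nonneg_right (hC x j) (norm_nonneg _)

theorem exists_eLpNorm_weight_mul_rotSum_le (M : Matrix (Fin n) (Fin n) ℝ) {h : Rn n → ℝ}
    (hh : IsWeight h) : ∃ C : ℝ, 0 ≤ C ∧
      ∀ (p : ℝ≥0∞), 1 ≤ p → ∀ g : Fin n → Rn n → ℂ, (∀ j, AEStronglyMeasurable (g j)) →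
        eLpNorm (fun x => (h x : ℂ) * rotSum M g x) p ≤
          ENNReal.ofReal C * ∑ j, eLpNorm (g j) p := by
  obtain ⟨C, hC0, hC⟩ := exists_norm_weight_mul_rotSum_le M hh
  refine ⟨C, hC0, fun p hp g hg => ?_⟩
  have h1 : eLpNorm (fun x => (h x : ℂ) * rotSum M g x) p ≤
      ENNReal.ofReal C * eLpNorm (∑ j, fun x => ‖g j x‖) p := by
    refine eLpNorm_le_mul_eLpNorm_of_ae_le_mul (ae_of_all _ fun x => ?_) p
    have h2 := hC g x
    rwa [Finset.sum_apply, Real.norm_of_nonneg (Finset.sum_nonneg fun j _ => norm_nonneg _)]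
  refine h1.trans (mul_le_mul_right ?_ _)
  refine (eLpNorm_sum_le (fun j _ => (hg j).norm) hp).trans (Finset.sum_le_sum fun j _ => ?_)
  rw [eLpNorm_norm]

theorem memLp_weight_mul_rotSum (M : Matrix (Fin n) (Fin n) ℝ) {h : Rn n → ℝ}
    (hh : IsWeight h) {p : ℝ≥0∞} (hp : 1 ≤ p) {g : Fin n → Rn n → ℂ}
    (hg : ∀ j, MemLp (g j) p) : MemLp (fun x => (h x : ℂ) * rotSum M g x) p := by
  obtain ⟨C, -, hC⟩ := exists_eLpNorm_weight_mul_rotSum_le M hh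
  refine ⟨(Complex.measurable_ofReal.comp hh.measurable).aestronglyMeasurable.mul
    (aestronglyMeasurable_rotSum M fun j => (hg j).1), (hC p hp g fun j => (hg j).1).trans_lt ?_⟩
  exact ENNReal.mul_lt_top ENNReal.ofReal_lt_top (ENNReal.sum_lt_top.2 fun j _ => (hg j).2)

theorem tendsto_eLpNorm_weight_mul_rotSum (M : Matrix (Fin n) (Fin n) ℝ) {h : Rn n → ℝ}
    (hh : IsWeight h) {p : ℝ≥0∞} (hp : 1 ≤ p) {g : Fin n → Rn n → ℂ}
    {G : ℕ → Fin n → Rn n → ℂ} (hg : ∀ j, AEStronglyMeasurable (g j))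
    (hG : ∀ i j, AEStronglyMeasurable (G i j))
    (hlim : ∀ j, Tendsto (fun i => eLpNorm (G i j - g j) p) atTop (𝓝 0)) :
    Tendsto (fun i => eLpNorm ((fun x => (h x : ℂ) * rotSum M (G i) x)
      - fun x => (h x : ℂ) * rotSum M g x) p) atTop (𝓝 0) := by
  obtain ⟨C, -, hC⟩ := exists_eLpNorm_weight_mul_rotSum_le M hh
  have h0 : Tendsto (fun i => ENNReal.ofReal C * ∑ j, eLpNorm (G i j - g j) p) atTop (𝓝 0) := by
    have h1 : Tendsto (fun i => ∑ j, eLpNorm (G i j - g j) p) atTop (𝓝 (∑ _j : Fin n, 0)) :=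
      tendsto_finsetSum Finset.univ fun j _ => hlim j
    have := ENNReal.Tendsto.const_mul (a := ENNReal.ofReal C) h1 (Or.inr ENNReal.ofReal_ne_top)
    rwa [Finset.sum_const_zero, mul_zero] at this
  refine tendsto_of_tendsto_of_tendsto_of_le_of_le tendsto_const_nhds h0 (fun _ => zero_le) ?_
  intro i
  have e : ((fun x => (h x : ℂ) * rotSum M (G i) x) - fun x => (h x : ℂ) * rotSum M g x)
      = fun x => (h x : ℂ) * rotSum M (G i - g) x := by
    ext x
    rw [rotSum_sub, Pi.sub_apply, Pi.sub_apply, mul_sub]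
  have h2 := hC p hp (G i - g) fun j => (hG i j).sub (hg j)
  rw [← e] at h2
  exact h2

/-- Products of sequences that converge in `L^p` and in the dual `L^q` converge in `L¹`. -/
theorem tendsto_eLpNorm_mul_sub {p q : ℝ≥0∞} [p.HolderTriple q 1] (hp : 1 ≤ p)
    {a : Rn n → ℂ} {b : Rn n → ℂ} {A B : ℕ → Rn n → ℂ} (ha : MemLp a p) (hb : MemLp b q)
    (hA : ∀ i, MemLp (A i) p) (hB : ∀ i, MemLp (B i) q)
    (hAa : Tendsto (fun i => eLpNorm (A i - a) p) atTop (𝓝 0))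
    (hBb : Tendsto (fun i => eLpNorm (B i - b) q) atTop (𝓝 0)) :
    Tendsto (fun i => eLpNorm (A i * B i - a * b) 1) atTop (𝓝 0) := by
  have hle : ∀ i, eLpNorm (A i * B i - a * b) 1 ≤
      (eLpNorm (A i - a) p + eLpNorm a p) * eLpNorm (B i - b) q
        + eLpNorm (A i - a) p * eLpNorm b q := by
    intro i
    have e : A i * B i - a * b = A i • (B i - b) + (A i - a) • b := by
      simp only [smul_eq_mul]; ring
    rw [e]
    have m1 : AEStronglyMeasurable (A i • (B i - b)) := (hA i).1.smul ((hB i).1.sub hb.1)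
    have m2 : AEStronglyMeasurable ((A i - a) • b) := ((hA i).1.sub ha.1).smul hb.1
    refine (eLpNorm_add_le m1 m2 le_rfl).trans (add_le_add ?_ ?_)
    · refine (eLpNorm_smul_le_mul_eLpNorm (p := p) (q := q) ((hB i).1.sub hb.1) (hA i).1).trans ?_
      gcongr
      have := eLpNorm_add_le ((hA i).1.sub ha.1) ha.1 hp
      simpa using this
    · exact eLpNorm_smul_le_mul_eLpNorm (p := p) (q := q) hb.1 ((hA i).1.sub ha.1)
  refine tendsto_of_tendsto_of_tendsto_of_le_of_le tendsto_const_nhds ?_ (fun _ => zero_le) hle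
  have h1 : Tendsto (fun i => (eLpNorm (A i - a) p + eLpNorm a p) * eLpNorm (B i - b) q) atTop
      (𝓝 ((0 + eLpNorm a p) * 0)) :=
    ENNReal.Tendsto.mul (hAa.add tendsto_const_nhds) (by simp) hBb (by simp [ha.2.ne])
  have h2 : Tendsto (fun i => eLpNorm (A i - a) p * eLpNorm b q) atTop (𝓝 (0 * eLpNorm b q)) :=
    ENNReal.Tendsto.mul_const hAa (Or.inr hb.2.ne)
  simpa using h1.add h2

theorem tendsto_integral_mul {p q : ℝ≥0∞} [p.HolderTriple q 1] (hp : 1 ≤ p)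
    {a : Rn n → ℂ} {b : Rn n → ℂ} {A B : ℕ → Rn n → ℂ} (ha : MemLp a p) (hb : MemLp b q)
    (hA : ∀ i, MemLp (A i) p) (hB : ∀ i, MemLp (B i) q)
    (hAa : Tendsto (fun i => eLpNorm (A i - a) p) atTop (𝓝 0))
    (hBb : Tendsto (fun i => eLpNorm (B i - b) q) atTop (𝓝 0)) :
    Tendsto (fun i => ∫ x, A i x * B i x) atTop (𝓝 (∫ x, a x * b x)) :=
  tendsto_integral_of_L1' (fun x => a x * b x) (MemLp.integrable_mul ha hb).1
    (Eventually.of_forall fun i => MemLp.integrable_mul (hA i) (hB i))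
    (tendsto_eLpNorm_mul_sub hp ha hb hA hB hAa hBb)

theorem rotSum_pderiv_comp_norm_sq (M : Matrix (Fin n) (Fin n) ℝ) {v : Rn n → ℂ}
    (hv : ContDiff ℝ 1 v) {Θ : ℝ → ℝ} (hΘ : ContDiff ℝ 1 Θ) (x : Rn n) :
    rotSum M (pderiv fun y => ((Θ (‖v y‖ ^ 2) : ℝ) : ℂ)) x
      = ((2 * (deriv Θ (‖v x‖ ^ 2) * (conj (v x) * rotSum M (pderiv v) x).re) : ℝ) : ℂ) := by
  have hd : ∀ k, pderiv (fun y => ((Θ (‖v y‖ ^ 2) : ℝ) : ℂ)) k x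
      = ((2 * (deriv Θ (‖v x‖ ^ 2) * (conj (v x) * pderiv v k x).re) : ℝ) : ℂ) := by
    intro k
    have h1 := ((hv.differentiable (by simp)) x).hasFDerivAt.norm_sq
    have h2 := ((hΘ.differentiable (by simp)) (‖v x‖ ^ 2)).hasDerivAt.comp_hasFDerivAt x h1
    have h3 := (Complex.ofRealCLM.hasFDerivAt).comp x h2
    have h4 : fderiv ℝ (fun y => ((Θ (‖v y‖ ^ 2) : ℝ) : ℂ)) x = _ := h3.fderiv
    rw [pderiv, h4]
    simp only [ContinuousLinearMap.comp_apply, smul_apply, innerSL_apply_apply,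
      Complex.ofRealCLM_apply, smul_eq_mul, Complex.inner, pderiv, Complex.ofReal_inj, nsmul_eq_mul]
    push_cast
    rw [mul_comm (conj (v x))]
    ring
  simp only [rotSum, hd, Finset.mul_sum, Complex.re_sum]
  push_cast
  refine Finset.sum_congr rfl fun j _ => ?_
  have : (conj (v x) * ((((M *ᵥ x.ofLp) j : ℝ) : ℂ) * pderiv v j x)).re
      = (M *ᵥ x.ofLp) j * (conj (v x) * pderiv v j x).re := by
    rw [mul_left_comm, Complex.re_ofReal_mul]
  rw [this]
  push_cast
  ring

theorem contDiff_primitive {θ : ℝ → ℝ} (hθ : Continuous θ) :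
    ContDiff ℝ 1 (fun y => ∫ s in (0 : ℝ)..y, θ s) ∧
      deriv (fun y => ∫ s in (0 : ℝ)..y, θ s) = θ := by
  have h : ∀ y, HasDerivAt (fun y => ∫ s in (0 : ℝ)..y, θ s) (θ y) y := fun y =>
    intervalIntegral.integral_hasDerivAt_right (hθ.intervalIntegrable _ _)
      (hθ.stronglyMeasurableAtFilter _ _) hθ.continuousAt
  have hd : deriv (fun y => ∫ s in (0 : ℝ)..y, θ s) = θ := funext fun y => (h y).deriv
  exact ⟨contDiff_one_iff_deriv.2 ⟨fun y => (h y).differentiableAt, by rwa [hd]⟩, hd⟩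

theorem re_integral_weight_smooth_eq_zero {M : Matrix (Fin n) (Fin n) ℝ} (hM : Mᵀ = -M)
    {h : Rn n → ℝ} (hh : IsRadialWeight h) {θ : ℝ → ℝ} (hθ : Continuous θ) {v : Rn n → ℂ}
    (hv : ContDiff ℝ 1 v) :
    (∫ x, ((θ (‖v x‖ ^ 2) : ℝ) : ℂ) * (conj (v x) * ((h x : ℂ) * rotSum M (pderiv v) x))).re
      = 0 := by
  obtain ⟨hΘ, hΘd⟩ := contDiff_primitive hθ
  set Θ : ℝ → ℝ := fun y => ∫ s in (0 : ℝ)..y, θ s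
  have hG : ContDiff ℝ 1 fun y => ((Θ (‖v y‖ ^ 2) : ℝ) : ℂ) :=
    Complex.ofRealCLM.contDiff.comp (hΘ.comp (hv.norm_sq ℝ))
  have h1 := integral_radial_mul_rotSum hM hh hG
  simp_rw [rotSum_pderiv_comp_norm_sq M hv hΘ, hΘd] at h1
  have hint : Integrable fun x =>
      ((θ (‖v x‖ ^ 2) : ℝ) : ℂ) * (conj (v x) * ((h x : ℂ) * rotSum M (pderiv v) x)) := by
    have hc : Continuous fun x =>
        ((θ (‖v x‖ ^ 2) : ℝ) : ℂ) * (conj (v x) * rotSum M (pderiv v) x) :=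
      (Complex.continuous_ofReal.comp (hθ.comp (hv.continuous.norm.pow 2))).mul
        ((Complex.continuous_conj.comp hv.continuous).mul
          (continuous_rotSum M (continuous_pderiv hv)))
    refine (hh.integrable_mul hc.locallyIntegrable).congr (ae_of_all _ fun x => ?_)
    ring
  have h2 : ∫ x, ((h x * (2 * (θ (‖v x‖ ^ 2) * (conj (v x) * rotSum M (pderiv v) x).re)) : ℝ) : ℂ)
      = 0 := by
    rw [← h1]; push_cast; rfl
  rw [integral_complex_ofReal, Complex.ofReal_eq_zero] at h2
  have h3 : ∫ x, (((θ (‖v x‖ ^ 2) : ℝ) : ℂ) *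
      (conj (v x) * ((h x : ℂ) * rotSum M (pderiv v) x))).re = 0 := by
    have h4 : ∀ x, (((θ (‖v x‖ ^ 2) : ℝ) : ℂ) *
      (conj (v x) * ((h x : ℂ) * rotSum M (pderiv v) x))).re = (1 / 2) *
        (h x * (2 * (θ (‖v x‖ ^ 2) * (conj (v x) * rotSum M (pderiv v) x).re))) := by
      intro x
      rw [Complex.re_ofReal_mul, mul_left_comm (conj (v x)), Complex.re_ofReal_mul]
      ring
    simp_rw [h4]
    rw [integral_const_mul, h2, mul_zero]
  exact (integral_re (𝕜 := ℂ) hint).symm.trans h3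

/-- A sequence of bump functions whose radii tend to zero. -/
noncomputable def bump (n i : ℕ) : ContDiffBump (0 : Rn n) where
  rIn := 1 / (2 * ((i : ℝ) + 1))
  rOut := 1 / ((i : ℝ) + 1)
  rIn_pos := by positivity
  rIn_lt_rOut := by
    apply one_div_lt_one_div_of_lt <;> linarith [(Nat.cast_nonneg i : (0 : ℝ) ≤ i)]

theorem tendsto_bump_rOut (n : ℕ) : Tendsto (fun i => (bump n i).rOut) atTop (𝓝 0) :=
  tendsto_one_div_add_atTop_nhds_zero_nat

theorem pderiv_moll (φ : ContDiffBump (0 : Rn n)) {f g : Rn n → ℂ} {k : Fin n}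
    (h : HasWeakPartial f k g) : pderiv (moll φ f) k = moll φ g :=
  funext fun x => fderiv_moll_single φ h x

theorem eLpNorm_conj_sub (a b : Rn n → ℂ) (p : ℝ≥0∞) :
    eLpNorm ((fun x => conj (a x)) - fun x => conj (b x)) p = eLpNorm (a - b) p := by
  refine eLpNorm_congr_norm_ae (ae_of_all _ fun x => ?_)
  simp [← map_sub]

theorem memLp_conj {f : Rn n → ℂ} {p : ℝ≥0∞} (hf : MemLp f p) :
    MemLp (fun x => conj (f x)) p :=
  hf.congr_norm (Complex.continuous_conj.comp_aestronglyMeasurable hf.1) (by simp)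

/-- Rotation invariance of the density `Θ(|f|²)`, with `Θ' = θ`: against a radial weight its
derivative `2 θ(|f|²) Re (f̄ A·∇f)` integrates to zero. The smooth case is transferred by
mollification. -/
theorem re_integral_weight_eq_zero {M : Matrix (Fin n) (Fin n) ℝ} (hM : Mᵀ = -M)
    {h : Rn n → ℝ} (hh : IsRadialWeight h) {θ : ℝ → ℝ} (hθ : Continuous θ) {B : ℝ}
    (hB : ∀ y, |θ y| ≤ B) {f : Rn n → ℂ} {g : Fin n → Rn n → ℂ} (hf : MemLp f 2)
    (hg : ∀ k, MemLp (g k) 2) (hfg : ∀ k, HasWeakPartial f k (g k)) :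
    (∫ x, ((θ (‖f x‖ ^ 2) : ℝ) : ℂ) * (conj (f x) * ((h x : ℂ) * rotSum M g x))).re = 0 := by
  have h12 : (1 : ℝ≥0∞) ≤ 2 := one_le_two
  have h2t : (2 : ℝ≥0∞) ≠ ⊤ := by simp
  set v : ℕ → Rn n → ℂ := fun i => moll (bump n i) f with hv
  have hv2 : ∀ i, MemLp (v i) 2 := fun i => memLp_moll _ h12 h2t hf
  have hvc : ∀ i, ContDiff ℝ 1 (v i) := fun i =>
    (moll_contDiff _ (hf.locallyIntegrable h12)).of_le (by simp)
  have hvf : Tendsto (fun i => eLpNorm (v i - f) 2) atTop (𝓝 0) :=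
    tendsto_eLpNorm_moll_sub (tendsto_bump_rOut n) h12 h2t hf
  have hpv : ∀ i k, pderiv (v i) k = moll (bump n i) (g k) := fun i k => pderiv_moll _ (hfg k)
  obtain ⟨ns, hns, hae⟩ := (tendstoInMeasure_of_tendsto_eLpNorm (by simp)
    (fun i => (hv2 i).1) hf.1 hvf).exists_seq_tendsto_ae
  set b : Rn n → ℂ := fun x => (h x : ℂ) * rotSum M g x
  set bi : ℕ → Rn n → ℂ := fun i x => (h x : ℂ) * rotSum M (pderiv (v i)) x
  have hb : MemLp b 2 := memLp_weight_mul_rotSum M hh.toIsWeight h12 hg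
  have hpv2 : ∀ i k, MemLp (pderiv (v i) k) 2 := fun i k => by
    rw [hpv]; exact memLp_moll _ h12 h2t (hg k)
  have hbi : ∀ i, MemLp (bi i) 2 := fun i => memLp_weight_mul_rotSum M hh.toIsWeight h12 (hpv2 i)
  have hbb : Tendsto (fun i => eLpNorm (bi i - b) 2) atTop (𝓝 0) := by
    refine tendsto_eLpNorm_weight_mul_rotSum M hh.toIsWeight h12 (fun j => (hg j).1)
      (fun i j => (hpv2 i j).1) fun j => ?_
    simp_rw [hpv]
    exact tendsto_eLpNorm_moll_sub (tendsto_bump_rOut n) h12 h2t (hg j)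
  have hcv : Tendsto (fun i => eLpNorm ((fun x => conj (v i x)) * bi i
      - (fun x => conj (f x)) * b) 1) atTop (𝓝 0) := by
    refine tendsto_eLpNorm_mul_sub (p := 2) (q := 2) h12 (memLp_conj hf) hb
      (fun i => memLp_conj (hv2 i)) hbi ?_ hbb
    simpa only [eLpNorm_conj_sub] using hvf
  have hcvi : ∀ i, Integrable ((fun x => conj (v i x)) * bi i) := fun i =>
    MemLp.integrable_mul (p := 2) (q := 2) (memLp_conj (hv2 i)) (hbi i)
  have hci : Integrable ((fun x => conj (f x)) * b) :=
    MemLp.integrable_mul (p := 2) (q := 2) (memLp_conj hf) hb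
  have hθm : ∀ i, AEStronglyMeasurable fun x => ((θ (‖v i x‖ ^ 2) : ℝ) : ℂ) := fun i =>
    (Complex.continuous_ofReal.comp (hθ.comp ((hvc i).continuous.norm.pow 2))).aestronglyMeasurable
  have hθb : ∀ y, ‖((θ y : ℝ) : ℂ)‖ ≤ B := fun y => by simpa using hB y
  have hlim1 : Tendsto (fun i => ∫ x, ((θ (‖v (ns i) x‖ ^ 2) : ℝ) : ℂ) * (conj (f x) * b x)) atTop
      (𝓝 (∫ x, ((θ (‖f x‖ ^ 2) : ℝ) : ℂ) * (conj (f x) * b x))) := by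
    refine tendsto_integral_of_dominated_convergence (fun x => B * ‖conj (f x) * b x‖)
      (fun i => (hθm _).mul hci.1) (hci.norm.const_mul B)
      (fun i => ae_of_all _ fun x => ?_) ?_
    · rw [norm_mul]
      exact mul_le_mul_of_nonneg_right (hθb _) (norm_nonneg _)
    · filter_upwards [hae] with x hx
      exact ((Complex.continuous_ofReal.comp hθ).tendsto _ |>.comp (hx.norm.pow 2)).mul_const _
  have hlim2 : Tendsto (fun i => ∫ x, ((θ (‖v (ns i) x‖ ^ 2) : ℝ) : ℂ) *
      (conj (v (ns i) x) * bi (ns i) x - conj (f x) * b x)) atTop (𝓝 0) := by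
    have h0 : Tendsto (fun i => B * (eLpNorm ((fun x => conj (v (ns i) x)) * bi (ns i)
      - (fun x => conj (f x)) * b) 1).toReal) atTop (𝓝 0) := by
      have := ((ENNReal.tendsto_toReal ENNReal.zero_ne_top).comp
        (hcv.comp hns.tendsto_atTop)).const_mul B
      simpa using this
    refine squeeze_zero_norm (fun i => ?_) h0
    have hi := (hcvi (ns i)).sub hci
    have e : (eLpNorm ((fun x => conj (v (ns i) x)) * bi (ns i) - (fun x => conj (f x)) * b)
        1).toReal = ∫ x, ‖conj (v (ns i) x) * bi (ns i) x - conj (f x) * b x‖ := by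
      rw [eLpNorm_one_eq_lintegral_enorm]
      exact (integral_norm_eq_lintegral_enorm hi.1).symm
    rw [e, ← integral_const_mul]
    refine norm_integral_le_of_norm_le (hi.norm.const_mul B) (ae_of_all _ fun x => ?_)
    rw [norm_mul]
    exact mul_le_mul_of_nonneg_right (hθb _) (norm_nonneg _)
  have hlim : Tendsto (fun i => ∫ x, ((θ (‖v (ns i) x‖ ^ 2) : ℝ) : ℂ) *
      (conj (v (ns i) x) * bi (ns i) x)) atTop
      (𝓝 (∫ x, ((θ (‖f x‖ ^ 2) : ℝ) : ℂ) * (conj (f x) * b x))) := by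
    have := hlim2.add hlim1
    rw [zero_add] at this
    refine this.congr fun i => ?_
    have hi := (hcvi (ns i)).sub hci
    rw [← integral_add]
    · refine integral_congr_ae (ae_of_all _ fun x => ?_)
      ring
    · exact hi.bdd_mul (hθm _) (ae_of_all _ fun x => hθb _)
    · exact hci.bdd_mul (hθm _) (ae_of_all _ fun x => hθb _)
  have hre := (Complex.continuous_re.tendsto _).comp hlim
  refine tendsto_nhds_unique hre (tendsto_const_nhds.congr fun i => ?_)
  exact (re_integral_weight_smooth_eq_zero hM hh hθ (hvc (ns i))).symm

/-! ### Weak derivatives and cutoff functions -/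

theorem HasWeakPartial.unique {f g g' : Rn n → ℂ} {k : Fin n} (h : HasWeakPartial f k g)
    (h' : HasWeakPartial f k g') : g =ᵐ[volume] g' := by
  refine ae_eq_of_integral_contDiff_smul_eq h.2.1 h'.2.1 fun φ hφ hφc => ?_
  have h1 := h.2.2 φ ⟨hφ, hφc⟩
  rw [h'.2.2 φ ⟨hφ, hφc⟩, neg_inj] at h1
  simpa [mul_comm] using h1.symm

theorem hasWeakPartial_weakPartial {f g : Rn n → ℂ} {k : Fin n} (h : HasWeakPartial f k g) :
    HasWeakPartial f k (weakPartial f k) := by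
  have h' : ∃ g, HasWeakPartial f k g := ⟨g, h⟩
  rw [weakPartial, dif_pos h']
  exact Classical.choose_spec h'

theorem HasWeakPartial.congr_ae {f f' g g' : Rn n → ℂ} {k : Fin n} (h : HasWeakPartial f k g)
    (hf : f =ᵐ[volume] f') (hg : g =ᵐ[volume] g') : HasWeakPartial f' k g' := by
  refine ⟨h.1.congr hf, h.2.1.congr hg, fun φ hφ => ?_⟩
  have h1 := h.2.2 φ hφ
  have e1 : ∫ x, f x * (fderiv ℝ φ x (EuclideanSpace.single k 1) : ℂ)
      = ∫ x, f' x * (fderiv ℝ φ x (EuclideanSpace.single k 1) : ℂ) :=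
    integral_congr_ae (hf.mul (ae_eq_refl _))
  have e2 : ∫ x, g x * (φ x : ℂ) = ∫ x, g' x * (φ x : ℂ) :=
    integral_congr_ae (hg.mul (ae_eq_refl _))
  rwa [e1, e2] at h1

theorem IsTest.fderiv_single {φ : Rn n → ℝ} (hφ : IsTest φ) (k : Fin n) :
    IsTest fun x => fderiv ℝ φ x (EuclideanSpace.single k 1) :=
  ⟨(hφ.1.fderiv_right (m := ∞) (by simp)).clm_apply contDiff_const, hφ.2.fderiv_apply ℝ _⟩

theorem IsTest.integrable_mul {φ : Rn n → ℝ} (hφ : IsTest φ) {f : Rn n → ℂ}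
    (hf : LocallyIntegrable f) : Integrable fun x => f x * (φ x : ℂ) := by
  have := hf.integrable_smul_left_of_hasCompactSupport hφ.1.continuous hφ.2
  simpa [mul_comm] using this

theorem HasWeakPartial.sub {f f' g g' : Rn n → ℂ} {k : Fin n} (h : HasWeakPartial f k g)
    (h' : HasWeakPartial f' k g') : HasWeakPartial (f - f') k (g - g') := by
  refine ⟨h.1.sub h'.1, h.2.1.sub h'.2.1, fun φ hφ => ?_⟩
  simp only [Pi.sub_apply, sub_mul]
  rw [integral_sub ((hφ.fderiv_single k).integrable_mul h.1)
    ((hφ.fderiv_single k).integrable_mul h'.1),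
    integral_sub (hφ.integrable_mul h.2.1) (hφ.integrable_mul h'.2.1), h.2.2 φ hφ, h'.2.2 φ hφ]
  ring

theorem weakPartial_sub_ae {f f' g g' : Rn n → ℂ} {k : Fin n} (h : HasWeakPartial f k g)
    (h' : HasWeakPartial f' k g') :
    weakPartial (f - f') k =ᵐ[volume] weakPartial f k - weakPartial f' k :=
  (hasWeakPartial_weakPartial (h.sub h')).unique
    ((hasWeakPartial_weakPartial h).sub (hasWeakPartial_weakPartial h'))

theorem weakPartial_congr_ae {f f' : Rn n → ℂ} (h : f =ᵐ[volume] f') (k : Fin n) :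
    weakPartial f k = weakPartial f' k := by
  have : HasWeakPartial f k = HasWeakPartial f' k := by
    ext g
    exact ⟨fun hg => hg.congr_ae h (ae_eq_refl _), fun hg => hg.congr_ae h.symm (ae_eq_refl _)⟩
  unfold weakPartial
  rw [this]

theorem MemH.hasWeakPartial {r : ℝ≥0∞} {f : Rn n → ℂ} (h : MemH r f) (k : Fin n) :
    HasWeakPartial f k (weakPartial f k) :=
  hasWeakPartial_weakPartial (h.2.1 k).choose_spec.1

theorem MemH.memLp_weakPartial {r : ℝ≥0∞} {f : Rn n → ℂ} (h : MemH r f) (k : Fin n) :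
    MemLp (weakPartial f k) r :=
  (memLp_congr_ae ((h.hasWeakPartial k).unique (h.2.1 k).choose_spec.1)).2
    (h.2.1 k).choose_spec.2

theorem eLpNorm_weakPartial_le (r : ℝ≥0∞) (f : Rn n → ℂ) (k : Fin n) :
    eLpNorm (weakPartial f k) r ≤ eLpNorm (weakGrad f) r :=
  eLpNorm_mono fun x => PiLp.norm_apply_le (weakGrad f x) k

/-- The radial cutoff, equal to `1` on the ball of radius `R` and to `0` outside the ball of
radius `2R`. -/
noncomputable def cutoff (R : ℝ) (x : Rn n) : ℝ := Real.smoothTransition (2 - ‖x‖ ^ 2 / R ^ 2)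

theorem cutoff_contDiff (R : ℝ) : ContDiff ℝ ∞ (cutoff R : Rn n → ℝ) :=
  Real.smoothTransition.contDiff.comp
    (contDiff_const.sub ((contDiff_norm_sq ℝ).div_const _))

theorem cutoff_eq_one {R : ℝ} (hR : 0 < R) {x : Rn n} (hx : ‖x‖ ≤ R) : cutoff R x = 1 := by
  refine Real.smoothTransition.one_of_one_le ?_
  have : ‖x‖ ^ 2 / R ^ 2 ≤ 1 := by
    rw [div_le_one (by positivity)]
    gcongr
  linarith

theorem cutoff_eq_zero {R : ℝ} (hR : 0 < R) {x : Rn n} (hx : 2 * R < ‖x‖) : cutoff R x = 0 := by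
  refine Real.smoothTransition.zero_of_nonpos ?_
  have : 2 ≤ ‖x‖ ^ 2 / R ^ 2 := by
    rw [le_div_iff₀ (by positivity)]
    nlinarith
  linarith

theorem abs_cutoff_le (R : ℝ) (x : Rn n) : |cutoff R x| ≤ 1 := by
  rw [cutoff, abs_of_nonneg (Real.smoothTransition.nonneg _)]
  exact Real.smoothTransition.le_one _

theorem isRadialWeight_cutoff {R : ℝ} (hR : 0 < R) : IsRadialWeight (cutoff R : Rn n → ℝ) where
  measurable := (cutoff_contDiff R).continuous.measurable
  bounded := ⟨1, abs_cutoff_le R⟩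
  support := ⟨2 * R, fun _ hx => cutoff_eq_zero hR hx⟩
  radial x y h := by simp only [cutoff, h]

theorem exists_abs_deriv_smoothTransition_le :
    ∃ C : ℝ, 0 ≤ C ∧ ∀ x, |deriv Real.smoothTransition x| ≤ C := by
  have hc : Continuous (deriv Real.smoothTransition) :=
    (Real.smoothTransition.contDiff (n := 1)).continuous_deriv (by simp)
  obtain ⟨C, hC⟩ := (isCompact_Icc (a := (0 : ℝ)) (b := 1)).exists_bound_of_continuousOn
    hc.continuousOn
  refine ⟨|C|, abs_nonneg _, fun x => ?_⟩
  by_cases h0 : x < 0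
  · have : Real.smoothTransition =ᶠ[𝓝 x] fun _ => 0 := by
      filter_upwards [gt_mem_nhds h0] with y hy using
        Real.smoothTransition.zero_of_nonpos (le_of_lt hy)
    rw [this.deriv_eq]; simp
  by_cases h1 : 1 < x
  · have : Real.smoothTransition =ᶠ[𝓝 x] fun _ => 1 := by
      filter_upwards [lt_mem_nhds h1] with y hy using
        Real.smoothTransition.one_of_one_le (le_of_lt hy)
    rw [this.deriv_eq]; simp
  exact (hC x ⟨not_lt.1 h0, not_lt.1 h1⟩).trans (le_abs_self C)

/-- The gradient of the cutoff at `x` is at most `C / ‖x‖`, uniformly in `R`, and vanishes for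
`‖x‖ < R`. -/
theorem exists_norm_fderiv_cutoff_le : ∃ C : ℝ, 0 ≤ C ∧ ∀ R : ℝ, 0 < R → ∀ (x : Rn n) (k : Fin n),
    |fderiv ℝ (cutoff R) x (EuclideanSpace.single k 1)| * ‖x‖ ≤ C ∧
    (‖x‖ < R → fderiv ℝ (cutoff R) x (EuclideanSpace.single k 1) = 0) := by
  obtain ⟨D, hD0, hD⟩ := exists_abs_deriv_smoothTransition_le
  refine ⟨8 * D, by positivity, fun R hR x k => ⟨?_, fun hx => ?_⟩⟩
  · by_cases hx : 2 * R < ‖x‖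
    · have : (cutoff R : Rn n → ℝ) =ᶠ[𝓝 x] fun _ => 0 := by
        filter_upwards [(isOpen_lt continuous_const continuous_norm).mem_nhds hx] with y hy using
          cutoff_eq_zero hR hy
      rw [this.fderiv_eq]
      simp; positivity
    have h1 : HasFDerivAt (fun y : Rn n => 2 - ‖y‖ ^ 2 / R ^ 2)
        (-((R ^ 2)⁻¹ • ((2 : ℕ) • innerSL ℝ x))) x := by
      have := ((hasFDerivAt_id x).norm_sq.mul_const (R ^ 2)⁻¹).const_sub 2
      simpa [div_eq_mul_inv] using this
    have h2 := ((Real.smoothTransition.contDiff (n := 1)).differentiable (by simp)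
      (2 - ‖x‖ ^ 2 / R ^ 2)).hasDerivAt.comp_hasFDerivAt x h1
    have h3 : fderiv ℝ (cutoff R) x = _ := h2.fderiv
    have h4 : |x k| ≤ ‖x‖ := PiLp.norm_apply_le x k
    have h5 : ‖x‖ ^ 2 / R ^ 2 ≤ 4 := by
      rw [div_le_iff₀ (by positivity)]
      nlinarith [norm_nonneg x, not_lt.1 hx]
    have h6 : fderiv ℝ (cutoff R) x (EuclideanSpace.single k 1)
        = -(deriv Real.smoothTransition (2 - ‖x‖ ^ 2 / R ^ 2) * ((R ^ 2)⁻¹ * (2 * x k))) := by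
      rw [h3]
      simp [EuclideanSpace.inner_single_right]
    rw [h6, abs_neg, abs_mul, abs_mul, abs_mul, abs_of_nonneg (by positivity : 0 ≤ (R ^ 2)⁻¹),
      abs_two]
    calc _ ≤ D * ((R ^ 2)⁻¹ * (2 * ‖x‖)) * ‖x‖ := by gcongr; exact hD _
      _ = 2 * D * (‖x‖ ^ 2 / R ^ 2) := by ring
      _ ≤ 2 * D * 4 := by gcongr
      _ = 8 * D := by ring
  · have : (cutoff R : Rn n → ℝ) =ᶠ[𝓝 x] fun _ => 1 := by
      filter_upwards [(isOpen_lt continuous_norm continuous_const).mem_nhds hx] with y hy using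
        cutoff_eq_one hR (le_of_lt hy)
    rw [this.fderiv_eq]
    simp

/-! ### The regularised angular momentum operator -/

theorem contDiff_pderiv {v : Rn n → ℂ} (hv : ContDiff ℝ ∞ v) (k : Fin n) :
    ContDiff ℝ ∞ (pderiv v k) :=
  (hv.fderiv_right (m := ∞) (by simp)).clm_apply contDiff_const

theorem hasFDerivAt_mulVec (M : Matrix (Fin n) (Fin n) ℝ) (j : Fin n) (x : Rn n) :
    HasFDerivAt (fun x : Rn n => (((M *ᵥ x.ofLp) j : ℝ) : ℂ))
      (Complex.ofRealCLM.comp ((EuclideanSpace.proj (𝕜 := ℝ) j).comp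
        (Matrix.toEuclideanCLM (𝕜 := ℝ) M))) x := by
  have := (Complex.ofRealCLM.comp ((EuclideanSpace.proj (𝕜 := ℝ) j).comp
        (Matrix.toEuclideanCLM (𝕜 := ℝ) M))).hasFDerivAt (x := x)
  refine this.congr_of_eventuallyEq (Eventually.of_forall fun y => ?_)
  simp [Matrix.ofLp_toEuclideanCLM]

theorem contDiff_rotSum (M : Matrix (Fin n) (Fin n) ℝ) {v : Rn n → ℂ} (hv : ContDiff ℝ ∞ v) :
    ContDiff ℝ ∞ (rotSum M (pderiv v)) := by
  refine ContDiff.sum fun j _ => ContDiff.mul ?_ (contDiff_pderiv hv j)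
  have e : (fun x : Rn n => (((M *ᵥ x.ofLp) j : ℝ) : ℂ)) = Complex.ofRealCLM.comp
      ((EuclideanSpace.proj (𝕜 := ℝ) j).comp (Matrix.toEuclideanCLM (𝕜 := ℝ) M)) := by
    ext y
    simp [Matrix.ofLp_toEuclideanCLM]
  rw [e]
  exact ContinuousLinearMap.contDiff _

theorem pderiv_pderiv_comm {v : Rn n → ℂ} (hv : ContDiff ℝ ∞ v) (j k : Fin n) (x : Rn n) :
    pderiv (pderiv v j) k x = pderiv (pderiv v k) j x := by
  have h2 : (2 : ℕ∞ω) ≤ (∞ : ℕ∞ω) := WithTop.coe_le_coe.2 (le_top : (2 : ℕ∞) ≤ ⊤)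
  have hd : DifferentiableAt ℝ (fderiv ℝ v) x :=
    (hv.fderiv_right (m := ∞) (by simp)).differentiable (by simp) x
  have h : ∀ j k : Fin n, pderiv (pderiv v j) k x
      = fderiv ℝ (fderiv ℝ v) x (EuclideanSpace.single k 1) (EuclideanSpace.single j 1) := by
    intro j k
    have := (hd.hasFDerivAt.clm_apply
      (hasFDerivAt_const (EuclideanSpace.single j (1 : ℝ) : Rn n) x)).fderiv
    refine (congrArg (fun L : Rn n →L[ℝ] ℂ => L (EuclideanSpace.single k 1)) this).trans ?_
    simp
  rw [h, h]
  exact (hv.contDiffAt.isSymmSndFDerivAt (by simpa using h2)).eq _ _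

theorem pderiv_mul {a b : Rn n → ℂ} (ha : ContDiff ℝ ∞ a) (hb : ContDiff ℝ ∞ b) (k : Fin n)
    (x : Rn n) :
    pderiv (fun y => a y * b y) k x = pderiv a k x * b x + a x * pderiv b k x := by
  have := ((ha.differentiable (by simp) x).hasFDerivAt.mul
    (hb.differentiable (by simp) x).hasFDerivAt).fderiv
  rw [pderiv]
  refine (congrArg (fun L : Rn n →L[ℝ] ℂ => L (EuclideanSpace.single k 1)) this).trans ?_
  simp [pderiv]
  ring

theorem pderiv_ofReal {χ : Rn n → ℝ} (hχ : ContDiff ℝ ∞ χ) (k : Fin n) (x : Rn n) :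
    pderiv (fun y => (χ y : ℂ)) k x = (fderiv ℝ χ x (EuclideanSpace.single k 1) : ℂ) := by
  have := (Complex.ofRealCLM.hasFDerivAt.comp x
    (hχ.differentiable (by simp) x).hasFDerivAt).fderiv
  rw [pderiv]
  exact (congrArg (fun L : Rn n →L[ℝ] ℂ => L (EuclideanSpace.single k 1)) this).trans (by simp)

theorem pderiv_conj {v : Rn n → ℂ} (hv : ContDiff ℝ ∞ v) (k : Fin n) (x : Rn n) :
    pderiv (fun y => conj (v y)) k x = conj (pderiv v k x) := by
  have := (Complex.conjCLE.toContinuousLinearMap.hasFDerivAt.comp x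
    (hv.differentiable (by simp) x).hasFDerivAt).fderiv
  rw [pderiv]
  exact (congrArg (fun L : Rn n →L[ℝ] ℂ => L (EuclideanSpace.single k 1)) this).trans
    (by simp [pderiv])

/-- The commutator of `∂ₖ` with `A·∇` is the first order operator `∑ⱼ Mⱼₖ ∂ⱼ`. -/
theorem pderiv_rotSum (M : Matrix (Fin n) (Fin n) ℝ) {v : Rn n → ℂ} (hv : ContDiff ℝ ∞ v)
    (k : Fin n) (x : Rn n) :
    pderiv (rotSum M (pderiv v)) k x
      = ∑ j, (M j k : ℂ) * pderiv v j x + rotSum M (pderiv (pderiv v k)) x := by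
  have h : ∀ j, HasFDerivAt (fun x : Rn n => (((M *ᵥ x.ofLp) j : ℝ) : ℂ) * pderiv v j x) _ x :=
    fun j => (hasFDerivAt_mulVec M j x).mul
      ((contDiff_pderiv hv j).differentiable (by simp) x).hasFDerivAt
  have h2 : HasFDerivAt (rotSum M (pderiv v)) _ x := HasFDerivAt.fun_sum fun j _ => h j
  rw [pderiv, h2.fderiv, rotSum, ← Finset.sum_add_distrib, sum_apply]
  refine Finset.sum_congr rfl fun j _ => ?_
  rw [← pderiv_pderiv_comm hv j k x]
  simp [Matrix.ofLp_toEuclideanCLM, pderiv]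
  ring

theorem hasWeakPartial_pderiv {v : Rn n → ℂ} (hv : ContDiff ℝ ∞ v) (k : Fin n) :
    HasWeakPartial v k (pderiv v k) := by
  have hc := (contDiff_pderiv hv k).continuous
  refine ⟨hv.continuous.locallyIntegrable, hc.locallyIntegrable, fun φ hφ => ?_⟩
  have hφc : ∀ x, fderiv ℝ (fun y => (φ y : ℂ)) x (EuclideanSpace.single k 1)
      = (fderiv ℝ φ x (EuclideanSpace.single k 1) : ℂ) := pderiv_ofReal hφ.1 k
  have := integral_mul_fderiv_eq_neg_fderiv_mul_of_integrable (μ := volume) (f := v)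
    (g := fun y => (φ y : ℂ)) (v := EuclideanSpace.single k (1 : ℝ)) (hφ.integrable_mul
      hc.locallyIntegrable) ?_ (hφ.integrable_mul hv.continuous.locallyIntegrable)
      (fun x _ => hv.differentiable (by simp) x)
      (fun x _ => (Complex.ofRealCLM.contDiff.comp hφ.1).differentiable (by simp) x)
  · simp only [hφc] at this
    exact this
  · simp only [hφc]
    exact (hφ.fderiv_single k).integrable_mul hv.continuous.locallyIntegrable

/-- The energy identity behind conservation: for smooth `v`, the form `∇v · ∇(χ A·∇v)` has, up to
the gradient of the cutoff, vanishing real part. The commutator `[∇, A·∇] = Mᵀ∇` contributes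
nothing because `M` is skew, and `χ A·∇` is skew on each `∂ₖv`. -/
theorem re_sum_integral_pderiv_weight {M : Matrix (Fin n) (Fin n) ℝ} (hM : Mᵀ = -M)
    {χ : Rn n → ℝ} (hχr : IsRadialWeight χ) (hχ : ContDiff ℝ ∞ χ) {v : Rn n → ℂ}
    (hv : ContDiff ℝ ∞ v) :
    (∑ k, ∫ x, pderiv v k x * conj (pderiv (fun y => (χ y : ℂ) * rotSum M (pderiv v) y) k x)).re
      = (∑ k, ∫ x, pderiv v k x *
        conj ((fderiv ℝ χ x (EuclideanSpace.single k 1) : ℂ) * rotSum M (pderiv v) x)).re := by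
  have hχc : HasCompactSupport χ := by
    obtain ⟨R, hR⟩ := hχr.support
    exact hasCompactSupport_of_forall_norm_lt hR
  have hp : ∀ k, Continuous (pderiv v k) := fun k => (contDiff_pderiv hv k).continuous
  have hr : Continuous (rotSum M (pderiv v)) := (contDiff_rotSum M hv).continuous
  have hw : ∀ k, IsWeight fun x => fderiv ℝ χ x (EuclideanSpace.single k 1) := fun k =>
    isWeight_of_continuous ((hχ.continuous_fderiv (by simp)).clm_apply continuous_const)
      (hχc.fderiv_apply ℝ _)
  set a : Fin n → Rn n → ℂ := fun k x => pderiv v k x *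
        conj ((fderiv ℝ χ x (EuclideanSpace.single k 1) : ℂ) * rotSum M (pderiv v) x)
  set b : Fin n → Rn n → ℂ := fun k x =>
    (χ x : ℂ) * (pderiv v k x * conj (∑ j, (M j k : ℂ) * pderiv v j x))
  set c : Fin n → Rn n → ℂ := fun k x =>
    conj (conj (pderiv v k x) * ((χ x : ℂ) * rotSum M (pderiv (pderiv v k)) x))
  have ha : ∀ k, Integrable (a k) := fun k => by
    have := (hw k).integrable_mul (f := fun x => pderiv v k x * conj (rotSum M (pderiv v) x))
      ((hp k).mul (Complex.continuous_conj.comp hr)).locallyIntegrable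
    refine this.congr (ae_of_all _ fun x => ?_)
    simp only [a, map_mul, Complex.conj_ofReal]
    ring
  have hb : ∀ k, Integrable (b k) := fun k => hχr.integrable_mul
    ((hp k).mul (Complex.continuous_conj.comp (continuous_finsetSum _ fun j _ =>
      continuous_const.mul (hp j)))).locallyIntegrable
  have hc : ∀ k, Integrable (c k) := fun k => by
    have := hχr.integrable_mul (f := fun x => pderiv v k x * conj (rotSum M (pderiv (pderiv v k)) x))
      ((hp k).mul (Complex.continuous_conj.comp
        (contDiff_rotSum M (contDiff_pderiv hv k)).continuous)).locallyIntegrable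
    refine this.congr (ae_of_all _ fun x => ?_)
    simp only [c, map_mul, Complex.conj_ofReal, Complex.conj_conj]
    ring
  have hsplit : ∀ k, ∫ x, pderiv v k x *
      conj (pderiv (fun y => (χ y : ℂ) * rotSum M (pderiv v) y) k x)
      = (∫ x, a k x) + (∫ x, b k x) + ∫ x, c k x := by
    intro k
    have hab : Integrable fun x => a k x + b k x := (ha k).add (hb k)
    rw [← integral_add (ha k) (hb k), ← integral_add hab (hc k)]
    refine integral_congr_ae (ae_of_all _ fun x => ?_)
    simp only [a, b, c]
    rw [pderiv_mul (a := fun y => (χ y : ℂ)) (Complex.ofRealCLM.contDiff.comp hχ) (contDiff_rotSum M hv), pderiv_ofReal hχ,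
      pderiv_rotSum M hv]
    simp only [map_add, map_mul, Complex.conj_ofReal, Complex.conj_conj]
    ring
  have hb0 : (∑ k, ∫ x, b k x).re = 0 := by
    rw [← integral_finsetSum _ fun k _ => hb k]
    have hre : ∀ x, (∑ k, b k x).re = 0 := by
      intro x
      have h1 : conj (∑ k, b k x) = -∑ k, b k x := by
        simp only [b, map_sum, map_mul, Complex.conj_ofReal, Complex.conj_conj, Finset.mul_sum]
        rw [Finset.sum_comm, ← Finset.sum_neg_distrib]
        refine Finset.sum_congr rfl fun j _ => ?_
        rw [← Finset.sum_neg_distrib]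
        refine Finset.sum_congr rfl fun k _ => ?_
        have : M j k = -M k j := by
          have := congrFun (congrFun hM k) j
          simpa using this
        rw [this]
        push_cast
        ring
      have h2 := congrArg Complex.re h1
      rw [Complex.conj_re, Complex.neg_re] at h2
      linarith
    have h3 := integral_re (𝕜 := ℂ) (integrable_finsetSum _ fun k (_ : k ∈ Finset.univ) => hb k)
    refine h3.symm.trans (integral_eq_zero_of_ae (ae_of_all _ fun x => ?_))
    simpa using hre x
  have hc0 : ∀ k, (∫ x, c k x).re = 0 := by
    intro k
    simp only [c]
    rw [integral_conj, Complex.conj_re]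
    have := re_integral_weight_smooth_eq_zero hM hχr (θ := fun _ => 1) continuous_const
      ((contDiff_pderiv hv k).of_le (by simp))
    simpa using this
  have hc0' : (∑ k, ∫ x, c k x).re = 0 := by
    rw [Complex.re_sum]
    exact Finset.sum_eq_zero fun k _ => hc0 k
  simp_rw [hsplit, Finset.sum_add_distrib, Complex.add_re]
  rw [hb0, hc0', add_zero, add_zero]

/-- The regularised generator `f ↦ ρ ∗ (χ A·∇(ρ ∗ f))` of rotations. -/
noncomputable def angOp (φ : ContDiffBump (0 : Rn n)) (χ : Rn n → ℝ)
    (M : Matrix (Fin n) (Fin n) ℝ) (f : Rn n → ℂ) : Rn n → ℂ :=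
  moll φ fun x => (χ x : ℂ) * rotSum M (pderiv (moll φ f)) x

section angOp

variable (φ : ContDiffBump (0 : Rn n)) {χ : Rn n → ℝ} (M : Matrix (Fin n) (Fin n) ℝ)

theorem contDiff_angOp_inner (hχ : ContDiff ℝ ∞ χ) {f : Rn n → ℂ} (hf : LocallyIntegrable f) :
    ContDiff ℝ ∞ fun x => (χ x : ℂ) * rotSum M (pderiv (moll φ f)) x :=
  (Complex.ofRealCLM.contDiff.comp hχ).mul (contDiff_rotSum M (moll_contDiff φ hf))

theorem contDiff_angOp (hχ : ContDiff ℝ ∞ χ) {f : Rn n → ℂ} (hf : LocallyIntegrable f) :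
    ContDiff ℝ ∞ (angOp φ χ M f) :=
  moll_contDiff φ (contDiff_angOp_inner φ M hχ hf).continuous.locallyIntegrable

theorem angOp_eq_zero {R : ℝ} (hR : ∀ x, R < ‖x‖ → χ x = 0) (f : Rn n → ℂ) {x : Rn n}
    (hx : R + φ.rOut < ‖x‖) : angOp φ χ M f x = 0 :=
  moll_eq_zero φ (R := R) (fun y hy => by simp [hR y hy]) hx

theorem hasCompactSupport_angOp {R : ℝ} (hR : ∀ x, R < ‖x‖ → χ x = 0) (f : Rn n → ℂ) :
    HasCompactSupport (angOp φ χ M f) :=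
  hasCompactSupport_of_forall_norm_lt fun _ hx => angOp_eq_zero φ M hR f hx

theorem angOp_congr_ae {f f' : Rn n → ℂ} (h : f =ᵐ[volume] f') :
    angOp φ χ M f = angOp φ χ M f' := by
  rw [angOp, moll_congr_ae φ h, angOp]

theorem angOp_sub (hχ : ContDiff ℝ ∞ χ) {f f' : Rn n → ℂ} (hf : LocallyIntegrable f)
    (hf' : LocallyIntegrable f') :
    angOp φ χ M (f - f') = angOp φ χ M f - angOp φ χ M f' := by
  rw [angOp, angOp, angOp, ← moll_sub φ
    (contDiff_angOp_inner φ M hχ hf).continuous.locallyIntegrable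
    (contDiff_angOp_inner φ M hχ hf').continuous.locallyIntegrable]
  congr 1
  ext x
  have h : pderiv (moll φ (f - f')) = pderiv (moll φ f) - pderiv (moll φ f') := by
    ext k y
    rw [moll_sub φ hf hf', pderiv, fderiv_sub
      ((moll_contDiff φ hf).differentiable (by simp) y)
      ((moll_contDiff φ hf').differentiable (by simp) y)]
    rfl
  rw [h, rotSum_sub]
  simp [mul_sub]

theorem integral_conj_mul_angOp {χ : Rn n → ℝ} (hχ : ContDiff ℝ ∞ χ) (hχr : IsRadialWeight χ)
    {f g : Rn n → ℂ} (hf : LocallyIntegrable f) (hg : LocallyIntegrable g) :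
    ∫ x, conj (f x) * angOp φ χ M g x
      = ∫ x, conj (moll φ f x) * ((χ x : ℂ) * rotSum M (pderiv (moll φ g)) x) := by
  obtain ⟨R, hR⟩ := hχr.support
  have hfc : LocallyIntegrable fun x => conj (f x) := by
    intro x
    obtain ⟨s, hs, hfs⟩ := hf x
    exact ⟨s, hs, hfs.norm.mono' (Complex.continuous_conj.comp_aestronglyMeasurable hfs.1)
      (ae_of_all _ fun y => by simp)⟩
  rw [angOp, ← integral_moll_mul φ hfc (contDiff_angOp_inner φ M hχ hg).continuous
    (hasCompactSupport_of_forall_norm_lt (R := R) fun y hy => by simp [hR y hy])]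
  simp_rw [moll_conj]

/-- The regularised generator is skew, because `χ` is radial. -/
theorem integral_conj_mul_angOp_skew (hM : Mᵀ = -M) (hχ : ContDiff ℝ ∞ χ)
    (hχr : IsRadialWeight χ) {f g : Rn n → ℂ} (hf : LocallyIntegrable f)
    (hg : LocallyIntegrable g) :
    ∫ x, conj (f x) * angOp φ χ M g x = -conj (∫ x, conj (g x) * angOp φ χ M f x) := by
  rw [integral_conj_mul_angOp φ M hχ hχr hf hg, integral_conj_mul_angOp φ M hχ hχr hg hf,
    ← integral_conj, eq_neg_iff_add_eq_zero]
  have hv := moll_contDiff φ hf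
  have hw := moll_contDiff φ hg
  set v := moll φ f
  set w := moll φ g
  have hvc : ContDiff ℝ ∞ fun x => conj (v x) := Complex.conjCLE.contDiff.comp hv
  have h0 := integral_radial_mul_rotSum hM hχr (g := fun x => conj (v x) * w x)
    ((hvc.mul hw).of_le (by simp))
  have hrv := (contDiff_rotSum M hv).continuous
  have hrw := (contDiff_rotSum M hw).continuous
  have i1 : Integrable fun x => conj (v x) * ((χ x : ℂ) * rotSum M (pderiv w) x) := by
    refine (hχr.integrable_mul (f := fun x => conj (v x) * rotSum M (pderiv w) x) (hvc.continuous.mul hrw).locallyIntegrable).congr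
      (ae_of_all _ fun x => ?_)
    ring
  have i2 : Integrable fun x => conj (conj (w x) * ((χ x : ℂ) * rotSum M (pderiv v) x)) := by
    refine (hχr.integrable_mul (f := fun x => w x * conj (rotSum M (pderiv v) x))
      (hw.continuous.mul
      (Complex.continuous_conj.comp hrv)).locallyIntegrable).congr (ae_of_all _ fun x => ?_)
    simp
    ring
  rw [← integral_add i1 i2, ← h0]
  refine integral_congr_ae (ae_of_all _ fun x => ?_)
  have hp : rotSum M (pderiv fun x => conj (v x) * w x) x
      = conj (rotSum M (pderiv v) x) * w x + conj (v x) * rotSum M (pderiv w) x := by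
    simp only [rotSum, pderiv_mul hvc hw, pderiv_conj hv, map_sum, map_mul, Complex.conj_ofReal,
      Finset.sum_mul, Finset.mul_sum, ← Finset.sum_add_distrib]
    refine Finset.sum_congr rfl fun j _ => ?_
    ring
  simp only [hp, map_mul, Complex.conj_conj, Complex.conj_ofReal]
  ring

/-- The regularised generator is bounded by the gradient in every `L^p`, uniformly in the
mollifier. -/
theorem exists_eLpNorm_angOp_le {χ : Rn n → ℝ} (hχ : IsWeight χ) :
    ∃ C : ℝ, 0 ≤ C ∧ ∀ (φ : ContDiffBump (0 : Rn n)) (p : ℝ≥0∞), 1 ≤ p → p ≠ ⊤ →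
      ∀ (f : Rn n → ℂ) (g : Fin n → Rn n → ℂ), (∀ k, HasWeakPartial f k (g k)) →
      (∀ k, MemLp (g k) p) →
      eLpNorm (angOp φ χ M f) p ≤ ENNReal.ofReal C * ∑ k, eLpNorm (g k) p := by
  obtain ⟨C, hC0, hC⟩ := exists_eLpNorm_weight_mul_rotSum_le M hχ
  refine ⟨C, hC0, fun φ p hp hp' f g hfg hg => ?_⟩
  have hpd : pderiv (moll φ f) = fun k => moll φ (g k) := funext fun k => pderiv_moll φ (hfg k)
  have hm : ∀ k, MemLp (moll φ (g k)) p := fun k => memLp_moll φ hp hp' (hg k)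
  rw [angOp, hpd]
  refine (eLpNorm_moll_le φ hp hp' (memLp_weight_mul_rotSum M hχ hp hm).1).trans ?_
  refine (hC p hp _ fun k => (hm k).1).trans (mul_le_mul_right ?_ _)
  exact Finset.sum_le_sum fun k _ => eLpNorm_moll_le φ hp hp' (hg k).1

theorem memLp_angOp {χ : Rn n → ℝ} (hχ : IsWeight χ) {p : ℝ≥0∞} (hp : 1 ≤ p) (hp' : p ≠ ⊤)
    {f : Rn n → ℂ} {g : Fin n → Rn n → ℂ} (hfg : ∀ k, HasWeakPartial f k (g k))
    (hg : ∀ k, MemLp (g k) p) : MemLp (angOp φ χ M f) p := by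
  have hpd : pderiv (moll φ f) = fun k => moll φ (g k) := funext fun k => pderiv_moll φ (hfg k)
  rw [angOp, hpd]
  exact memLp_moll φ hp hp' (memLp_weight_mul_rotSum M hχ hp fun k => memLp_moll φ hp hp' (hg k))

theorem tendsto_eLpNorm_angOp {χ : Rn n → ℝ} (hχ : IsWeight χ) {p : ℝ≥0∞} (hp : 1 ≤ p)
    (hp' : p ≠ ⊤) {f : Rn n → ℂ} {g : Fin n → Rn n → ℂ} (hfg : ∀ k, HasWeakPartial f k (g k))
    (hg : ∀ k, MemLp (g k) p) :
    Tendsto (fun i => eLpNorm (angOp (bump n i) χ M f - fun x => (χ x : ℂ) * rotSum M g x) p)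
      atTop (𝓝 0) := by
  set S : Rn n → ℂ := fun x => (χ x : ℂ) * rotSum M g x
  set Si : ℕ → Rn n → ℂ := fun i x => (χ x : ℂ) * rotSum M (fun k => moll (bump n i) (g k)) x
  have hS : MemLp S p := memLp_weight_mul_rotSum M hχ hp hg
  have hSi : ∀ i, MemLp (Si i) p := fun i =>
    memLp_weight_mul_rotSum M hχ hp fun k => memLp_moll _ hp hp' (hg k)
  have h1 : Tendsto (fun i => eLpNorm (Si i - S) p) atTop (𝓝 0) :=
    tendsto_eLpNorm_weight_mul_rotSum M hχ hp (fun j => (hg j).1)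
      (G := fun i k => moll (bump n i) (g k))
      (fun i j => (memLp_moll _ hp hp' (hg j)).1)
      fun j => tendsto_eLpNorm_moll_sub (tendsto_bump_rOut n) hp hp' (hg j)
  have h2 : Tendsto (fun i => eLpNorm (moll (bump n i) S - S) p) atTop (𝓝 0) :=
    tendsto_eLpNorm_moll_sub (tendsto_bump_rOut n) hp hp' hS
  refine tendsto_of_tendsto_of_tendsto_of_le_of_le tendsto_const_nhds
    (by simpa using h1.add h2) (fun _ => zero_le) fun i => ?_
  have hpd : pderiv (moll (bump n i) f) = fun k => moll (bump n i) (g k) :=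
    funext fun k => pderiv_moll _ (hfg k)
  have e : angOp (bump n i) χ M f - S = moll (bump n i) (Si i - S) + (moll (bump n i) S - S) := by
    rw [moll_sub _ ((hSi i).locallyIntegrable hp) (hS.locallyIntegrable hp), angOp, hpd]
    abel
  rw [e]
  have hd : MemLp (moll (bump n i) (Si i - S)) p := memLp_moll _ hp hp' ((hSi i).sub hS)
  refine (eLpNorm_add_le hd.1 ((memLp_moll _ hp hp' hS).sub hS).1 hp).trans
    (add_le_add_left ?_ _)
  exact eLpNorm_moll_le _ hp hp' ((hSi i).sub hS).1

/-- For a fixed mollifier the regularised generator maps `L²` boundedly into every `L^p`, and so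
do its derivatives. -/
theorem exists_eLpNorm_angOp_le_two {χ : Rn n → ℝ} (hχ : ContDiff ℝ ∞ χ) (hχw : IsWeight χ)
    {p : ℝ≥0∞} (hp : 1 ≤ p) (hp' : p ≠ ⊤) :
    ∃ C : ℝ, 0 ≤ C ∧ ∀ f : Rn n → ℂ, MemLp f 2 →
      eLpNorm (angOp φ χ M f) p ≤ ENNReal.ofReal (C * (eLpNorm f 2).toReal) ∧
      ∀ k, eLpNorm (pderiv (angOp φ χ M f) k) p ≤ ENNReal.ofReal (C * (eLpNorm f 2).toReal) := by
  obtain ⟨R, hR⟩ := hχw.support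
  obtain ⟨A, hA0, hA⟩ := exists_norm_moll_le φ
  obtain ⟨B, hB0, hB⟩ := exists_norm_weight_mul_rotSum_le M hχw
  have hball : ∀ (w : Rn n → ℂ) (r c : ℝ) (q : ℝ≥0∞), 0 ≤ c → (∀ x, r < ‖x‖ → w x = 0) →
      (∀ x, ‖w x‖ ≤ c) → eLpNorm w q ≤ ENNReal.ofReal c *
        eLpNorm ((Metric.closedBall (0 : Rn n) r).indicator fun _ => (1 : ℝ)) q := by
    intro w r c q hc hw hwc
    refine eLpNorm_le_mul_eLpNorm_of_ae_le_mul (ae_of_all _ fun x => ?_) q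
    by_cases hx : x ∈ Metric.closedBall (0 : Rn n) r
    · simpa [hx] using hwc x
    · simp [hx, hw x (by simpa using hx)]
  have hfin : ∀ (r : ℝ) (q : ℝ≥0∞), eLpNorm ((Metric.closedBall (0 : Rn n) r).indicator
      fun _ => (1 : ℝ)) q ≠ ⊤ := fun r q =>
    (memLp_indicator_const q Metric.isClosed_closedBall.measurableSet 1
      (Or.inr (isCompact_closedBall _ _).measure_ne_top)).2.ne
  set N : ℝ → ℝ≥0∞ → ℝ := fun r q =>
    (eLpNorm ((Metric.closedBall (0 : Rn n) r).indicator fun _ => (1 : ℝ)) q).toReal with hN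
  have hball' : ∀ (w : Rn n → ℂ) (r c : ℝ) (q : ℝ≥0∞), 0 ≤ c → (∀ x, r < ‖x‖ → w x = 0) →
      (∀ x, ‖w x‖ ≤ c) → eLpNorm w q ≤ ENNReal.ofReal (c * N r q) := by
    intro w r c q hc hw hwc
    rw [ENNReal.ofReal_mul hc, hN, ENNReal.ofReal_toReal (hfin r q)]
    exact hball w r c q hc hw hwc
  have hN0 : ∀ r q, 0 ≤ N r q := fun r q => ENNReal.toReal_nonneg
  set D : ℝ := B * (n * A) with hD
  have hD0 : 0 ≤ D := by positivity
  refine ⟨D * N R p + A * (D * N R 2) * N (R + φ.rOut) p,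
    add_nonneg (mul_nonneg hD0 (hN0 _ _))
      (mul_nonneg (mul_nonneg hA0 (mul_nonneg hD0 (hN0 _ _))) (hN0 _ _)), fun f hf => ?_⟩
  set E := (eLpNorm f 2).toReal with hE
  have hE0 : 0 ≤ E := ENNReal.toReal_nonneg
  set w : Rn n → ℂ := fun x => (χ x : ℂ) * rotSum M (pderiv (moll φ f)) x with hw
  have hwc : ContDiff ℝ ∞ w := contDiff_angOp_inner φ M hχ (hf.locallyIntegrable one_le_two)
  have hwR : ∀ x, R < ‖x‖ → w x = 0 := fun x hx => by simp [hw, hR x hx]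
  have hwb : ∀ x, ‖w x‖ ≤ D * E := fun x => by
    refine (hB _ x).trans ?_
    rw [hD, mul_assoc]
    refine mul_le_mul_of_nonneg_left ?_ hB0
    refine (Finset.sum_le_card_nsmul _ _ (A * E) fun k _ => (hA f hf x).2 k).trans ?_
    simp [mul_assoc]
  have hw2 : MemLp w 2 := hwc.continuous.memLp_of_hasCompactSupport
    (hasCompactSupport_of_forall_norm_lt hwR)
  have hw2b : (eLpNorm w 2).toReal ≤ D * E * N R 2 :=
    ENNReal.toReal_le_of_le_ofReal (mul_nonneg (mul_nonneg hD0 hE0) (hN0 _ _))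
      (hball' w R _ 2 (mul_nonneg hD0 hE0) hwR hwb)
  constructor
  · refine (eLpNorm_moll_le φ hp hp' hwc.continuous.aestronglyMeasurable).trans
      ((hball' w R _ p (mul_nonneg hD0 hE0) hwR hwb).trans (ENNReal.ofReal_le_ofReal ?_))
    have h1 := mul_nonneg (mul_nonneg (mul_nonneg hA0 (mul_nonneg hD0 (hN0 R 2)))
      (hN0 (R + φ.rOut) p)) hE0
    nlinarith [h1]
  · intro k
    have hz : ∀ x, R + φ.rOut < ‖x‖ → pderiv (angOp φ χ M f) k x = 0 := by
      intro x hx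
      have : angOp φ χ M f =ᶠ[𝓝 x] fun _ => 0 := by
        filter_upwards [(isOpen_lt continuous_const continuous_norm).mem_nhds hx] with y hy using
          angOp_eq_zero φ M hR f hy
      rw [pderiv, this.fderiv_eq]
      simp
    have hb : ∀ x, ‖pderiv (angOp φ χ M f) k x‖ ≤ A * (D * E * N R 2) := fun x =>
      ((hA w hw2 x).2 k).trans (mul_le_mul_of_nonneg_left hw2b hA0)
    refine (hball' _ _ _ p (mul_nonneg hA0 (mul_nonneg (mul_nonneg hD0 hE0) (hN0 _ _)))
      hz hb).trans (ENNReal.ofReal_le_ofReal ?_)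
    have h1 := mul_nonneg (mul_nonneg hD0 (hN0 R p)) hE0
    nlinarith [h1]

/-- One of the two mollifiers in `angOp` is moved to the other factor, where it turns the weak
derivative `g` into the classical derivative of `ρ ∗ f`. -/
theorem integral_mul_conj_pderiv_angOp {χ : Rn n → ℝ} (hχ : ContDiff ℝ ∞ χ) (hχw : IsWeight χ)
    {f g : Rn n → ℂ} {k : Fin n} (hfg : HasWeakPartial f k g) :
    ∫ x, g x * conj (pderiv (angOp φ χ M f) k x)
      = ∫ x, pderiv (moll φ f) k x *
        conj (pderiv (fun y => (χ y : ℂ) * rotSum M (pderiv (moll φ f)) y) k x) := by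
  obtain ⟨R, hR⟩ := hχw.support
  set w : Rn n → ℂ := fun x => (χ x : ℂ) * rotSum M (pderiv (moll φ f)) x with hw
  have hwc : ContDiff ℝ ∞ w := contDiff_angOp_inner φ M hχ hfg.1
  have hwR : HasCompactSupport w :=
    hasCompactSupport_of_forall_norm_lt (R := R) fun x hx => by simp [hw, hR x hx]
  have hp : pderiv (angOp φ χ M f) k = moll φ (pderiv w k) :=
    pderiv_moll φ (hasWeakPartial_pderiv hwc k)
  have hpc : HasCompactSupport fun x => conj (pderiv w k x) :=
    (hwR.fderiv_apply ℝ (EuclideanSpace.single k 1)).comp_left (map_zero _)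
  rw [pderiv_moll φ hfg, hp, integral_moll_mul φ (g := fun x => conj (pderiv w k x)) hfg.2.1
    (Complex.continuous_conj.comp (contDiff_pderiv hwc k).continuous) hpc]
  simp_rw [moll_conj]

end angOp

/-! ### The equation in weak form and its nonlinear terms -/

/-- The exponent `r = (2n+4)/n = 2 + 4/n`. -/
noncomputable abbrev expR (n : ℕ) : ℝ≥0∞ := ENNReal.ofReal ((2 * n + 4) / n)

/-- The exponent `r' = (2n+4)/(n+4)` dual to `r = (2n+4)/n`. -/
noncomputable abbrev expR' (n : ℕ) : ℝ≥0∞ := ENNReal.ofReal ((2 * n + 4) / (n + 4))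

theorem one_le_expR (hn : 1 ≤ n) : 1 ≤ expR n := by
  have hn0 : (0 : ℝ) < n := by exact_mod_cast hn
  rw [expR, ENNReal.one_le_ofReal, le_div_iff₀ hn0]
  linarith

theorem one_le_expR' (n : ℕ) : 1 ≤ expR' n := by
  rw [expR', ENNReal.one_le_ofReal, le_div_iff₀ (by positivity)]
  linarith [(Nat.cast_nonneg n : (0 : ℝ) ≤ n)]

theorem holderTriple_expR (hn : 1 ≤ n) : (expR' n).HolderTriple (expR n) 1 := by
  have hn0 : (0 : ℝ) < n := by exact_mod_cast hn
  constructor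
  rw [← ENNReal.ofReal_inv_of_pos (by positivity), ← ENNReal.ofReal_inv_of_pos (by positivity),
    ← ENNReal.ofReal_add (by positivity) (by positivity), inv_one, ENNReal.ofReal_eq_one]
  field_simp
  ring

/-- The nonlinearity `|f|^{4/n} f`. -/
noncomputable def nonlin (f : Rn n → ℂ) (x : Rn n) : ℂ :=
  ((‖f x‖ ^ (4 / (n : ℝ)) : ℝ) : ℂ) * f x

theorem norm_nonlin (hn : 1 ≤ n) (f : Rn n → ℂ) (x : Rn n) :
    ‖nonlin f x‖ = ‖f x‖ ^ ((n + 4) / n : ℝ) := by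
  have hn0 : (0 : ℝ) < n := by exact_mod_cast hn
  rw [nonlin, norm_mul, Complex.norm_real, Real.norm_of_nonneg (by positivity)]
  have e : ((n + 4) / n : ℝ) = 4 / n + 1 := by
    field_simp
    ring
  rw [e, Real.rpow_add_one' (norm_nonneg _) (by positivity)]

theorem aestronglyMeasurable_nonlin {f : Rn n → ℂ} (hf : AEStronglyMeasurable f) :
    AEStronglyMeasurable (nonlin f) :=
  (Complex.continuous_ofReal.comp_aestronglyMeasurable
    (hf.norm.aemeasurable.pow_const _).aestronglyMeasurable).mul hf

theorem eLpNorm_nonlin (hn : 1 ≤ n) (f : Rn n → ℂ) :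
    eLpNorm (nonlin f) (expR' n) = eLpNorm f (expR n) ^ ((n + 4) / n : ℝ) := by
  have hn0 : (0 : ℝ) < n := by exact_mod_cast hn
  have h1 : eLpNorm (nonlin f) (expR' n)
      = eLpNorm (fun x => ‖f x‖ ^ ((n + 4) / n : ℝ)) (expR' n) := by
    refine eLpNorm_congr_norm_ae (ae_of_all _ fun x => ?_)
    rw [norm_nonlin hn, Real.norm_of_nonneg (by positivity)]
  rw [h1, eLpNorm_norm_rpow _ (by positivity), expR', ← ENNReal.ofReal_mul (by positivity)]
  congr 3
  field_simp

theorem memLp_nonlin (hn : 1 ≤ n) {f : Rn n → ℂ} (hf : MemLp f (expR n)) :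
    MemLp (nonlin f) (expR' n) := by
  refine ⟨aestronglyMeasurable_nonlin hf.1, ?_⟩
  rw [eLpNorm_nonlin hn]
  exact ENNReal.rpow_lt_top_of_nonneg (by positivity) hf.2.ne

theorem norm_integral_mul_le {p q : ℝ≥0∞} [p.HolderTriple q 1] {a b : Rn n → ℂ}
    (ha : MemLp a p) (hb : MemLp b q) :
    ‖∫ x, a x * b x‖ ≤ (eLpNorm a p).toReal * (eLpNorm b q).toReal := by
  have h2 : ‖∫ x, a x * b x‖ₑ ≤ eLpNorm a p * eLpNorm b q := by
    have h := eLpNorm_smul_le_mul_eLpNorm (p := p) (q := q) (r := 1) hb.1 ha.1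
    rw [eLpNorm_one_eq_lintegral_enorm] at h
    refine (enorm_integral_le_lintegral_enorm _).trans (le_trans (le_of_eq ?_) h)
    exact lintegral_congr fun x => rfl
  have := (ENNReal.toReal_le_toReal (by simp) (ENNReal.mul_ne_top ha.2.ne hb.2.ne)).2 h2
  simpa [ENNReal.toReal_mul] using this

theorem exists_eLpNorm_weight_mul_le {h : Rn n → ℝ} (hh : IsWeight h) : ∃ C : ℝ, 0 ≤ C ∧
    ∀ (p : ℝ≥0∞) (f : Rn n → ℂ), MemLp f p → MemLp (fun x => (h x : ℂ) * f x) p ∧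
      (eLpNorm (fun x => (h x : ℂ) * f x) p).toReal ≤ C * (eLpNorm f p).toReal := by
  obtain ⟨C, hC⟩ := hh.bounded
  have hC0 : 0 ≤ C := (abs_nonneg _).trans (hC 0)
  refine ⟨C, hC0, fun p f hf => ?_⟩
  have h1 : eLpNorm (fun x => (h x : ℂ) * f x) p ≤ ENNReal.ofReal C * eLpNorm f p := by
    refine eLpNorm_le_mul_eLpNorm_of_ae_le_mul (ae_of_all _ fun x => ?_) p
    rw [norm_mul, Complex.norm_real]
    exact mul_le_mul_of_nonneg_right (hC x) (norm_nonneg _)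
  have h2 : ENNReal.ofReal C * eLpNorm f p ≠ ⊤ := ENNReal.mul_ne_top ENNReal.ofReal_ne_top hf.2.ne
  refine ⟨⟨(Complex.measurable_ofReal.comp hh.measurable).aestronglyMeasurable.mul hf.1,
    h1.trans_lt h2.lt_top⟩, ?_⟩
  have := ENNReal.toReal_mono h2 h1
  rwa [ENNReal.toReal_mul, ENNReal.toReal_ofReal hC0] at this

/-- The lower order part `V f + μ |f|^{4/n} f + i A·∇f` of the equation. -/
noncomputable def source (M : Matrix (Fin n) (Fin n) ℝ) (V μ : Rn n → ℝ) (f : Rn n → ℂ)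
    (x : Rn n) : ℂ :=
  (V x : ℂ) * f x + (μ x : ℂ) * nonlin f x + Complex.I * rotDeriv M f x

/-- The right-hand side of the equation, in its weak form with one derivative on the test function
`φ`, which may be complex-valued. -/
noncomputable def weakForm (M : Matrix (Fin n) (Fin n) ℝ) (V μ : Rn n → ℝ) (f φ : Rn n → ℂ) : ℂ :=
  (∑ k, ∫ x, weakPartial f k x * pderiv φ k x) + ∫ x, source M V μ f x * φ x

theorem integrable_coeff_mul {V : Rn n → ℝ} (hV : IsRadialCoeff V) {f φ : Rn n → ℂ}
    (hf : LocallyIntegrable f) (hφ : Continuous φ) (hφc : HasCompactSupport φ) :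
    Integrable fun x => (V x : ℂ) * f x * φ x := by
  obtain ⟨R, hR⟩ := exists_forall_norm_lt_eq_zero hφc
  have hw := (isRadialWeight_indicator_closedBall (n := n) R).mul_coeff hV
  obtain ⟨C, hC⟩ := hφ.bounded_above_of_compact_support hφc
  refine ((hw.integrable_mul hf).bdd_mul hφ.aestronglyMeasurable (ae_of_all _ hC)).congr
    (ae_of_all _ fun x => ?_)
  simp only []
  by_cases hx : x ∈ Metric.closedBall (0 : Rn n) R
  · simp [hx]; ring
  · simp [hR x (by simpa using hx)]

theorem locallyIntegrable_rotDeriv (M : Matrix (Fin n) (Fin n) ℝ) {f : Rn n → ℂ}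
    (hf : ∀ k, LocallyIntegrable (weakPartial f k)) : LocallyIntegrable (rotDeriv M f) := by
  rw [rotDeriv_eq_rotSum, locallyIntegrable_iff]
  intro K hK
  obtain ⟨R, hR⟩ := hK.isBounded.subset_closedBall 0
  refine IntegrableOn.mono_set ?_ hR
  refine integrable_finsetSum _ fun j _ => ?_
  refine ((hf j).integrableOn_isCompact (isCompact_closedBall _ _)).continuousOn_mul
    (Continuous.continuousOn ?_) (isCompact_closedBall _ _)
  have : (fun x : Rn n => (((M *ᵥ x.ofLp) j : ℝ) : ℂ)) = Complex.ofRealCLM.comp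
      ((EuclideanSpace.proj (𝕜 := ℝ) j).comp (Matrix.toEuclideanCLM (𝕜 := ℝ) M)) := by
    ext y
    simp [Matrix.ofLp_toEuclideanCLM]
  rw [this]
  exact ContinuousLinearMap.continuous _

theorem integrable_mul_of_hasCompactSupport {f φ : Rn n → ℂ}
    (hf : LocallyIntegrable f) (hφ : Continuous φ) (hφc : HasCompactSupport φ) :
    Integrable fun x => f x * φ x := by
  have := hf.integrable_smul_left_of_hasCompactSupport hφ hφc
  simpa [mul_comm] using this

theorem integrable_source_mul {M : Matrix (Fin n) (Fin n) ℝ} {V μ : Rn n → ℝ}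
    (hn : 1 ≤ n) (hV : IsRadialCoeff V) (hμ : IsRadialCoeff μ) {f φ : Rn n → ℂ} (hf : MemH 2 f)
    (hfr : MemLp f (expR n)) (hφ : Continuous φ) (hφc : HasCompactSupport φ) :
    Integrable fun x => source M V μ f x * φ x := by
  have h1 := integrable_coeff_mul hV (hf.1.locallyIntegrable one_le_two) hφ hφc
  have h2 := integrable_coeff_mul hμ
    ((memLp_nonlin hn hfr).locallyIntegrable (one_le_expR' n)) hφ hφc
  have h3 := (integrable_mul_of_hasCompactSupport (locallyIntegrable_rotDeriv M fun k =>
    (hf.memLp_weakPartial k).locallyIntegrable one_le_two) hφ hφc).const_mul Complex.I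
  refine ((h1.add h2).add h3).congr (ae_of_all _ fun x => ?_)
  simp only [Pi.add_apply, source]
  ring

theorem laplacian_eq_sum_fderiv {φ : Rn n → ℝ} (hφ : IsTest φ) (x : Rn n) :
    Laplacian.laplacian φ x = ∑ k, fderiv ℝ
      (fun y => fderiv ℝ φ y (EuclideanSpace.single k 1)) x (EuclideanSpace.single k 1) := by
  have h := congrFun (InnerProductSpace.laplacian_eq_iteratedFDeriv_orthonormalBasis φ
    (EuclideanSpace.basisFun (Fin n) ℝ)) x
  rw [h]
  refine Finset.sum_congr rfl fun k _ => ?_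
  have hd : DifferentiableAt ℝ (fderiv ℝ φ) x :=
    (hφ.1.fderiv_right (m := ∞) (by simp)).differentiable (by simp) x
  have := (hd.hasFDerivAt.clm_apply
    (hasFDerivAt_const (EuclideanSpace.single k (1 : ℝ) : Rn n) x)).fderiv
  refine Eq.trans ?_
    (congrArg (fun L : Rn n →L[ℝ] ℝ => L (EuclideanSpace.single k 1)) this).symm
  simp [iteratedFDeriv_two_apply]

/-- The distributional Laplacian, integrated by parts once; the nonlinear term is locally
integrable because `f` is in `L^r`. -/
theorem rhs_eq_weakForm {M : Matrix (Fin n) (Fin n) ℝ} {V μ : Rn n → ℝ}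
    (hn : 1 ≤ n) (hV : IsRadialCoeff V) (hμ : IsRadialCoeff μ) {f : Rn n → ℂ} (hf : MemH 2 f)
    (hfr : MemLp f (expR n)) {φ : Rn n → ℝ} (hφ : IsTest φ) :
    rhs M V μ f φ = weakForm M V μ f fun x => (φ x : ℂ) := by
  have hfl := hf.1.locallyIntegrable one_le_two
  have hφc : Continuous fun x => (φ x : ℂ) := Complex.continuous_ofReal.comp hφ.1.continuous
  have hφs : HasCompactSupport fun x => (φ x : ℂ) := hφ.2.comp_left Complex.ofReal_zero
  have hlap : -(∫ x, f x * ((Laplacian.laplacian φ x : ℝ) : ℂ))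
      = ∑ k, ∫ x, weakPartial f k x * pderiv (fun x => (φ x : ℂ)) k x := by
    simp_rw [laplacian_eq_sum_fderiv hφ, Complex.ofReal_sum, Finset.mul_sum]
    rw [integral_finsetSum _ fun k _ => ((hφ.fderiv_single k).fderiv_single k).integrable_mul hfl,
      ← Finset.sum_neg_distrib]
    refine Finset.sum_congr rfl fun k _ => ?_
    rw [(hf.hasWeakPartial k).2.2 _ (hφ.fderiv_single k), neg_neg]
    simp_rw [pderiv_ofReal hφ.1]
  have h1 := integrable_coeff_mul hV hfl hφc hφs
  have h2 := integrable_coeff_mul hμ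
    ((memLp_nonlin hn hfr).locallyIntegrable (one_le_expR' n)) hφc hφs
  have h3 := integrable_mul_of_hasCompactSupport (locallyIntegrable_rotDeriv M fun k =>
    (hf.memLp_weakPartial k).locallyIntegrable one_le_two) hφc hφs
  have hs : ∫ x, source M V μ f x * (φ x : ℂ) = (∫ x, (V x : ℂ) * f x * (φ x : ℂ))
      + (∫ x, (μ x : ℂ) * nonlin f x * (φ x : ℂ))
      + Complex.I * ∫ x, rotDeriv M f x * (φ x : ℂ) := by
    have h12 : Integrable fun x => (V x : ℂ) * f x * (φ x : ℂ)
      + (μ x : ℂ) * nonlin f x * (φ x : ℂ) := h1.add h2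
    rw [← integral_const_mul, ← integral_add h1 h2, ← integral_add h12 (h3.const_mul _)]
    refine integral_congr_ae (ae_of_all _ fun x => ?_)
    simp only [source]
    ring
  rw [weakForm, rhs, hlap, hs]
  simp only [nonlin, mul_assoc, add_assoc]

theorem isTest_re {φ : Rn n → ℂ} (hφ : ContDiff ℝ ∞ φ) (hφc : HasCompactSupport φ) :
    IsTest fun x => (φ x).re :=
  ⟨Complex.reCLM.contDiff.comp hφ, hφc.comp_left Complex.zero_re⟩

theorem isTest_im {φ : Rn n → ℂ} (hφ : ContDiff ℝ ∞ φ) (hφc : HasCompactSupport φ) :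
    IsTest fun x => (φ x).im :=
  ⟨Complex.imCLM.contDiff.comp hφ, hφc.comp_left Complex.zero_im⟩

theorem integrable_weakPartial_mul_pderiv {f : Rn n → ℂ} (hf : MemH 2 f) {φ : Rn n → ℂ}
    (hφ : ContDiff ℝ ∞ φ) (hφc : HasCompactSupport φ) (k : Fin n) :
    Integrable fun x => weakPartial f k x * pderiv φ k x :=
  integrable_mul_of_hasCompactSupport ((hf.memLp_weakPartial k).locallyIntegrable one_le_two)
    (contDiff_pderiv hφ k).continuous (hφc.fderiv_apply ℝ _)

theorem weakForm_add_mul {M : Matrix (Fin n) (Fin n) ℝ} {V μ : Rn n → ℝ}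
    (hn : 1 ≤ n) (hV : IsRadialCoeff V) (hμ : IsRadialCoeff μ) {f : Rn n → ℂ} (hf : MemH 2 f)
    (hfr : MemLp f (expR n)) {φ ψ : Rn n → ℂ} (hφ : ContDiff ℝ ∞ φ) (hφc : HasCompactSupport φ)
    (hψ : ContDiff ℝ ∞ ψ) (hψc : HasCompactSupport ψ) (c : ℂ) :
    weakForm M V μ f (fun x => φ x + c * ψ x)
      = weakForm M V μ f φ + c * weakForm M V μ f ψ := by
  have hp : ∀ k x, pderiv (fun x => φ x + c * ψ x) k x = pderiv φ k x + c * pderiv ψ k x := by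
    intro k x
    have := ((hφ.differentiable (by simp) x).hasFDerivAt.add
      ((hψ.differentiable (by simp) x).hasFDerivAt.const_mul c)).fderiv
    exact (congrArg (fun L : Rn n →L[ℝ] ℂ => L (EuclideanSpace.single k 1)) this).trans
      (by simp [pderiv])
  have h1 : ∀ k, ∫ x, weakPartial f k x * pderiv (fun x => φ x + c * ψ x) k x
      = (∫ x, weakPartial f k x * pderiv φ k x) + c * ∫ x, weakPartial f k x * pderiv ψ k x := by
    intro k
    rw [← integral_const_mul, ← integral_add (integrable_weakPartial_mul_pderiv hf hφ hφc k)
      ((integrable_weakPartial_mul_pderiv hf hψ hψc k).const_mul c)]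
    refine integral_congr_ae (ae_of_all _ fun x => ?_)
    simp only [hp]
    ring
  have h2 : ∫ x, source M V μ f x * (φ x + c * ψ x)
      = (∫ x, source M V μ f x * φ x) + c * ∫ x, source M V μ f x * ψ x := by
    rw [← integral_const_mul, ← integral_add
      (integrable_source_mul hn hV hμ hf hfr hφ.continuous hφc)
      ((integrable_source_mul hn hV hμ hf hfr hψ.continuous hψc).const_mul c)]
    refine integral_congr_ae (ae_of_all _ fun x => ?_)
    ring
  rw [weakForm, weakForm, weakForm]
  simp_rw [h1]
  rw [h2, Finset.sum_add_distrib, ← Finset.mul_sum]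
  ring

theorem weakForm_eq_rhs_re_add_rhs_im {M : Matrix (Fin n) (Fin n) ℝ} {V μ : Rn n → ℝ}
    (hn : 1 ≤ n) (hV : IsRadialCoeff V) (hμ : IsRadialCoeff μ) {f : Rn n → ℂ} (hf : MemH 2 f)
    (hfr : MemLp f (expR n)) {φ : Rn n → ℂ} (hφ : ContDiff ℝ ∞ φ) (hφc : HasCompactSupport φ) :
    weakForm M V μ f φ = rhs M V μ f (fun x => (φ x).re)
      + Complex.I * rhs M V μ f fun x => (φ x).im := by
  have h1 := isTest_re hφ hφc
  have h2 := isTest_im hφ hφc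
  rw [rhs_eq_weakForm hn hV hμ hf hfr h1, rhs_eq_weakForm hn hV hμ hf hfr h2,
    ← weakForm_add_mul (φ := fun x => ((φ x).re : ℂ)) (ψ := fun x => ((φ x).im : ℂ)) hn hV hμ hf
      hfr (Complex.ofRealCLM.contDiff.comp h1.1) (h1.2.comp_left Complex.ofReal_zero)
      (Complex.ofRealCLM.contDiff.comp h2.1) (h2.2.comp_left Complex.ofReal_zero)]
  congr 1
  ext x
  rw [mul_comm]
  exact (Complex.re_add_im (φ x)).symm

/-- A Hölder bound for the pairing of the lower order terms with functions supported in a fixed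
ball. -/
theorem exists_norm_integral_source_le (M : Matrix (Fin n) (Fin n) ℝ) {V μ : Rn n → ℝ}
    (hn : 1 ≤ n) (hV : IsRadialCoeff V) (hμ : IsRadialCoeff μ) (R : ℝ) :
    ∃ C : ℝ, 0 ≤ C ∧ ∀ f : Rn n → ℂ, MemH 2 f → MemLp f (expR n) →
      ∀ ψ : Rn n → ℂ, MemLp ψ 2 → MemLp ψ (expR n) → (∀ x, R < ‖x‖ → ψ x = 0) →
      Integrable (fun x => source M V μ f x * ψ x) ∧
      ‖∫ x, source M V μ f x * ψ x‖ ≤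
        C * (((eLpNorm f 2).toReal + ∑ k, (eLpNorm (weakPartial f k) 2).toReal)
            * (eLpNorm ψ 2).toReal
          + (eLpNorm f (expR n)).toReal ^ ((n + 4) / n : ℝ) * (eLpNorm ψ (expR n)).toReal) := by
  have := holderTriple_expR hn
  set η : Rn n → ℝ := (Metric.closedBall (0 : Rn n) R).indicator fun _ => (1 : ℝ) with hη
  have hηw : IsRadialWeight η := isRadialWeight_indicator_closedBall R
  obtain ⟨C₁, hC₁0, hC₁⟩ := exists_eLpNorm_weight_mul_le (hηw.mul_coeff hV).toIsWeight
  obtain ⟨C₂, hC₂0, hC₂⟩ := exists_eLpNorm_weight_mul_le (hηw.mul_coeff hμ).toIsWeight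
  obtain ⟨C₃, hC₃0, hC₃⟩ := exists_eLpNorm_weight_mul_rotSum_le M hηw.toIsWeight
  refine ⟨C₁ + C₂ + C₃, by positivity, fun f hf hfr ψ hψ2 hψr hψ => ?_⟩
  obtain ⟨m1, b1⟩ := hC₁ 2 f hf.1
  obtain ⟨m2, b2⟩ := hC₂ (expR' n) (nonlin f) (memLp_nonlin hn hfr)
  have m3 := memLp_weight_mul_rotSum M hηw.toIsWeight (p := 2) one_le_two hf.memLp_weakPartial
  have b3 : (eLpNorm (fun x => (η x : ℂ) * rotSum M (weakPartial f) x) 2).toReal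
      ≤ C₃ * ∑ k, (eLpNorm (weakPartial f k) 2).toReal := by
    have := ENNReal.toReal_mono (ENNReal.mul_ne_top ENNReal.ofReal_ne_top
      (ENNReal.sum_ne_top.2 fun k _ => (hf.memLp_weakPartial k).2.ne))
      (hC₃ 2 one_le_two (weakPartial f) fun k => (hf.memLp_weakPartial k).1)
    rwa [ENNReal.toReal_mul, ENNReal.toReal_ofReal hC₃0,
      ENNReal.toReal_sum fun k _ => (hf.memLp_weakPartial k).2.ne] at this
  have b2' : (eLpNorm (fun x => ((η x * μ x : ℝ) : ℂ) * nonlin f x) (expR' n)).toReal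
      ≤ C₂ * (eLpNorm f (expR n)).toReal ^ ((n + 4) / n : ℝ) := by
    rwa [eLpNorm_nonlin hn, ← ENNReal.toReal_rpow] at b2
  have i1 : Integrable fun x => ((η x * V x : ℝ) : ℂ) * f x * ψ x :=
    MemLp.integrable_mul (p := 2) (q := 2) m1 hψ2
  have i2 : Integrable fun x => ((η x * μ x : ℝ) : ℂ) * nonlin f x * ψ x :=
    MemLp.integrable_mul (p := expR' n) (q := expR n) m2 hψr
  have i3 : Integrable fun x => (η x : ℂ) * rotSum M (weakPartial f) x * ψ x :=
    MemLp.integrable_mul (p := 2) (q := 2) m3 hψ2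
  have n1 := norm_integral_mul_le (p := 2) (q := 2) m1 hψ2
  have n2 := norm_integral_mul_le (p := expR' n) (q := expR n) m2 hψr
  have n3 := norm_integral_mul_le (p := 2) (q := 2) m3 hψ2
  have i12 : Integrable fun x => ((η x * V x : ℝ) : ℂ) * f x * ψ x
    + ((η x * μ x : ℝ) : ℂ) * nonlin f x * ψ x := i1.add i2
  have i123 := i12.add (i3.const_mul Complex.I)
  have e : ∀ x, ((η x * V x : ℝ) : ℂ) * f x * ψ x + ((η x * μ x : ℝ) : ℂ) * nonlin f x * ψ x
      + Complex.I * ((η x : ℂ) * rotSum M (weakPartial f) x * ψ x) = source M V μ f x * ψ x := by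
    intro x
    by_cases hx : x ∈ Metric.closedBall (0 : Rn n) R
    · rw [source, rotDeriv_eq_rotSum]
      simp only [hη, Set.indicator_of_mem hx]
      push_cast
      ring
    · simp [hψ x (by simpa using hx)]
  refine ⟨i123.congr (ae_of_all _ e), ?_⟩
  have hsplit : ∫ x, source M V μ f x * ψ x = (∫ x, ((η x * V x : ℝ) : ℂ) * f x * ψ x)
      + (∫ x, ((η x * μ x : ℝ) : ℂ) * nonlin f x * ψ x)
      + Complex.I * ∫ x, (η x : ℂ) * rotSum M (weakPartial f) x * ψ x := by
    rw [← integral_const_mul, ← integral_add i1 i2, ← integral_add i12 (i3.const_mul _)]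
    exact integral_congr_ae (ae_of_all _ fun x => (e x).symm)
  rw [hsplit]
  refine (norm_add₃_le).trans ?_
  rw [norm_mul, Complex.norm_I, one_mul]
  have ha0 : 0 ≤ (eLpNorm f 2).toReal := ENNReal.toReal_nonneg
  have hg0 : 0 ≤ ∑ k, (eLpNorm (weakPartial f k) 2).toReal :=
    Finset.sum_nonneg fun k _ => ENNReal.toReal_nonneg
  have hN0 : 0 ≤ (eLpNorm f (expR n)).toReal ^ ((n + 4) / n : ℝ) :=
    Real.rpow_nonneg ENNReal.toReal_nonneg _
  have hp20 : 0 ≤ (eLpNorm ψ 2).toReal := ENNReal.toReal_nonneg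
  have hpr0 : 0 ≤ (eLpNorm ψ (expR n)).toReal := ENNReal.toReal_nonneg
  have t1 := n1.trans (mul_le_mul_of_nonneg_right b1 hp20)
  have t2 := n2.trans (mul_le_mul_of_nonneg_right b2' hpr0)
  have t3 := n3.trans (mul_le_mul_of_nonneg_right b3 hp20)
  refine (add_le_add (add_le_add t1 t2) t3).trans ?_
  clear t1 t2 t3 n1 n2 n3 b1 b2 b2' b3
  generalize (eLpNorm f 2).toReal = a at *
  generalize ∑ k, (eLpNorm (weakPartial f k) 2).toReal = g at *
  generalize (eLpNorm f (expR n)).toReal ^ ((n + 4) / n : ℝ) = N at *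
  generalize (eLpNorm ψ 2).toReal = p2 at *
  generalize (eLpNorm ψ (expR n)).toReal = pr at *
  have w1 := mul_nonneg (add_nonneg hC₂0 hC₃0) (mul_nonneg ha0 hp20)
  have w2 := mul_nonneg (add_nonneg hC₁0 hC₃0) (mul_nonneg hN0 hpr0)
  have w3 := mul_nonneg (add_nonneg hC₁0 hC₂0) (mul_nonneg hg0 hp20)
  linarith

theorem tendsto_integral_source {M : Matrix (Fin n) (Fin n) ℝ} {V μ : Rn n → ℝ}
    (hn : 1 ≤ n) (hV : IsRadialCoeff V) (hμ : IsRadialCoeff μ) {f : Rn n → ℂ} (hf : MemH 2 f)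
    (hfr : MemLp f (expR n)) {R : ℝ} {ψ : Rn n → ℂ} {Ψ : ℕ → Rn n → ℂ} (h2 : MemLp ψ 2)
    (hr : MemLp ψ (expR n)) (h0 : ∀ x, R < ‖x‖ → ψ x = 0) (H2 : ∀ i, MemLp (Ψ i) 2)
    (Hr : ∀ i, MemLp (Ψ i) (expR n)) (H0 : ∀ i x, R < ‖x‖ → Ψ i x = 0)
    (hlim2 : Tendsto (fun i => eLpNorm (Ψ i - ψ) 2) atTop (𝓝 0))
    (hlimr : Tendsto (fun i => eLpNorm (Ψ i - ψ) (expR n)) atTop (𝓝 0)) :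
    Tendsto (fun i => ∫ x, source M V μ f x * Ψ i x) atTop
      (𝓝 (∫ x, source M V μ f x * ψ x)) := by
  obtain ⟨C, hC0, hC⟩ := exists_norm_integral_source_le M hn hV hμ R
  have hlim : Tendsto (fun i =>
      C * (((eLpNorm f 2).toReal + ∑ k, (eLpNorm (weakPartial f k) 2).toReal)
            * (eLpNorm (Ψ i - ψ) 2).toReal
          + (eLpNorm f (expR n)).toReal ^ ((n + 4) / n : ℝ)
            * (eLpNorm (Ψ i - ψ) (expR n)).toReal)) atTop (𝓝 0) := by
    have t2 := (ENNReal.tendsto_toReal ENNReal.zero_ne_top).comp hlim2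
    have tr := (ENNReal.tendsto_toReal ENNReal.zero_ne_top).comp hlimr
    have := ((t2.const_mul ((eLpNorm f 2).toReal
      + ∑ k, (eLpNorm (weakPartial f k) 2).toReal)).add
      (tr.const_mul ((eLpNorm f (expR n)).toReal ^ ((n + 4) / n : ℝ)))).const_mul C
    simpa using this
  rw [tendsto_iff_norm_sub_tendsto_zero]
  refine squeeze_zero (fun i => norm_nonneg _) (fun i => ?_) hlim
  have h1 := (hC f hf hfr (Ψ i) (H2 i) (Hr i) (H0 i)).1
  have h2' := (hC f hf hfr ψ h2 hr h0).1
  have h3 := (hC f hf hfr (Ψ i - ψ) ((H2 i).sub h2) ((Hr i).sub hr)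
    fun x hx => by simp [H0 i x hx, h0 x hx]).2
  rw [← integral_sub h1 h2']
  simpa only [Pi.sub_apply, mul_sub] using h3

/-- The nonlinear term does not contribute: `|f|^{4/n}` is truncated at height `m`, which puts it
in reach of `re_integral_weight_eq_zero`, and then `m → ∞`; the `L^r` bounds on `f` and `∇f`
provide the integrable majorant. -/
theorem re_integral_nonlin_eq_zero {M : Matrix (Fin n) (Fin n) ℝ} (hM : Mᵀ = -M) (hn : 1 ≤ n)
    {h : Rn n → ℝ} (hh : IsRadialWeight h) {f : Rn n → ℂ} (hf : MemH 2 f)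
    (hfr : MemH (expR n) f) :
    (∫ x, conj (nonlin f x) * ((h x : ℂ) * rotSum M (weakPartial f) x)).re = 0 := by
  have := holderTriple_expR hn
  have hn0 : (0 : ℝ) < n := by exact_mod_cast hn
  set b : Rn n → ℂ := fun x => (h x : ℂ) * rotSum M (weakPartial f) x with hb
  have hbr : MemLp b (expR n) :=
    memLp_weight_mul_rotSum M hh.toIsWeight (one_le_expR hn) hfr.memLp_weakPartial
  have hint : Integrable fun x => conj (nonlin f x) * b x :=
    MemLp.integrable_mul (p := expR' n) (q := expR n) (memLp_conj (memLp_nonlin hn hfr.1)) hbr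
  set θ : ℕ → ℝ → ℝ := fun m y => min (|y| ^ (2 / n : ℝ)) m with hθ
  have hθc : ∀ m, Continuous (θ m) := fun m =>
    (continuous_abs.rpow_const fun _ => Or.inr (by positivity)).min continuous_const
  have hθb : ∀ m y, |θ m y| ≤ m := fun m y => by
    rw [abs_of_nonneg (le_min (by positivity) (by positivity))]
    exact min_le_right _ _
  have hpow : ∀ x, |‖f x‖ ^ 2| ^ (2 / n : ℝ) = ‖f x‖ ^ (4 / n : ℝ) := fun x => by
    rw [abs_of_nonneg (by positivity), ← Real.rpow_natCast, ← Real.rpow_mul (norm_nonneg _)]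
    congr 1
    push_cast
    ring
  have hlim : Tendsto (fun m : ℕ => ∫ x, ((θ m (‖f x‖ ^ 2) : ℝ) : ℂ) * (conj (f x) * b x)) atTop
      (𝓝 (∫ x, conj (nonlin f x) * b x)) := by
    refine tendsto_integral_of_dominated_convergence (fun x => ‖conj (nonlin f x) * b x‖)
      (fun m => ?_) hint.norm (fun m => ae_of_all _ fun x => ?_) (ae_of_all _ fun x => ?_)
    · have h1 : AEStronglyMeasurable (fun x => ((θ m (‖f x‖ ^ 2) : ℝ) : ℂ)) volume :=
        ((Complex.continuous_ofReal.comp (hθc m)).comp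
          (continuous_norm.pow 2)).comp_aestronglyMeasurable hf.1.1
      exact h1.mul ((memLp_conj hf.1).1.mul hbr.1)
    · have h1 : ‖conj (nonlin f x) * b x‖ = ‖f x‖ ^ (4 / n : ℝ) * ‖conj (f x) * b x‖ := by
        rw [nonlin, map_mul, Complex.conj_ofReal, mul_assoc, norm_mul, Complex.norm_real,
          Real.norm_of_nonneg (by positivity)]
      have h2 : ‖((θ m (‖f x‖ ^ 2) : ℝ) : ℂ)‖ ≤ ‖f x‖ ^ (4 / n : ℝ) := by
        rw [Complex.norm_real, Real.norm_of_nonneg (le_min (by positivity) (by positivity)),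
          ← hpow]
        exact min_le_left _ _
      rw [h1, norm_mul]
      exact mul_le_mul_of_nonneg_right h2 (norm_nonneg (conj (f x) * b x))
    · refine tendsto_const_nhds.congr' ?_
      filter_upwards [eventually_ge_atTop ⌈|‖f x‖ ^ 2| ^ (2 / n : ℝ)⌉₊] with m hm
      have : θ m (‖f x‖ ^ 2) = ‖f x‖ ^ (4 / n : ℝ) := by
        rw [← hpow, hθ]
        exact min_eq_left (Nat.ceil_le.1 hm)
      rw [this, nonlin, map_mul, Complex.conj_ofReal, mul_assoc]
  have hre := (Complex.continuous_re.tendsto _).comp hlim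
  refine tendsto_nhds_unique hre (tendsto_const_nhds.congr fun m => ?_)
  exact (re_integral_weight_eq_zero hM hh (hθc m) (hθb m) hf.1 hf.memLp_weakPartial
    hf.hasWeakPartial).symm

/-- None of the lower order terms changes the localised angular momentum. -/
theorem re_integral_source_eq_zero {M : Matrix (Fin n) (Fin n) ℝ} (hM : Mᵀ = -M) (hn : 1 ≤ n)
    {V μ : Rn n → ℝ} (hV : IsRadialCoeff V) (hμ : IsRadialCoeff μ) {χ : Rn n → ℝ}
    (hχ : IsRadialWeight χ) {f : Rn n → ℂ} (hf : MemH 2 f) (hfr : MemH (expR n) f) :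
    (∫ x, source M V μ f x * conj ((χ x : ℂ) * rotSum M (weakPartial f) x)).re = 0 := by
  have := holderTriple_expR hn
  have hχV := hχ.mul_coeff hV
  have hχμ := hχ.mul_coeff hμ
  have mV : MemLp (fun x => ((χ x * V x : ℝ) : ℂ) * rotSum M (weakPartial f) x) 2 :=
    memLp_weight_mul_rotSum M hχV.toIsWeight one_le_two hf.memLp_weakPartial
  have mμ : MemLp (fun x => ((χ x * μ x : ℝ) : ℂ) * rotSum M (weakPartial f) x) (expR n) :=
    memLp_weight_mul_rotSum M hχμ.toIsWeight (one_le_expR hn) hfr.memLp_weakPartial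
  have iV : Integrable fun x =>
      conj (f x) * (((χ x * V x : ℝ) : ℂ) * rotSum M (weakPartial f) x) :=
    MemLp.integrable_mul (p := 2) (q := 2) (memLp_conj hf.1) mV
  have iμ : Integrable fun x =>
      conj (nonlin f x) * (((χ x * μ x : ℝ) : ℂ) * rotSum M (weakPartial f) x) :=
    MemLp.integrable_mul (p := expR' n) (q := expR n) (memLp_conj (memLp_nonlin hn hfr.1)) mμ
  obtain ⟨R, hR⟩ := hχ.support
  have iS := ((exists_norm_integral_source_le M hn hV hμ R).choose_spec.2 f hf hfr.1 _
    (memLp_conj (memLp_weight_mul_rotSum M hχ.toIsWeight one_le_two hf.memLp_weakPartial))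
    (memLp_conj (memLp_weight_mul_rotSum M hχ.toIsWeight (one_le_expR hn) hfr.memLp_weakPartial))
    fun x hx => by simp [hR x hx]).1
  have h0V : (∫ x, conj (f x) * (((χ x * V x : ℝ) : ℂ) * rotSum M (weakPartial f) x)).re = 0 := by
    have := re_integral_weight_eq_zero hM hχV (θ := fun _ => 1) continuous_const (B := 1)
      (fun _ => by simp) hf.1 hf.memLp_weakPartial hf.hasWeakPartial
    simpa using this
  have h0μ := re_integral_nonlin_eq_zero hM hn hχμ hf hfr
  have hre : ∀ x, (source M V μ f x * conj ((χ x : ℂ) * rotSum M (weakPartial f) x)).re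
      = (conj (f x) * (((χ x * V x : ℝ) : ℂ) * rotSum M (weakPartial f) x)).re
        + (conj (nonlin f x) * (((χ x * μ x : ℝ) : ℂ) * rotSum M (weakPartial f) x)).re := by
    intro x
    rw [source, rotDeriv_eq_rotSum]
    simp only [Complex.add_re, Complex.mul_re, Complex.mul_im, Complex.add_im, Complex.conj_re,
      Complex.conj_im, Complex.ofReal_re, Complex.ofReal_im, Complex.I_re, Complex.I_im,
      Complex.ofReal_mul]
    ring
  have e := integral_re (𝕜 := ℂ) iS
  have eV := integral_re (𝕜 := ℂ) iV
  have eμ := integral_re (𝕜 := ℂ) iμ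
  refine e.symm.trans ((integral_congr_ae (ae_of_all _ hre)).trans ?_)
  refine (integral_add iV.re iμ.re).trans ?_
  rw [eV, eμ]
  exact (congrArg₂ (· + ·) h0V h0μ).trans (add_zero _)

/-! ### The localised angular momentum balance -/

/-- The Sobolev norm `‖f‖_p + ∑ₖ ‖∂ₖf‖_p`, as a real number. -/
noncomputable def sobNorm (p : ℝ≥0∞) (f : Rn n → ℂ) : ℝ :=
  (eLpNorm f p).toReal + ∑ k, (eLpNorm (weakPartial f k) p).toReal

theorem sobNorm_nonneg (p : ℝ≥0∞) (f : Rn n → ℂ) : 0 ≤ sobNorm p f :=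
  add_nonneg ENNReal.toReal_nonneg (Finset.sum_nonneg fun _ _ => ENNReal.toReal_nonneg)

theorem toReal_eLpNorm_le_sobNorm (p : ℝ≥0∞) (f : Rn n → ℂ) :
    (eLpNorm f p).toReal ≤ sobNorm p f :=
  le_add_of_nonneg_right (Finset.sum_nonneg fun _ _ => ENNReal.toReal_nonneg)

theorem sum_toReal_eLpNorm_le_sobNorm (p : ℝ≥0∞) (f : Rn n → ℂ) :
    ∑ k, (eLpNorm (weakPartial f k) p).toReal ≤ sobNorm p f :=
  le_add_of_nonneg_left ENNReal.toReal_nonneg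

theorem toReal_le_mul_sum {p : ℝ≥0∞} {C : ℝ} (hC : 0 ≤ C) {f : Rn n → ℂ} {g : Fin n → Rn n → ℂ}
    (hg : ∀ k, MemLp (g k) p) (h : eLpNorm f p ≤ ENNReal.ofReal C * ∑ k, eLpNorm (g k) p) :
    (eLpNorm f p).toReal ≤ C * ∑ k, (eLpNorm (g k) p).toReal := by
  have := ENNReal.toReal_mono (ENNReal.mul_ne_top ENNReal.ofReal_ne_top
    (ENNReal.sum_ne_top.2 fun k _ => (hg k).2.ne)) h
  rwa [ENNReal.toReal_mul, ENNReal.toReal_ofReal hC,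
    ENNReal.toReal_sum fun k _ => (hg k).2.ne] at this

theorem isWeight_fderiv {χ : Rn n → ℝ} (hχ : ContDiff ℝ ∞ χ) (hχw : IsWeight χ) (k : Fin n) :
    IsWeight fun x => fderiv ℝ χ x (EuclideanSpace.single k 1) := by
  obtain ⟨R, hR⟩ := hχw.support
  exact isWeight_of_continuous ((hχ.continuous_fderiv (by simp)).clm_apply continuous_const)
      ((hasCompactSupport_of_forall_norm_lt hR).fderiv_apply ℝ _)

/-- The quantity `Re ∫ (∇f · ∇χ) conj(A·∇f)`, the defect in the conservation of the angular
momentum localised by the cutoff `χ`. -/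
noncomputable def defect (χ : Rn n → ℝ) (M : Matrix (Fin n) (Fin n) ℝ)
    (g : Fin n → Rn n → ℂ) : ℝ :=
  (∑ k, ∫ x, g k x *
    conj ((fderiv ℝ χ x (EuclideanSpace.single k 1) : ℂ) * rotSum M g x)).re

theorem exists_abs_defect_le {χ : Rn n → ℝ} (hχ : ContDiff ℝ ∞ χ) (hχw : IsWeight χ)
    (M : Matrix (Fin n) (Fin n) ℝ) : ∃ C : ℝ, 0 ≤ C ∧ ∀ g : Fin n → Rn n → ℂ,
      (∀ k, MemLp (g k) 2) → |defect χ M g| ≤ C * (∑ k, (eLpNorm (g k) 2).toReal) ^ 2 := by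
  choose C hC0 hC using fun k => exists_eLpNorm_weight_mul_rotSum_le M (isWeight_fderiv hχ hχw k)
  refine ⟨∑ k, C k, Finset.sum_nonneg fun k _ => hC0 k, fun g hg => ?_⟩
  refine (Complex.abs_re_le_norm _).trans ((norm_sum_le _ _).trans ?_)
  rw [Finset.sum_mul]
  refine Finset.sum_le_sum fun k _ => ?_
  have m := memLp_weight_mul_rotSum M (isWeight_fderiv hχ hχw k) one_le_two hg
  refine (norm_integral_mul_le (p := 2) (q := 2) (hg k) (memLp_conj m)).trans ?_
  have e : eLpNorm (fun x => conj ((fderiv ℝ χ x (EuclideanSpace.single k 1) : ℂ)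
      * rotSum M g x)) 2 = eLpNorm (fun x => (fderiv ℝ χ x (EuclideanSpace.single k 1) : ℂ)
      * rotSum M g x) 2 := eLpNorm_congr_norm_ae (ae_of_all _ fun x => by simp)
  rw [e]
  have h1 := toReal_le_mul_sum (hC0 k) hg (hC k 2 one_le_two g fun j => (hg j).1)
  have hN0 : ∀ k, 0 ≤ (eLpNorm (g k) 2).toReal := fun k => ENNReal.toReal_nonneg
  generalize hN : (fun k => (eLpNorm (g k) 2).toReal) = N at *
  have hNk : ∀ k, (eLpNorm (g k) 2).toReal = N k := fun k => congrFun hN k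
  simp only [hNk] at *
  have h2 : N k ≤ ∑ k, N k := Finset.single_le_sum (fun k _ => hN0 k) (Finset.mem_univ k)
  have h0 : 0 ≤ ∑ k, N k := Finset.sum_nonneg fun k _ => hN0 k
  refine (mul_le_mul h2 h1 ENNReal.toReal_nonneg h0).trans (le_of_eq ?_)
  ring

theorem tendsto_defect_moll {χ : Rn n → ℝ} (hχ : ContDiff ℝ ∞ χ) (hχw : IsWeight χ)
    (M : Matrix (Fin n) (Fin n) ℝ) {g : Fin n → Rn n → ℂ} (hg : ∀ k, MemLp (g k) 2) :
    Tendsto (fun i => defect χ M fun k => moll (bump n i) (g k)) atTop (𝓝 (defect χ M g)) := by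
  have h2t : (2 : ℝ≥0∞) ≠ ⊤ := by simp
  have hm : ∀ i k, MemLp (moll (bump n i) (g k)) 2 := fun i k =>
    memLp_moll _ one_le_two h2t (hg k)
  refine (Complex.continuous_re.tendsto _).comp (tendsto_finsetSum _ fun k _ => ?_)
  have hw := isWeight_fderiv hχ hχw k
  refine tendsto_integral_mul (p := 2) (q := 2) one_le_two (hg k)
    (memLp_conj (memLp_weight_mul_rotSum M hw one_le_two hg)) (fun i => hm i k)
    (fun i => memLp_conj (memLp_weight_mul_rotSum M hw one_le_two (hm i)))
    (tendsto_eLpNorm_moll_sub (tendsto_bump_rOut n) one_le_two h2t (hg k)) ?_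
  simp_rw [eLpNorm_conj_sub]
  exact tendsto_eLpNorm_weight_mul_rotSum M hw one_le_two (fun j => (hg j).1)
    (fun i j => (hm i j).1) fun j =>
      tendsto_eLpNorm_moll_sub (tendsto_bump_rOut n) one_le_two h2t (hg j)

theorem bump_rOut_le (n i : ℕ) : (bump n i).rOut ≤ 1 := by
  change 1 / ((i : ℝ) + 1) ≤ 1
  rw [div_le_one (by positivity)]
  linarith [(Nat.cast_nonneg i : (0 : ℝ) ≤ i)]

theorem angOp_bump_eq_zero {χ : Rn n → ℝ} {R : ℝ} (hR : ∀ x, R < ‖x‖ → χ x = 0)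
    (M : Matrix (Fin n) (Fin n) ℝ) (i : ℕ) (f : Rn n → ℂ) {x : Rn n} (hx : R + 1 < ‖x‖) :
    angOp (bump n i) χ M f x = 0 :=
  angOp_eq_zero _ M hR f (by linarith [bump_rOut_le n i])

section

variable {M : Matrix (Fin n) (Fin n) ℝ} {V μ χ : Rn n → ℝ}

/-- The equation tested against `conj (K f)`, where `K` is the regularised operator `angOp`: the
Laplacian contributes the defect of the mollified gradient, and only the lower order terms
remain. -/
theorem re_weakForm_conj_angOp (hM : Mᵀ = -M) (hχ : ContDiff ℝ ∞ χ) (hχr : IsRadialWeight χ)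
    (φ : ContDiffBump (0 : Rn n)) {f : Rn n → ℂ} (hf : MemH 2 f) :
    (weakForm M V μ f fun x => conj (angOp φ χ M f x)).re
      = defect χ M (fun k => moll φ (weakPartial f k))
        + (∫ x, source M V μ f x * conj (angOp φ χ M f x)).re := by
  have hfl := hf.1.locallyIntegrable one_le_two
  have hpd : pderiv (moll φ f) = fun k => moll φ (weakPartial f k) :=
    funext fun k => pderiv_moll φ (hf.hasWeakPartial k)
  have h1 : ∀ k x, pderiv (fun x => conj (angOp φ χ M f x)) k x
      = conj (pderiv (angOp φ χ M f) k x) := fun k x => pderiv_conj (contDiff_angOp φ M hχ hfl) k x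
  rw [weakForm, Complex.add_re]
  congr 1
  simp_rw [h1, integral_mul_conj_pderiv_angOp φ M hχ hχr.toIsWeight (hf.hasWeakPartial _)]
  rw [re_sum_integral_pderiv_weight hM hχr hχ (moll_contDiff φ hfl), hpd, defect]

/-- As the mollification parameter tends to zero, only the defect of the cutoff survives. This is
where both integrability classes of `f` are needed: `L²` for the linear terms and `L^r` for the
nonlinear one. -/
theorem tendsto_re_weakForm_conj_angOp (hM : Mᵀ = -M) (hn : 1 ≤ n) (hV : IsRadialCoeff V)
    (hμ : IsRadialCoeff μ) (hχ : ContDiff ℝ ∞ χ) (hχr : IsRadialWeight χ) {f : Rn n → ℂ}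
    (hf : MemH 2 f) (hfr : MemH (expR n) f) :
    Tendsto (fun i => (weakForm M V μ f fun x => conj (angOp (bump n i) χ M f x)).re) atTop
      (𝓝 (defect χ M (weakPartial f))) := by
  obtain ⟨R, hR⟩ := hχr.support
  have h2t : (2 : ℝ≥0∞) ≠ ⊤ := by simp
  have hrt : expR n ≠ ⊤ := ENNReal.ofReal_ne_top
  have hr1 := one_le_expR hn
  have hw := hχr.toIsWeight
  simp_rw [re_weakForm_conj_angOp hM hχ hχr _ hf]
  rw [← add_zero (defect χ M (weakPartial f)),
    ← re_integral_source_eq_zero hM hn hV hμ hχr hf hfr]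
  refine (tendsto_defect_moll hχ hw M hf.memLp_weakPartial).add
    ((Complex.continuous_re.tendsto _).comp ?_)
  refine tendsto_integral_source hn hV hμ hf hfr.1 (R := R + 1)
    (memLp_conj (memLp_weight_mul_rotSum M hw one_le_two hf.memLp_weakPartial))
    (memLp_conj (memLp_weight_mul_rotSum M hw hr1 hfr.memLp_weakPartial))
    (fun x hx => by simp [hR x (by linarith)])
    (fun i => memLp_conj (memLp_angOp _ M hw one_le_two h2t hf.hasWeakPartial
      hf.memLp_weakPartial))
    (fun i => memLp_conj (memLp_angOp _ M hw hr1 hrt hfr.hasWeakPartial hfr.memLp_weakPartial))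
    (fun i x hx => by rw [angOp_bump_eq_zero hR M i f hx, map_zero]) ?_ ?_
  · simp_rw [eLpNorm_conj_sub]
    exact tendsto_eLpNorm_angOp M hw one_le_two h2t hf.hasWeakPartial hf.memLp_weakPartial
  · simp_rw [eLpNorm_conj_sub]
    exact tendsto_eLpNorm_angOp M hw hr1 hrt hfr.hasWeakPartial hfr.memLp_weakPartial

theorem eLpNorm_conj (f : Rn n → ℂ) (p : ℝ≥0∞) :
    eLpNorm (fun x => conj (f x)) p = eLpNorm f p :=
  eLpNorm_congr_norm_ae (ae_of_all _ fun x => by simp)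

/-- A bound uniform in the mollification parameter `i`, whose right-hand side is integrable in time
along a solution. -/
theorem exists_abs_re_weakForm_conj_angOp_le (hM : Mᵀ = -M) (hn : 1 ≤ n) (hV : IsRadialCoeff V)
    (hμ : IsRadialCoeff μ) (hχ : ContDiff ℝ ∞ χ) (hχr : IsRadialWeight χ) :
    ∃ C : ℝ, 0 ≤ C ∧ ∀ (i : ℕ) (f : Rn n → ℂ), MemH 2 f → MemH (expR n) f →
      |(weakForm M V μ f fun x => conj (angOp (bump n i) χ M f x)).re|
        ≤ C * (sobNorm 2 f ^ 2 + sobNorm (expR n) f ^ ((2 * n + 4) / n : ℝ)) := by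
  obtain ⟨R, hR⟩ := hχr.support
  have hn0 : (0 : ℝ) < n := by exact_mod_cast hn
  have h2t : (2 : ℝ≥0∞) ≠ ⊤ := by simp
  have hrt : expR n ≠ ⊤ := ENNReal.ofReal_ne_top
  have hr1 := one_le_expR hn
  have hw := hχr.toIsWeight
  obtain ⟨C₁, hC₁0, hC₁⟩ := exists_abs_defect_le hχ hw M
  obtain ⟨C₂, hC₂0, hC₂⟩ := exists_norm_integral_source_le M hn hV hμ (R + 1)
  obtain ⟨C₃, hC₃0, hC₃⟩ := exists_eLpNorm_angOp_le M hw
  refine ⟨C₁ + C₂ * C₃, by positivity, fun i f hf hfr => ?_⟩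
  rw [re_weakForm_conj_angOp hM hχ hχr _ hf]
  have d1 := hC₁ (fun k => moll (bump n i) (weakPartial f k))
    fun k => memLp_moll _ one_le_two h2t (hf.memLp_weakPartial k)
  have d2 : ∑ k, (eLpNorm (moll (bump n i) (weakPartial f k)) 2).toReal ≤ sobNorm 2 f := by
    refine le_trans (Finset.sum_le_sum fun k _ => ?_) (sum_toReal_eLpNorm_le_sobNorm 2 f)
    exact ENNReal.toReal_mono (hf.memLp_weakPartial k).2.ne
      (eLpNorm_moll_le _ one_le_two h2t (hf.memLp_weakPartial k).1)
  have d0 : 0 ≤ ∑ k, (eLpNorm (moll (bump n i) (weakPartial f k)) 2).toReal :=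
    Finset.sum_nonneg fun k _ => ENNReal.toReal_nonneg
  have d3 : |defect χ M fun k => moll (bump n i) (weakPartial f k)| ≤ C₁ * sobNorm 2 f ^ 2 :=
    d1.trans (mul_le_mul_of_nonneg_left (pow_le_pow_left₀ d0 d2 2) hC₁0)
  have m2 := memLp_angOp (bump n i) M hw one_le_two h2t hf.hasWeakPartial hf.memLp_weakPartial
  have mr := memLp_angOp (bump n i) M hw hr1 hrt hfr.hasWeakPartial hfr.memLp_weakPartial
  have s1 := (hC₂ f hf hfr.1 _ (memLp_conj m2) (memLp_conj mr)
    fun x hx => by rw [angOp_bump_eq_zero hR M i f hx, map_zero]).2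
  rw [eLpNorm_conj, eLpNorm_conj] at s1
  have a2 : (eLpNorm (angOp (bump n i) χ M f) 2).toReal ≤ C₃ * sobNorm 2 f :=
    (toReal_le_mul_sum hC₃0 hf.memLp_weakPartial (hC₃ (bump n i) 2 one_le_two h2t f _
      hf.hasWeakPartial hf.memLp_weakPartial)).trans
      (mul_le_mul_of_nonneg_left (sum_toReal_eLpNorm_le_sobNorm 2 f) hC₃0)
  have ar : (eLpNorm (angOp (bump n i) χ M f) (expR n)).toReal ≤ C₃ * sobNorm (expR n) f :=
    (toReal_le_mul_sum hC₃0 hfr.memLp_weakPartial (hC₃ (bump n i) _ hr1 hrt f _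
      hfr.hasWeakPartial hfr.memLp_weakPartial)).trans
      (mul_le_mul_of_nonneg_left (sum_toReal_eLpNorm_le_sobNorm _ f) hC₃0)
  have s2 : ‖∫ x, source M V μ f x * conj (angOp (bump n i) χ M f x)‖
      ≤ C₂ * (sobNorm 2 f * (C₃ * sobNorm 2 f)
        + sobNorm (expR n) f ^ ((n + 4) / n : ℝ) * (C₃ * sobNorm (expR n) f)) := by
    refine s1.trans (mul_le_mul_of_nonneg_left (add_le_add ?_ ?_) hC₂0)
    · exact mul_le_mul_of_nonneg_left a2 (sobNorm_nonneg 2 f)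
    · exact mul_le_mul (Real.rpow_le_rpow ENNReal.toReal_nonneg
        (toReal_eLpNorm_le_sobNorm _ f) (by positivity)) ar ENNReal.toReal_nonneg
        (Real.rpow_nonneg (sobNorm_nonneg _ f) _)
  have e : sobNorm (expR n) f ^ ((n + 4) / n : ℝ) * sobNorm (expR n) f
      = sobNorm (expR n) f ^ ((2 * n + 4) / n : ℝ) := by
    have : ((2 * n + 4) / n : ℝ) = (n + 4) / n + 1 := by field_simp; ring
    rw [this, Real.rpow_add_one' (sobNorm_nonneg _ f) (by positivity)]
  refine (abs_add_le _ _).trans ((add_le_add d3 ((Complex.abs_re_le_norm _).trans s2)).trans ?_)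
  have e2 : sobNorm (expR n) f ^ ((n + 4) / n : ℝ) * (C₃ * sobNorm (expR n) f)
      = C₃ * sobNorm (expR n) f ^ ((2 * n + 4) / n : ℝ) := by rw [← e]; ring
  rw [e2]
  have p1 := mul_nonneg hC₁0 (Real.rpow_nonneg (sobNorm_nonneg (expR n) f) ((2 * n + 4) / n : ℝ))
  nlinarith [p1]

/-- For a fixed mollifier, the equation tested against `conj (K z)` is continuous in `z` for the
`L²` norm, because `K` maps `L²` to smooth functions. -/
theorem exists_norm_weakForm_conj_angOp_le (hn : 1 ≤ n) (hV : IsRadialCoeff V)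
    (hμ : IsRadialCoeff μ) (hχ : ContDiff ℝ ∞ χ) (hχw : IsWeight χ)
    (φ : ContDiffBump (0 : Rn n)) :
    ∃ C : ℝ, 0 ≤ C ∧ ∀ f : Rn n → ℂ, MemH 2 f → MemLp f (expR n) → ∀ z : Rn n → ℂ, MemLp z 2 →
      ‖weakForm M V μ f fun x => conj (angOp φ χ M z x)‖
        ≤ C * (sobNorm 2 f + (eLpNorm f (expR n)).toReal ^ ((n + 4) / n : ℝ))
          * (eLpNorm z 2).toReal := by
  obtain ⟨R, hR⟩ := hχw.support
  have h2t : (2 : ℝ≥0∞) ≠ ⊤ := by simp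
  have hrt : expR n ≠ ⊤ := ENNReal.ofReal_ne_top
  have hr1 := one_le_expR hn
  obtain ⟨C₁, hC₁0, hC₁⟩ := exists_eLpNorm_angOp_le_two φ M hχ hχw (p := 2) one_le_two h2t
  obtain ⟨C₂, hC₂0, hC₂⟩ := exists_eLpNorm_angOp_le_two φ M hχ hχw hr1 hrt
  obtain ⟨C₃, hC₃0, hC₃⟩ := exists_norm_integral_source_le M hn hV hμ (R + φ.rOut)
  refine ⟨C₁ + C₃ * (C₁ + C₂), by positivity, fun f hf hfr z hz => ?_⟩
  have hzl := hz.locallyIntegrable one_le_two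
  have hK := contDiff_angOp φ M hχ hzl
  have hKc := hasCompactSupport_angOp φ M hR z
  have mK : ∀ p, MemLp (angOp φ χ M z) p := fun p => hK.continuous.memLp_of_hasCompactSupport hKc
  have mP : ∀ k, MemLp (pderiv (angOp φ χ M z) k) 2 := fun k =>
    (contDiff_pderiv hK k).continuous.memLp_of_hasCompactSupport (hKc.fderiv_apply ℝ _)
  have hz0 : 0 ≤ (eLpNorm z 2).toReal := ENNReal.toReal_nonneg
  have s1 := (hC₃ f hf hfr _ (memLp_conj (mK 2)) (memLp_conj (mK _))
    fun x hx => by rw [angOp_eq_zero φ M hR z hx, map_zero]).2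
  rw [eLpNorm_conj, eLpNorm_conj] at s1
  have a2 := ENNReal.toReal_le_of_le_ofReal (mul_nonneg hC₁0 hz0) (hC₁ z hz).1
  have ar := ENNReal.toReal_le_of_le_ofReal (mul_nonneg hC₂0 hz0) (hC₂ z hz).1
  have ap := fun k => ENNReal.toReal_le_of_le_ofReal (mul_nonneg hC₁0 hz0) ((hC₁ z hz).2 k)
  have hp : ∀ k x, pderiv (fun x => conj (angOp φ χ M z x)) k x
      = conj (pderiv (angOp φ χ M z) k x) := fun k x => pderiv_conj hK k x
  have t1 : ‖∑ k, ∫ x, weakPartial f k x * pderiv (fun x => conj (angOp φ χ M z x)) k x‖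
      ≤ sobNorm 2 f * (C₁ * (eLpNorm z 2).toReal) := by
    simp_rw [hp]
    have hk : ∀ k, ‖∫ x, weakPartial f k x * conj (pderiv (angOp φ χ M z) k x)‖
        ≤ (eLpNorm (weakPartial f k) 2).toReal * (C₁ * (eLpNorm z 2).toReal) := fun k => by
      refine (norm_integral_mul_le (p := 2) (q := 2) (hf.memLp_weakPartial k)
        (memLp_conj (mP k))).trans ?_
      rw [eLpNorm_conj]
      exact mul_le_mul_of_nonneg_left (ap k) ENNReal.toReal_nonneg
    refine (norm_sum_le _ _).trans ((Finset.sum_le_sum fun k _ => hk k).trans ?_)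
    rw [← Finset.sum_mul]
    exact mul_le_mul_of_nonneg_right (sum_toReal_eLpNorm_le_sobNorm 2 f)
      (mul_nonneg hC₁0 hz0)
  have hN0 : 0 ≤ (eLpNorm f (expR n)).toReal ^ ((n + 4) / n : ℝ) :=
    Real.rpow_nonneg ENNReal.toReal_nonneg _
  have s2 : ‖∫ x, source M V μ f x * conj (angOp φ χ M z x)‖
      ≤ C₃ * (sobNorm 2 f * (C₁ * (eLpNorm z 2).toReal)
        + (eLpNorm f (expR n)).toReal ^ ((n + 4) / n : ℝ) * (C₂ * (eLpNorm z 2).toReal)) :=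
    s1.trans (mul_le_mul_of_nonneg_left (add_le_add
    (mul_le_mul_of_nonneg_left a2 (sobNorm_nonneg 2 f))
    (mul_le_mul_of_nonneg_left ar hN0)) hC₃0)
  refine (norm_add_le _ _).trans ((add_le_add t1 s2).trans ?_)
  have hs0 := sobNorm_nonneg 2 f
  generalize (eLpNorm f (expR n)).toReal ^ ((n + 4) / n : ℝ) = N at *
  generalize (eLpNorm z 2).toReal = Z at *
  generalize sobNorm 2 f = S at *
  have w1 : 0 ≤ C₃ * C₂ * (S * Z) := by positivity
  have w2 : 0 ≤ (C₁ + C₃ * C₁) * (N * Z) := by positivity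
  nlinarith [w1, w2]

theorem weakForm_conj_angOp_sub (hn : 1 ≤ n) (hV : IsRadialCoeff V)
    (hμ : IsRadialCoeff μ) (hχ : ContDiff ℝ ∞ χ) (hχw : IsWeight χ)
    (φ : ContDiffBump (0 : Rn n)) {f : Rn n → ℂ} (hf : MemH 2 f) (hfr : MemLp f (expR n))
    {z z' : Rn n → ℂ} (hz : LocallyIntegrable z) (hz' : LocallyIntegrable z') :
    weakForm M V μ f (fun x => conj (angOp φ χ M (z - z') x))
      = weakForm M V μ f (fun x => conj (angOp φ χ M z x))
        - weakForm M V μ f fun x => conj (angOp φ χ M z' x) := by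
  obtain ⟨R, hR⟩ := hχw.support
  have hc : ∀ z : Rn n → ℂ, HasCompactSupport fun x => conj (angOp φ χ M z x) := fun z =>
    (hasCompactSupport_angOp φ M hR z).comp_left (map_zero _)
  have hd : ∀ z : Rn n → ℂ, LocallyIntegrable z →
      ContDiff ℝ ∞ fun x => conj (angOp φ χ M z x) := fun z hz =>
    Complex.conjCLE.contDiff.comp (contDiff_angOp φ M hχ hz)
  have := weakForm_add_mul (M := M) hn hV hμ hf hfr (hd z hz) (hc z) (hd z' hz') (hc z') (-1)
  rw [neg_one_mul, ← sub_eq_add_neg] at this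
  rw [← this, angOp_sub φ M hχ hz hz']
  congr 1
  ext x
  simp
  ring

end

/-- The defect disappears when the cutoff is removed, because `∇χ_R` is of size `1/R` and lives
where `‖x‖ ≥ R`, while `A(x)` grows linearly. -/
theorem exists_abs_defect_cutoff_le (M : Matrix (Fin n) (Fin n) ℝ) :
    ∃ C : ℝ, 0 ≤ C ∧ ∀ g : Fin n → Rn n → ℂ, (∀ k, MemLp (g k) 2) →
      (∀ R, 0 < R → |defect (cutoff R) M g| ≤ C * (∑ k, (eLpNorm (g k) 2).toReal) ^ 2) ∧
      Tendsto (fun m : ℕ => defect (cutoff ((m : ℝ) + 1)) M g) atTop (𝓝 0) := by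
  obtain ⟨C, hC0, hC⟩ := exists_norm_fderiv_cutoff_le (n := n)
  set A := ‖Matrix.toEuclideanCLM (𝕜 := ℝ) M‖ with hA
  have hA0 : 0 ≤ A := norm_nonneg _
  have hpt : ∀ (g : Fin n → Rn n → ℂ) (R : ℝ), 0 < R → ∀ (k : Fin n) x,
      ‖g k x * conj ((fderiv ℝ (cutoff R) x (EuclideanSpace.single k 1) : ℂ) * rotSum M g x)‖
        ≤ ∑ j, C * A * (‖g k x‖ * ‖g j x‖) := by
    intro g R hR k x
    have h1 : ‖rotSum M g x‖ ≤ ∑ j, A * ‖x‖ * ‖g j x‖ := by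
      refine (norm_sum_le _ _).trans (Finset.sum_le_sum fun j _ => ?_)
      rw [norm_mul, Complex.norm_real]
      exact mul_le_mul_of_nonneg_right (abs_mulVec_le M x j) (norm_nonneg _)
    rw [norm_mul, RCLike.norm_conj, norm_mul, Complex.norm_real, Real.norm_eq_abs]
    calc _ ≤ ‖g k x‖ * (|fderiv ℝ (cutoff R) x (EuclideanSpace.single k 1)|
          * ∑ j, A * ‖x‖ * ‖g j x‖) := by gcongr
      _ = ∑ j, (|fderiv ℝ (cutoff R) x (EuclideanSpace.single k 1)| * ‖x‖) * A
          * (‖g k x‖ * ‖g j x‖) := by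
        rw [Finset.mul_sum, Finset.mul_sum]
        refine Finset.sum_congr rfl fun j _ => ?_
        ring
      _ ≤ _ := by
        refine Finset.sum_le_sum fun j _ => ?_
        gcongr
        exact (hC R hR x k).1
  have hint : ∀ g : Fin n → Rn n → ℂ, (∀ k, MemLp (g k) 2) → ∀ k,
      Integrable fun x => ∑ j, C * A * (‖g k x‖ * ‖g j x‖) := fun g hg k =>
    integrable_finsetSum _ fun j _ =>
      (MemLp.integrable_mul (p := 2) (q := 2) (hg k).norm (hg j).norm).const_mul _
  refine ⟨C * A, by positivity, fun g hg => ⟨fun R hR => ?_, ?_⟩⟩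
  · have hij : ∀ k j, Integrable fun x => C * A * (‖g k x‖ * ‖g j x‖) := fun k j =>
      (MemLp.integrable_mul (p := 2) (q := 2) (hg k).norm (hg j).norm).const_mul _
    refine (Complex.abs_re_le_norm _).trans ((norm_sum_le _ _).trans ?_)
    rw [pow_two, Finset.sum_mul_sum, Finset.mul_sum]
    refine Finset.sum_le_sum fun k _ => ?_
    refine (norm_integral_le_of_norm_le (hint g hg k) (ae_of_all _ (hpt g R hR k))).trans ?_
    rw [integral_finsetSum _ fun j _ => hij k j, Finset.mul_sum]
    refine Finset.sum_le_sum fun j _ => ?_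
    rw [integral_const_mul]
    refine mul_le_mul_of_nonneg_left ?_ (by positivity)
    have h1 := norm_integral_mul_le (p := 2) (q := 2) (a := fun x => (‖g k x‖ : ℂ))
      (b := fun x => (‖g j x‖ : ℂ)) (hg k).norm.ofReal (hg j).norm.ofReal
    have e : ∀ j, eLpNorm (fun x => (‖g j x‖ : ℂ)) 2 = eLpNorm (g j) 2 := fun j =>
      eLpNorm_congr_norm_ae (ae_of_all _ fun x => by simp)
    rw [e, e] at h1
    refine le_trans (le_of_eq ?_) h1
    have e2 : ∫ x, (‖g k x‖ : ℂ) * (‖g j x‖ : ℂ) = ((∫ x, ‖g k x‖ * ‖g j x‖ : ℝ) : ℂ) := by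
      rw [← integral_complex_ofReal]
      push_cast
      rfl
    rw [e2, Complex.norm_real, Real.norm_of_nonneg (integral_nonneg fun x => by positivity)]
  · have hz : ∀ k, Tendsto (fun m : ℕ => ∫ x, g k x * conj ((fderiv ℝ (cutoff ((m : ℝ) + 1)) x
        (EuclideanSpace.single k 1) : ℂ) * rotSum M g x)) atTop (𝓝 0) := by
      intro k
      have := tendsto_integral_of_dominated_convergence (μ := (volume : Measure (Rn n)))
        (F := fun (m : ℕ) x => g k x * conj ((fderiv ℝ (cutoff ((m : ℝ) + 1)) x
        (EuclideanSpace.single k 1) : ℂ) * rotSum M g x)) (f := fun _ => 0) _ ?_ (hint g hg k)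
        (fun m => ae_of_all _ (hpt g _ (by positivity) k)) ?_
      · simpa using this
      · intro m
        have h1 : Continuous fun x : Rn n => (fderiv ℝ (cutoff ((m : ℝ) + 1)) x
            (EuclideanSpace.single k 1) : ℂ) :=
          Complex.continuous_ofReal.comp (((cutoff_contDiff _).continuous_fderiv
            (by simp)).clm_apply continuous_const)
        exact (hg k).1.mul (Complex.continuous_conj.comp_aestronglyMeasurable
          (h1.aestronglyMeasurable.mul (aestronglyMeasurable_rotSum M fun j => (hg j).1)))
      · refine ae_of_all _ fun x => tendsto_const_nhds.congr' ?_
        filter_upwards [eventually_ge_atTop ⌈‖x‖⌉₊] with m hm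
        have : ‖x‖ < (m : ℝ) + 1 := (Nat.ceil_le.1 hm).trans_lt (lt_add_one _)
        rw [(hC _ (by positivity) x k).2 this]
        simp
    have := (Complex.continuous_re.tendsto _).comp
      (tendsto_finsetSum Finset.univ fun k (_ : k ∈ Finset.univ) => hz k)
    simpa [defect, Function.comp_def] using this

/-! ### Curves in `L²` and integration in time -/

/-- Gluing countably many measurable functions along a measurable index function. -/
theorem aestronglyMeasurable_comp_countable {ι : Type*} [Countable ι] [MeasurableSpace ι]
    [MeasurableSingletonClass ι] {ν : Measure ℝ} {k : ℝ → ι} (hk : Measurable k)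
    {G : ι → ℝ → ℂ} (hG : ∀ i, AEStronglyMeasurable (G i) ν) :
    AEStronglyMeasurable (fun s => G (k s) s) ν := by
  have h1 : Measurable fun p : ι × ℝ => (hG p.1).mk _ p.2 :=
    measurable_from_prod_countable_right fun i => (hG i).stronglyMeasurable_mk.measurable
  refine ⟨fun s => (hG (k s)).mk _ s,
    (h1.comp (hk.prodMk measurable_id)).stronglyMeasurable, ?_⟩
  filter_upwards [ae_all_iff.2 fun i => (hG i).ae_eq_mk] with s hs using hs (k s)

theorem tendsto_floor_div (s : ℝ) :
    Tendsto (fun N : ℕ => (⌊s * ((N : ℝ) + 1)⌋ : ℝ) / ((N : ℝ) + 1)) atTop (𝓝 s) := by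
  have h : Tendsto (fun N : ℕ => s - 1 / ((N : ℝ) + 1)) atTop (𝓝 s) := by
    simpa using tendsto_const_nhds.sub (tendsto_one_div_add_atTop_nhds_zero_nat (𝕜 := ℝ))
  refine tendsto_of_tendsto_of_tendsto_of_le_of_le h tendsto_const_nhds (fun N => ?_) fun N => ?_
  · have hN : (0 : ℝ) < (N : ℝ) + 1 := by positivity
    change s - 1 / ((N : ℝ) + 1) ≤ _
    rw [le_div_iff₀ hN, sub_mul, one_div, inv_mul_cancel₀ hN.ne']
    linarith [Int.lt_floor_add_one (s * ((N : ℝ) + 1))]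
  · have hN : (0 : ℝ) < (N : ℝ) + 1 := by positivity
    change _ ≤ s
    rw [div_le_iff₀ hN]
    exact Int.floor_le _

section

variable {X : Type*} [PseudoMetricSpace X] {t : ℝ} {U : ℝ → X} {F : ℝ → X → ℂ} {m : ℝ → ℝ}

/-- Superposition of a curve with a Carathéodory function, which is Lipschitz in the second
variable with an integrable constant. Measurability comes from approximating the curve by step
functions. -/
theorem integrableOn_comp_curve (hU : Continuous U) (hm : IntegrableOn m (Set.Ioc 0 t))
    (hFm : ∀ z, IntegrableOn (fun s => F s z) (Set.Ioc 0 t))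
    (hF : ∀ᵐ s ∂volume.restrict (Set.Ioc 0 t), ∀ z z', ‖F s z - F s z'‖ ≤ m s * dist z z') :
    IntegrableOn (fun s => F s (U s)) (Set.Ioc 0 t) := by
  have hmeas : AEStronglyMeasurable (fun s => F s (U s)) (volume.restrict (Set.Ioc 0 t)) := by
    refine aestronglyMeasurable_of_tendsto_ae (u := atTop)
      (f := fun (N : ℕ) s => F s (U ((⌊s * ((N : ℝ) + 1)⌋ : ℝ) / ((N : ℝ) + 1)))) ?_ ?_
    · intro N
      exact aestronglyMeasurable_comp_countable
        (k := fun s : ℝ => ⌊s * ((N : ℝ) + 1)⌋) (by fun_prop)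
        (G := fun j s => F s (U ((j : ℝ) / ((N : ℝ) + 1)))) fun j => (hFm _).1
    · filter_upwards [hF] with s hs
      rw [tendsto_iff_norm_sub_tendsto_zero]
      have h1 := ((hU.tendsto s).comp (tendsto_floor_div s))
      rw [tendsto_iff_dist_tendsto_zero] at h1
      refine squeeze_zero (fun _ => norm_nonneg _) (fun N => hs _ _) ?_
      simpa using h1.const_mul (m s)
  obtain ⟨D, hD⟩ := (isCompact_Icc (a := (0 : ℝ)) (b := t)).exists_bound_of_continuousOn
    (f := fun s => dist (U s) (U 0)) (by fun_prop)
  refine Integrable.mono' ((hFm (U 0)).norm.add (hm.norm.mul_const D)) hmeas ?_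
  filter_upwards [hF, ae_restrict_mem measurableSet_Ioc] with s hs hst
  have h1 := hs (U s) (U 0)
  have h2 := hD s ⟨hst.1.le, hst.2⟩
  rw [Real.norm_of_nonneg dist_nonneg] at h2
  have h3 : m s * dist (U s) (U 0) ≤ ‖m s‖ * D :=
    mul_le_mul (Real.le_norm_self _) h2 dist_nonneg (norm_nonneg _)
  change _ ≤ ‖F s (U 0)‖ + ‖m s‖ * D
  linarith [norm_sub_norm_le (F s (U s)) (F s (U 0))]

/-- The fundamental theorem of calculus for a quantity which is quadratic along a curve: its
increments are given by a Riemann sum whose integrand freezes one factor at the end points. -/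
theorem sub_eq_integral_of_increment (ht : 0 ≤ t) {J : ℝ → ℂ} (hU : Continuous U)
    (hm : IntegrableOn m (Set.Ioc 0 t)) (hFm : ∀ z, IntegrableOn (fun s => F s z) (Set.Ioc 0 t))
    (hF : ∀ᵐ s ∂volume.restrict (Set.Ioc 0 t), ∀ z z', ‖F s z - F s z'‖ ≤ m s * dist z z')
    (hJ : ∀ a b, 0 ≤ a → a ≤ b → b ≤ t →
      J b - J a = Complex.I * ∫ s in a..b, (conj (F s (U b)) + F s (U a))) :
    J t - J 0 = 2 * Complex.I * ∫ s in (0 : ℝ)..t, ((F s (U s)).re : ℂ) := by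
  have hFU := integrableOn_comp_curve hU hm hFm hF
  have hconj : ∀ {g : ℝ → ℂ} {S : Set ℝ}, IntegrableOn g S → IntegrableOn (fun s => conj (g s)) S :=
    fun {g S} hg => (Complex.conjCLE.toContinuousLinearMap.integrable_comp hg :)
  set G : ℝ → ℂ := fun s => conj (F s (U s)) + F s (U s) with hG
  have hGi : IntegrableOn G (Set.Ioc 0 t) := (hconj hFU).add hFU
  have hsub : ∀ {a b : ℝ}, 0 ≤ a → b ≤ t → Set.Ioc a b ⊆ Set.Ioc 0 t := fun ha hb =>
    Set.Ioc_subset_Ioc ha hb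
  have hii : ∀ {E : Type} [NormedAddCommGroup E] {g : ℝ → E}, IntegrableOn g (Set.Ioc 0 t) →
      ∀ {a b : ℝ}, 0 ≤ a → a ≤ b → b ≤ t → IntervalIntegrable g volume a b :=
    fun {E _ g} hg {a b} ha hab hb => (intervalIntegrable_iff_integrableOn_Ioc_of_le hab).2
      (hg.mono_set (hsub ha hb))
  -- `Φ` is the difference of the two sides; its increments over short intervals are at most
  -- `2 ε ∫ ‖m‖`, and these bounds add up over a partition, so `Φ` is constant.
  set Φ : ℝ → ℂ := fun b => J b - Complex.I * ∫ s in (0 : ℝ)..b, G s with hΦ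
  have hstep : ∀ ε : ℝ, 0 < ε → ∃ δ > 0, ∀ a b, 0 ≤ a → a ≤ b → b ≤ t → b - a < δ →
      ‖Φ b - Φ a‖ ≤ ∫ s in a..b, 2 * ε * ‖m s‖ := by
    intro ε hε
    obtain ⟨δ, hδ, hUδ⟩ := Metric.uniformContinuousOn_iff.1
      ((isCompact_Icc (a := (0 : ℝ)) (b := t)).uniformContinuousOn_of_continuous
        hU.continuousOn) ε hε
    refine ⟨δ, hδ, fun a b ha hab hb hlt => ?_⟩
    have e : Φ b - Φ a = Complex.I * ∫ s in a..b, ((conj (F s (U b)) + F s (U a)) - G s) := by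
      have hi : IntervalIntegrable (fun s => conj (F s (U b)) + F s (U a)) volume a b :=
        hii ((hconj (hFm _)).add (hFm _)) ha hab hb
      rw [intervalIntegral.integral_sub hi (hii hGi ha hab hb), mul_sub, ← hJ a b ha hab hb, hΦ]
      have := intervalIntegral.integral_add_adjacent_intervals
        (hii hGi le_rfl ha (hab.trans hb)) (hii hGi ha hab hb)
      simp only [← this]
      ring
    rw [e, norm_mul, Complex.norm_I, one_mul]
    refine intervalIntegral.norm_integral_le_of_norm_le hab ?_
      ((hii hm ha hab hb).norm.const_mul _)
    filter_upwards [(ae_restrict_iff' measurableSet_Ioc).1 hF] with s hs hst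
    have hs' := hs (hsub ha hb hst)
    have h1 : ∀ c, 0 ≤ c → c ≤ t → |c - s| < δ → ‖F s (U c) - F s (U s)‖ ≤ ε * ‖m s‖ := by
      intro c hc0 hct hcs
      have := hUδ c ⟨hc0, hct⟩ s ⟨ha.trans hst.1.le, hst.2.trans hb⟩ hcs
      rw [mul_comm]
      exact (hs' _ _).trans (mul_le_mul (Real.le_norm_self _) this.le dist_nonneg (norm_nonneg _))
    have hb1 := h1 b (ha.trans hab) hb
      (by rw [abs_of_nonneg (by linarith [hst.2])]; linarith [hst.1])
    have ha1 := h1 a ha (hab.trans hb)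
      (by rw [abs_of_nonpos (by linarith [hst.1])]; linarith [hst.2])
    have e2 : conj (F s (U b)) + F s (U a) - G s
        = conj (F s (U b) - F s (U s)) + (F s (U a) - F s (U s)) := by
      simp only [hG, map_sub]
      ring
    rw [e2]
    refine (norm_add_le _ _).trans ?_
    rw [RCLike.norm_conj]
    linarith
  have hzero : Φ t - Φ 0 = 0 := by
    rw [← norm_le_zero_iff]
    set m₀ := ∫ s in (0 : ℝ)..t, ‖m s‖ with hm₀
    have key : ∀ ε : ℝ, 0 < ε → ‖Φ t - Φ 0‖ ≤ 2 * ε * m₀ := by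
      intro ε hε
      obtain ⟨δ, hδ, hb⟩ := hstep ε hε
      obtain ⟨N, hN⟩ := exists_nat_gt (t / δ)
      have hN0 : (0 : ℝ) < N := (div_nonneg ht hδ.le).trans_lt hN
      set a : ℕ → ℝ := fun k => t * k / N with ha
      have haN : a N = t := by simp [ha, hN0.ne']
      have ha0 : a 0 = 0 := by simp [ha]
      have hmono : Monotone a := fun j k hjk => by
        simp only [ha]
        gcongr
      have hdiff : ∀ k, a (k + 1) - a k < δ := fun k => by
        have : a (k + 1) - a k = t / N := by simp only [ha]; push_cast; ring
        rw [this, div_lt_iff₀ hN0]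
        rwa [div_lt_iff₀ hδ, mul_comm] at hN
      have hle : ∀ k < N, 0 ≤ a k ∧ a (k + 1) ≤ t := fun k hk =>
        ⟨ha0 ▸ hmono (Nat.zero_le k), haN ▸ hmono (Nat.succ_le_of_lt hk)⟩
      have hsum := Finset.sum_range_sub (fun k => Φ (a k)) N
      rw [haN, ha0] at hsum
      have hint := intervalIntegral.sum_integral_adjacent_intervals (a := a) (n := N)
        (f := fun s => 2 * ε * ‖m s‖) (μ := volume) fun k hk =>
          (hii hm (hle k hk).1 (hmono (Nat.le_succ k)) (hle k hk).2).norm.const_mul _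
      rw [haN, ha0, intervalIntegral.integral_const_mul] at hint
      rw [← hsum, hm₀, ← hint]
      refine (norm_sum_le _ _).trans (Finset.sum_le_sum fun k hk => ?_)
      have hk' := Finset.mem_range.1 hk
      exact hb _ _ (hle k hk').1 (hmono (Nat.le_succ k)) (hle k hk').2 (hdiff k)
    have hlim : Tendsto (fun ε : ℝ => 2 * ε * m₀) (𝓝[>] 0) (𝓝 0) := by
      have : Continuous fun ε : ℝ => 2 * ε * m₀ := by fun_prop
      simpa using (this.tendsto 0).mono_left nhdsWithin_le_nhds
    exact ge_of_tendsto hlim (eventually_mem_nhdsWithin.mono fun ε hε => key ε hε)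
  have hG2 : ∫ s in (0 : ℝ)..t, G s = 2 * ∫ s in (0 : ℝ)..t, ((F s (U s)).re : ℂ) := by
    rw [← intervalIntegral.integral_const_mul]
    congr 1
    ext s
    rw [hG]
    change conj (F s (U s)) + F s (U s) = _
    rw [add_comm, Complex.add_conj]
    push_cast
    rfl
  simp only [hΦ, intervalIntegral.integral_same, mul_zero, sub_zero, hG2] at hzero
  linear_combination hzero

end

/-- A curve of functions that is continuous for the `L²` norm on `[0, t]`, as a continuous curve
in `Lp`, constant outside of `[0, t]`. -/
theorem exists_continuous_lp {t : ℝ} (ht : 0 ≤ t) {v : ℝ → Rn n → ℂ}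
    (hv : ∀ s ∈ Set.Icc 0 t, MemLp (v s) 2)
    (h : ∀ s ∈ Set.Icc 0 t,
      Tendsto (fun s' => eLpNorm (v s' - v s) 2) (𝓝[Set.Icc 0 t] s) (𝓝 0)) :
    ∃ U : ℝ → Lp ℂ 2 (volume : Measure (Rn n)), Continuous U ∧
      ∀ s ∈ Set.Icc 0 t, U s =ᵐ[volume] v s := by
  have hW : Continuous fun s : Set.Icc (0 : ℝ) t => (hv s s.2).toLp (v s) := by
    refine continuous_iff_continuousAt.2 fun s => ?_
    rw [ContinuousAt, tendsto_iff_edist_tendsto_0]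
    simp_rw [Lp.edist_toLp_toLp]
    exact (h s s.2).comp (tendsto_nhdsWithin_iff.2
      ⟨continuous_subtype_val.tendsto s, Eventually.of_forall fun s => s.2⟩)
  refine ⟨fun s => (hv _ (Set.projIcc 0 t ht s).2).toLp (v (Set.projIcc 0 t ht s)),
    hW.comp continuous_projIcc, fun s hs => ?_⟩
  have : (Set.projIcc 0 t ht s : ℝ) = s := congrArg Subtype.val (Set.projIcc_of_mem ht hs)
  refine (hv _ (Set.projIcc 0 t ht s).2).coeFn_toLp.trans ?_
  rw [this]

/-- By Fatou's lemma every `L^p` norm is lower semicontinuous on `L²`. -/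
theorem lowerSemicontinuous_eLpNorm (p : ℝ≥0∞) :
    LowerSemicontinuous fun z : Lp ℂ 2 (volume : Measure (Rn n)) => eLpNorm z p := by
  refine lowerSemicontinuous_iff_isClosed_preimage.2 fun c => ?_
  refine IsSeqClosed.isClosed fun z z₀ hz hlim => ?_
  obtain ⟨ns, -, hns⟩ := (tendstoInMeasure_of_tendsto_Lp hlim).exists_seq_tendsto_ae
  refine (Lp.eLpNorm_lim_le_liminf_eLpNorm (f := fun i => (z (ns i) : Rn n → ℂ))
    (fun i => Lp.aestronglyMeasurable _) _ hns).trans ?_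
  refine (liminf_le_liminf (Eventually.of_forall fun i => hz (ns i))).trans ?_
  rw [liminf_const]

/-- The `L^p` norm along an `L²`-continuous curve is a measurable function of time, although the
curve need not be continuous, or even finite, in `L^p`. -/
theorem measurable_eLpNorm_curve {U : ℝ → Lp ℂ 2 (volume : Measure (Rn n))} (hU : Continuous U)
    (p : ℝ≥0∞) : Measurable fun s => eLpNorm (U s) p :=
  ((lowerSemicontinuous_eLpNorm p).comp hU :).measurable

/-! ### Time evolution of the regularised angular momentum -/

theorem ofReal_sobNorm_le (p : ℝ≥0∞) (f : Rn n → ℂ) :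
    ENNReal.ofReal (sobNorm p f) ≤ ((n : ℝ≥0∞) + 1) * normH p f := by
  have h1 : ∀ a : ℝ≥0∞, ENNReal.ofReal a.toReal ≤ a := fun a => ENNReal.ofReal_toReal_le
  have h2 : ENNReal.ofReal (∑ k, (eLpNorm (weakPartial f k) p).toReal)
      ≤ (n : ℝ≥0∞) * normH p f := by
    rw [ENNReal.ofReal_sum_of_nonneg fun _ _ => ENNReal.toReal_nonneg]
    refine (Finset.sum_le_card_nsmul _ _ (normH p f) fun k _ => ?_).trans ?_
    · refine (h1 _).trans ((eLpNorm_weakPartial_le p f k).trans ?_)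
      exact le_add_right le_add_self
    · simp [nsmul_eq_mul]
  rw [sobNorm, add_mul, one_mul, add_comm]
  refine ENNReal.ofReal_add_le.trans (add_le_add h2 ((h1 _).trans ?_))
  exact le_add_right le_self_add

section

variable {M : Matrix (Fin n) (Fin n) ℝ} {V μ χ : Rn n → ℝ} {T : EReal} {u₀ : Rn n → ℂ}
  {u : ℝ → Rn n → ℂ} {t : ℝ}

theorem Icc_subset_timeInterval (ht : t ∈ timeInterval T) : Set.Icc 0 t ⊆ timeInterval T :=
  fun _ hs => ⟨hs.1, (EReal.coe_le_coe_iff.2 hs.2).trans_lt ht.2⟩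

theorem IsSolution.ae_memH (hu : IsSolution M V μ T u₀ u) (ht : t ∈ timeInterval T) :
    ∀ᵐ s ∂volume.restrict (Set.Ioc 0 t), MemH 2 (u s) ∧ MemH (expR n) (u s) := by
  filter_upwards [ae_restrict_of_ae hu.mem_strichartz, ae_restrict_mem measurableSet_Ioc]
    with s hs hst
  have := Icc_subset_timeInterval ht (Set.Ioc_subset_Icc_self hst)
  exact ⟨hu.mem s this, hs this⟩

theorem IsSolution.exists_curve (hu : IsSolution M V μ T u₀ u) (ht : t ∈ timeInterval T) :
    ∃ U : ℝ → Lp ℂ 2 (volume : Measure (Rn n)), Continuous U ∧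
      ∀ s ∈ Set.Icc 0 t, U s =ᵐ[volume] u s := by
  have hsub := Icc_subset_timeInterval ht
  refine exists_continuous_lp ht.1 (fun s hs => (hu.mem s (hsub hs)).1) fun s hs => ?_
  refine tendsto_of_tendsto_of_tendsto_of_le_of_le tendsto_const_nhds
    ((hu.continuous s (hsub hs)).mono_left (nhdsWithin_mono _ hsub)) (fun _ => zero_le) ?_
  exact fun s' => le_add_right le_self_add

theorem IsSolution.exists_curve_weakPartial (hu : IsSolution M V μ T u₀ u)
    (ht : t ∈ timeInterval T) (k : Fin n) :
    ∃ U : ℝ → Lp ℂ 2 (volume : Measure (Rn n)), Continuous U ∧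
      ∀ s ∈ Set.Icc 0 t, U s =ᵐ[volume] weakPartial (u s) k := by
  have hsub := Icc_subset_timeInterval ht
  refine exists_continuous_lp ht.1 (fun s hs => (hu.mem s (hsub hs)).memLp_weakPartial k)
    fun s hs => ?_
  refine tendsto_of_tendsto_of_tendsto_of_le_of_le' tendsto_const_nhds
    ((hu.continuous s (hsub hs)).mono_left (nhdsWithin_mono _ hsub))
    (Eventually.of_forall fun _ => zero_le) ?_
  filter_upwards [self_mem_nhdsWithin] with s' hs'
  rw [← eLpNorm_congr_ae (weakPartial_sub_ae ((hu.mem s' (hsub hs')).hasWeakPartial k)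
    ((hu.mem s (hsub hs)).hasWeakPartial k))]
  exact (eLpNorm_weakPartial_le 2 _ k).trans (le_add_right le_add_self)

/-- The function of time that dominates all integrands: its first part is continuous, and the
second one is controlled by the space-time norm in the definition of a solution. -/
theorem IsSolution.integrableOn_sobNorm (hu : IsSolution M V μ T u₀ u)
    (ht : t ∈ timeInterval T) :
    IntegrableOn (fun s => sobNorm 2 (u s) ^ 2 + sobNorm (expR n) (u s) ^ ((2 * n + 4) / n : ℝ))
      (Set.Ioc 0 t) := by
  obtain ⟨U, hU, hUu⟩ := hu.exists_curve ht
  choose G hG hGu using hu.exists_curve_weakPartial ht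
  have hsob : ∀ p, ∀ s ∈ Set.Icc 0 t, sobNorm p (u s)
      = (eLpNorm (U s) p).toReal + ∑ k, (eLpNorm (G k s) p).toReal := by
    intro p s hs
    rw [sobNorm, eLpNorm_congr_ae (hUu s hs)]
    simp_rw [eLpNorm_congr_ae (hGu _ s hs)]
  refine Integrable.add ?_ ?_
  · have hc : Continuous fun s => (‖U s‖ + ∑ k, ‖G k s‖) ^ 2 := by fun_prop
    refine (hc.integrableOn_Icc.mono_set Set.Ioc_subset_Icc_self).congr_fun (fun s hs => ?_)
      measurableSet_Ioc
    simp only [hsob 2 s (Set.Ioc_subset_Icc_self hs), Lp.norm_def]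
  · have hmeas : Measurable fun s => ((eLpNorm (U s) (expR n)).toReal
        + ∑ k, (eLpNorm (G k s) (expR n)).toReal) ^ ((2 * n + 4) / n : ℝ) :=
      ((measurable_eLpNorm_curve hU _).ennreal_toReal.add (Finset.measurable_sum _ fun k _ =>
        (measurable_eLpNorm_curve (hG k) _).ennreal_toReal)).pow_const _
    refine ⟨hmeas.aestronglyMeasurable.congr ?_, ?_⟩
    · filter_upwards [ae_restrict_mem measurableSet_Ioc] with s hs
      rw [hsob _ s (Set.Ioc_subset_Icc_self hs)]
    · have hρ : (0 : ℝ) ≤ (2 * n + 4) / n := by positivity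
      have hpt : ∀ s, ‖sobNorm (expR n) (u s) ^ ((2 * n + 4) / n : ℝ)‖ₑ
          ≤ ((n : ℝ≥0∞) + 1) ^ ((2 * n + 4) / n : ℝ)
            * normH (expR n) (u s) ^ ((2 * n + 4) / n : ℝ) := fun s => by
        rw [Real.enorm_of_nonneg (Real.rpow_nonneg (sobNorm_nonneg _ _) _),
          ← ENNReal.ofReal_rpow_of_nonneg (sobNorm_nonneg _ _) hρ, ← ENNReal.mul_rpow_of_nonneg _ _ hρ]
        exact ENNReal.rpow_le_rpow (ofReal_sobNorm_le _ _) hρ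
      have hct : ((n : ℝ≥0∞) + 1) ^ ((2 * n + 4) / n : ℝ) ≠ ⊤ :=
        ENNReal.rpow_ne_top_of_nonneg hρ (by simp)
      refine (lintegral_mono hpt).trans_lt ?_
      rw [lintegral_const_mul' _ _ hct]
      refine ENNReal.mul_lt_top hct.lt_top (lt_of_le_of_lt ?_ (hu.strichartz t ht))
      exact lintegral_mono' (Measure.restrict_mono Set.Ioc_subset_Icc_self le_rfl) le_rfl

/-- The equation, tested against a complex test function, between two times. -/
theorem IsSolution.integral_sub_mul (hn : 1 ≤ n) (hV : IsRadialCoeff V) (hμ : IsRadialCoeff μ)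
    (hu : IsSolution M V μ T u₀ u) (ht : t ∈ timeInterval T) {g : Rn n → ℂ}
    (hg : ContDiff ℝ ∞ g) (hgc : HasCompactSupport g) :
    IntegrableOn (fun s => weakForm M V μ (u s) g) (Set.Ioc 0 t) ∧
      ∀ a b, 0 ≤ a → a ≤ b → b ≤ t → ∫ x, (u b - u a) x * g x
        = -Complex.I * ∫ s in a..b, weakForm M V μ (u s) g := by
  have hsub := Icc_subset_timeInterval ht
  have hre := isTest_re hg hgc
  have him := isTest_im hg hgc
  set R : ℝ → ℂ := fun s => (rhs M V μ (u s) fun x => (g x).re)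
    + Complex.I * rhs M V μ (u s) fun x => (g x).im with hR
  have hae : ∀ᵐ s ∂volume.restrict (Set.Ioc 0 t), R s = weakForm M V μ (u s) g := by
    filter_upwards [hu.ae_memH ht] with s hs
    exact (weakForm_eq_rhs_re_add_rhs_im hn hV hμ hs.1 hs.2.1 hg hgc).symm
  have hRi : ∀ b ∈ Set.Icc 0 t, IntervalIntegrable R volume 0 b := fun b hb =>
    (hu.equation _ hre b (hsub hb)).1.add ((hu.equation _ him b (hsub hb)).1.const_mul _)
  refine ⟨((intervalIntegrable_iff_integrableOn_Ioc_of_le ht.1).1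
    (hRi t ⟨ht.1, le_rfl⟩)).congr hae, fun a b ha hab hb => ?_⟩
  have hbI : b ∈ Set.Icc 0 t := ⟨ha.trans hab, hb⟩
  have haI : a ∈ Set.Icc 0 t := ⟨ha, hab.trans hb⟩
  have hinc : ∀ φ, IsTest φ → (∫ x, u b x * (φ x : ℂ)) - ∫ x, u a x * (φ x : ℂ)
      = -Complex.I * ∫ s in a..b, rhs M V μ (u s) φ := by
    intro φ hφ
    obtain ⟨i1, e1⟩ := hu.equation φ hφ b (hsub hbI)
    obtain ⟨i2, e2⟩ := hu.equation φ hφ a (hsub haI)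
    rw [← intervalIntegral.integral_interval_sub_left i1 i2, ← e1, ← e2]
    linear_combination ((∫ x, u b x * (φ x : ℂ)) - ∫ x, u a x * (φ x : ℂ)) * Complex.I_mul_I
  have hl : ∀ c ∈ Set.Icc 0 t, LocallyIntegrable (u c) := fun c hc =>
    (hu.mem c (hsub hc)).1.locallyIntegrable one_le_two
  have hsplit : ∀ c ∈ Set.Icc 0 t, Integrable (fun x => u c x * g x) ∧ ∫ x, u c x * g x
      = (∫ x, u c x * ((g x).re : ℂ)) + Complex.I * ∫ x, u c x * ((g x).im : ℂ) := by
    intro c hc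
    have j1 := hre.integrable_mul (hl c hc)
    have j2 := (him.integrable_mul (hl c hc)).const_mul Complex.I
    have e : ∀ x, u c x * g x = u c x * ((g x).re : ℂ) + Complex.I * (u c x * ((g x).im : ℂ)) :=
      fun x => by
        conv_lhs => rw [← Complex.re_add_im (g x)]
        ring
    simp_rw [e]
    refine ⟨j1.add j2, ?_⟩
    rw [integral_add j1 j2, integral_const_mul]
  have hsame : ∫ s in a..b, weakForm M V μ (u s) g = ∫ s in a..b, R s := by
    refine intervalIntegral.integral_congr_ae ?_
    rw [Set.uIoc_of_le hab]
    filter_upwards [(ae_restrict_iff' measurableSet_Ioc).1 hae] with s hs hst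
    exact (hs (Set.Ioc_subset_Ioc ha hb hst)).symm
  have i3 := (hu.equation _ hre a (hsub haI)).1.symm.trans (hu.equation _ hre b (hsub hbI)).1
  have i4 := (hu.equation _ him a (hsub haI)).1.symm.trans (hu.equation _ him b (hsub hbI)).1
  have hRe : ∫ s in a..b, R s = (∫ s in a..b, rhs M V μ (u s) fun x => (g x).re)
      + Complex.I * ∫ s in a..b, rhs M V μ (u s) fun x => (g x).im := by
    rw [← intervalIntegral.integral_const_mul]
    exact intervalIntegral.integral_add i3 (i4.const_mul _)
  have e5 : ∫ x, (u b - u a) x * g x = (∫ x, u b x * g x) - ∫ x, u a x * g x := by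
    rw [← integral_sub (hsplit b hbI).1 (hsplit a haI).1]
    simp only [Pi.sub_apply, sub_mul]
  rw [e5, (hsplit b hbI).2, (hsplit a haI).2, hsame, hRe]
  linear_combination hinc _ hre + Complex.I * hinc _ him

/-- Evolution of the regularised and localised angular momentum. Since `K = angOp φ χ M` is
skew and smoothing, the increment over `[a, b]` is `i ∫ₐᵇ (conj Λₛ(conj K u(b)) + Λₛ(conj K u(a)))`,
where `Λₛ` is the weak form of the equation at time `s`; no time derivative of `u` is needed. -/
theorem IsSolution.integral_conj_mul_angOp_sub (hM : Mᵀ = -M) (hn : 1 ≤ n)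
    (hV : IsRadialCoeff V) (hμ : IsRadialCoeff μ) (hu : IsSolution M V μ T u₀ u)
    (ht : t ∈ timeInterval T) (hχ : ContDiff ℝ ∞ χ) (hχr : IsRadialWeight χ)
    (φ : ContDiffBump (0 : Rn n)) :
    IntegrableOn (fun s => weakForm M V μ (u s) fun x => conj (angOp φ χ M (u s) x))
        (Set.Ioc 0 t) ∧
      (∫ x, conj (u t x) * angOp φ χ M (u t) x) - ∫ x, conj (u 0 x) * angOp φ χ M (u 0) x
        = 2 * Complex.I * ∫ s in (0 : ℝ)..t,
          ((weakForm M V μ (u s) fun x => conj (angOp φ χ M (u s) x)).re : ℂ) := by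
  have hsub := Icc_subset_timeInterval ht
  obtain ⟨R, hR⟩ := hχr.support
  obtain ⟨U, hU, hUu⟩ := hu.exists_curve ht
  obtain ⟨C, hC0, hC⟩ := exists_norm_weakForm_conj_angOp_le (M := M) hn hV hμ hχ hχr.toIsWeight φ
  set F : ℝ → Lp ℂ 2 (volume : Measure (Rn n)) → ℂ := fun s z =>
    weakForm M V μ (u s) fun x => conj (angOp φ χ M z x) with hF
  have hK : ∀ z : Rn n → ℂ, LocallyIntegrable z →
      ContDiff ℝ ∞ (fun x => conj (angOp φ χ M z x)) ∧
        HasCompactSupport fun x => conj (angOp φ χ M z x) := fun z hz =>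
    ⟨Complex.conjCLE.contDiff.comp (contDiff_angOp φ M hχ hz),
      (hasCompactSupport_angOp φ M hR z).comp_left (map_zero _)⟩
  have hUl : ∀ z : Lp ℂ 2 (volume : Measure (Rn n)), LocallyIntegrable z := fun z =>
    (Lp.memLp z).locallyIntegrable one_le_two
  have hdom := hu.integrableOn_sobNorm ht
  set dom : ℝ → ℝ := fun s =>
    sobNorm 2 (u s) ^ 2 + sobNorm (expR n) (u s) ^ ((2 * n + 4) / n : ℝ) with hdomdef
  have hm : IntegrableOn (fun s => C * (2 + dom s)) (Set.Ioc 0 t) :=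
    ((integrable_const (2 : ℝ)).add hdom).const_mul C
  have hLip : ∀ᵐ s ∂volume.restrict (Set.Ioc 0 t), ∀ z z',
      ‖F s z - F s z'‖ ≤ C * (2 + dom s) * dist z z' := by
    filter_upwards [hu.ae_memH ht] with s hs z z'
    have h1 := weakForm_conj_angOp_sub (M := M) hn hV hμ hχ hχr.toIsWeight φ hs.1 hs.2.1
      (hUl z) (hUl z')
    have h2 := hC (u s) hs.1 hs.2.1 (z - z') ((Lp.memLp z).sub (Lp.memLp z'))
    rw [h1] at h2
    refine h2.trans ?_
    rw [Lp.dist_def]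
    refine mul_le_mul_of_nonneg_right (mul_le_mul_of_nonneg_left ?_ hC0) ENNReal.toReal_nonneg
    have hs0 := sobNorm_nonneg 2 (u s)
    have hr0 : 0 ≤ (eLpNorm (u s) (expR n)).toReal := ENNReal.toReal_nonneg
    have hrs := toReal_eLpNorm_le_sobNorm (expR n) (u s)
    have hn0 : (0 : ℝ) < n := by exact_mod_cast hn
    have h3 : (eLpNorm (u s) (expR n)).toReal ^ ((n + 4) / n : ℝ)
        ≤ 1 + sobNorm (expR n) (u s) ^ ((2 * n + 4) / n : ℝ) := by
      have hp : 0 ≤ sobNorm (expR n) (u s) ^ ((2 * n + 4) / n : ℝ) :=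
        Real.rpow_nonneg (sobNorm_nonneg _ _) _
      rcases le_total (eLpNorm (u s) (expR n)).toReal 1 with h | h
      · linarith [Real.rpow_le_one hr0 h (by positivity : (0 : ℝ) ≤ (n + 4) / n)]
      · have e1 := Real.rpow_le_rpow_of_exponent_le h
          (show ((n + 4) / n : ℝ) ≤ (2 * n + 4) / n by gcongr; linarith)
        have e2 := Real.rpow_le_rpow hr0 hrs (by positivity : (0 : ℝ) ≤ (2 * n + 4) / n)
        linarith
    have h4 : sobNorm 2 (u s) ≤ 1 + sobNorm 2 (u s) ^ 2 := by
      nlinarith [sq_nonneg (sobNorm 2 (u s) - 1)]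
    simp only [hdomdef]
    linarith
  have hFm : ∀ z, IntegrableOn (fun s => F s z) (Set.Ioc 0 t) := fun z =>
    (hu.integral_sub_mul hn hV hμ ht (hK z (hUl z)).1 (hK z (hUl z)).2).1
  have hFU : ∀ a ∈ Set.Icc 0 t, ∀ s, F s (U a)
      = weakForm M V μ (u s) fun x => conj (angOp φ χ M (u a) x) := fun a ha s => by
    simp only [hF, angOp_congr_ae φ M (hUu a ha)]
  have hl : ∀ c ∈ Set.Icc 0 t, LocallyIntegrable (u c) := fun c hc =>
    (hu.mem c (hsub hc)).1.locallyIntegrable one_le_two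
  have hint : ∀ a ∈ Set.Icc 0 t, ∀ b ∈ Set.Icc 0 t,
      Integrable fun x => conj (u a x) * angOp φ χ M (u b) x := by
    intro a ha b hb
    have h2 : MemLp (angOp φ χ M (u b)) 2 :=
      (contDiff_angOp φ M hχ (hl b hb)).continuous.memLp_of_hasCompactSupport
        (hasCompactSupport_angOp φ M hR (u b))
    exact MemLp.integrable_mul (p := 2) (q := 2) (memLp_conj (hu.mem a (hsub ha)).1) h2
  have hmain := sub_eq_integral_of_increment (F := F) ht.1
    (J := fun s => ∫ x, conj (u s x) * angOp φ χ M (u s) x) hU hm hFm hLip ?_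
  · have hint2 := integrableOn_comp_curve hU hm hFm hLip
    refine ⟨hint2.congr_fun (fun s hs => hFU s (Set.Ioc_subset_Icc_self hs) s)
      measurableSet_Ioc, hmain.trans ?_⟩
    congr 1
    refine intervalIntegral.integral_congr fun s hs => ?_
    rw [Set.uIcc_of_le ht.1] at hs
    simp only [hFU s hs s]
  · intro a b ha hab hb
    have haI : a ∈ Set.Icc 0 t := ⟨ha, hab.trans hb⟩
    have hbI : b ∈ Set.Icc 0 t := ⟨ha.trans hab, hb⟩
    have hD : ∀ c ∈ Set.Icc 0 t, ∫ x, (u b - u a) x * conj (angOp φ χ M (u c) x)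
        = -Complex.I * ∫ s in a..b, F s (U c) := by
      intro c hc
      simp_rw [hFU c hc]
      exact (hu.integral_sub_mul hn hV hμ ht (hK _ (hl c hc)).1 (hK _ (hl c hc)).2).2
        a b ha hab hb
    -- the increment in the first factor
    have e1 : (∫ x, conj (u b x) * angOp φ χ M (u b) x) - ∫ x, conj (u a x) * angOp φ χ M (u b) x
        = conj (∫ x, (u b - u a) x * conj (angOp φ χ M (u b) x)) := by
      rw [← integral_conj, ← integral_sub (hint b hbI b hbI) (hint a haI b hbI)]
      congr 1
      ext x
      simp
      ring
    -- the increment in the second factor, moved to the first one by skewness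
    have e2 : (∫ x, conj (u a x) * angOp φ χ M (u b) x) - ∫ x, conj (u a x) * angOp φ χ M (u a) x
        = -∫ x, (u b - u a) x * conj (angOp φ χ M (u a) x) := by
      rw [integral_conj_mul_angOp_skew φ M hM hχ hχr (hl a haI) (hl b hbI),
        integral_conj_mul_angOp_skew φ M hM hχ hχr (hl a haI) (hl a haI), neg_sub_neg,
        ← map_sub, ← integral_sub (hint a haI a haI) (hint b hbI a haI), ← integral_conj,
        ← integral_neg]
      congr 1
      ext x
      simp
      ring
    have i1 : IntervalIntegrable (fun s => F s (U b)) volume a b :=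
      (intervalIntegrable_iff_integrableOn_Ioc_of_le hab).2
        ((hFm _).mono_set (Set.Ioc_subset_Ioc ha hb))
    have i2 : IntervalIntegrable (fun s => F s (U a)) volume a b :=
      (intervalIntegrable_iff_integrableOn_Ioc_of_le hab).2
        ((hFm _).mono_set (Set.Ioc_subset_Ioc ha hb))
    have i1' : IntervalIntegrable (fun s => conj (F s (U b))) volume a b :=
      ⟨(Complex.conjCLE.toContinuousLinearMap.integrable_comp i1.1 :),
        (Complex.conjCLE.toContinuousLinearMap.integrable_comp i1.2 :)⟩
    have e3 : ∫ s in a..b, conj (F s (U b)) = conj (∫ s in a..b, F s (U b)) := by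
      rw [intervalIntegral.integral_of_le hab, intervalIntegral.integral_of_le hab, integral_conj]
    rw [intervalIntegral.integral_add i1' i2, e3]
    rw [hD b hbI, map_mul, map_neg, Complex.conj_I, neg_neg] at e1
    rw [hD a haI] at e2
    linear_combination e1 + e2

end

/-! ### Removal of the mollifier and of the cutoff -/

section

variable {M : Matrix (Fin n) (Fin n) ℝ} {V μ χ : Rn n → ℝ} {T : EReal} {u₀ : Rn n → ℂ}
  {u : ℝ → Rn n → ℂ} {t : ℝ}

theorem tendsto_integral_conj_mul_angOp (hχw : IsWeight χ) {f : Rn n → ℂ} (hf : MemH 2 f) :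
    Tendsto (fun i => ∫ x, conj (f x) * angOp (bump n i) χ M f x) atTop
      (𝓝 (∫ x, conj (f x) * ((χ x : ℂ) * rotDeriv M f x))) := by
  have h2t : (2 : ℝ≥0∞) ≠ ⊤ := by simp
  refine tendsto_integral_mul (p := 2) (q := 2) one_le_two (memLp_conj hf.1)
    (memLp_weight_mul_rotSum M hχw one_le_two hf.memLp_weakPartial) (fun _ => memLp_conj hf.1)
    (fun i => memLp_angOp _ M hχw one_le_two h2t hf.hasWeakPartial hf.memLp_weakPartial) ?_
    (tendsto_eLpNorm_angOp M hχw one_le_two h2t hf.hasWeakPartial hf.memLp_weakPartial)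
  simp

/-- Evolution of the localised angular momentum, obtained by removing the mollifier. -/
theorem IsSolution.integral_conj_mul_weight_sub (hM : Mᵀ = -M) (hn : 1 ≤ n)
    (hV : IsRadialCoeff V) (hμ : IsRadialCoeff μ) (hu : IsSolution M V μ T u₀ u)
    (ht : t ∈ timeInterval T) (hχ : ContDiff ℝ ∞ χ) (hχr : IsRadialWeight χ) :
    AEStronglyMeasurable (fun s => defect χ M (weakPartial (u s)))
        (volume.restrict (Set.Ioc 0 t)) ∧
      (∫ x, conj (u t x) * ((χ x : ℂ) * rotDeriv M (u t) x))
          - ∫ x, conj (u 0 x) * ((χ x : ℂ) * rotDeriv M (u 0) x)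
        = 2 * Complex.I * ∫ s in (0 : ℝ)..t, (defect χ M (weakPartial (u s)) : ℂ) := by
  have hsub := Icc_subset_timeInterval ht
  have hlim : ∀ᵐ s ∂volume.restrict (Set.Ioc 0 t), Tendsto (fun i =>
      (weakForm M V μ (u s) fun x => conj (angOp (bump n i) χ M (u s) x)).re) atTop
      (𝓝 (defect χ M (weakPartial (u s)))) := by
    filter_upwards [hu.ae_memH ht] with s hs
    exact tendsto_re_weakForm_conj_angOp hM hn hV hμ hχ hχr hs.1 hs.2
  have hi := fun i => hu.integral_conj_mul_angOp_sub hM hn hV hμ ht hχ hχr (bump n i)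
  have hmeas : ∀ i, AEStronglyMeasurable (fun s =>
      (weakForm M V μ (u s) fun x => conj (angOp (bump n i) χ M (u s) x)).re)
      (volume.restrict (Set.Ioc 0 t)) := fun i =>
    Complex.continuous_re.comp_aestronglyMeasurable (hi i).1.1
  refine ⟨aestronglyMeasurable_of_tendsto_ae atTop hmeas hlim, ?_⟩
  obtain ⟨C, hC0, hC⟩ := exists_abs_re_weakForm_conj_angOp_le hM hn hV hμ hχ hχr
  have hrhs : Tendsto (fun i => ∫ s in (0 : ℝ)..t,
      ((weakForm M V μ (u s) fun x => conj (angOp (bump n i) χ M (u s) x)).re : ℂ)) atTop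
      (𝓝 (∫ s in (0 : ℝ)..t, (defect χ M (weakPartial (u s)) : ℂ))) := by
    simp only [intervalIntegral.integral_of_le ht.1]
    refine tendsto_integral_of_dominated_convergence _
      (fun i => Complex.continuous_ofReal.comp_aestronglyMeasurable (hmeas i))
      ((hu.integrableOn_sobNorm ht).const_mul C) (fun i => ?_) ?_
    · filter_upwards [hu.ae_memH ht] with s hs
      rw [Complex.norm_real]
      exact hC i (u s) hs.1 hs.2
    · filter_upwards [hlim] with s hs
      exact (Complex.continuous_ofReal.tendsto _).comp hs
  have hlhs := (tendsto_integral_conj_mul_angOp (M := M) hχr.toIsWeight (hu.mem t ht)).sub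
    (tendsto_integral_conj_mul_angOp (M := M) hχr.toIsWeight
      (hu.mem 0 (hsub ⟨le_rfl, ht.1⟩)))
  simp_rw [fun i => (hi i).2] at hlhs
  exact tendsto_nhds_unique hlhs (hrhs.const_mul _)

theorem integrable_conj_mul_rotDeriv (M : Matrix (Fin n) (Fin n) ℝ) {f : Rn n → ℂ}
    (hf : MemH 2 f) : Integrable fun x => conj (f x) * rotDeriv M f x := by
  have hmeas : AEStronglyMeasurable fun x => conj (f x) * rotDeriv M f x :=
    (memLp_conj hf.1).1.mul (aestronglyMeasurable_rotSum M fun j => (hf.memLp_weakPartial j).1)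
  have hb : Integrable fun x => ∑ j, ‖Matrix.toEuclideanCLM (𝕜 := ℝ) M‖
      * (‖(‖x‖ : ℂ) * f x‖ * ‖weakPartial f j x‖) :=
    integrable_finsetSum _ fun j _ => (MemLp.integrable_mul (p := 2) (q := 2) hf.2.2.norm
      (hf.memLp_weakPartial j).norm).const_mul _
  refine hb.mono' hmeas (ae_of_all _ fun x => ?_)
  rw [rotDeriv, Finset.mul_sum]
  refine (norm_sum_le _ _).trans (Finset.sum_le_sum fun j _ => ?_)
  rw [norm_mul, norm_mul, RCLike.norm_conj, Complex.norm_real, norm_mul, Complex.norm_real,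
    norm_norm, Real.norm_eq_abs]
  calc _ ≤ ‖f x‖ * (‖Matrix.toEuclideanCLM (𝕜 := ℝ) M‖ * ‖x‖ * ‖weakPartial f j x‖) := by
        gcongr
        exact abs_mulVec_le M x j
    _ = _ := by ring

theorem tendsto_integral_cutoff_mul (M : Matrix (Fin n) (Fin n) ℝ) {f : Rn n → ℂ}
    (hf : MemH 2 f) :
    Tendsto (fun m : ℕ => ∫ x, conj (f x) * ((cutoff ((m : ℝ) + 1) x : ℂ) * rotDeriv M f x))
      atTop (𝓝 (∫ x, conj (f x) * rotDeriv M f x)) := by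
  have hi := integrable_conj_mul_rotDeriv M hf
  have e : ∀ (m : ℕ) x, conj (f x) * ((cutoff ((m : ℝ) + 1) x : ℂ) * rotDeriv M f x)
      = (cutoff ((m : ℝ) + 1) x : ℂ) * (conj (f x) * rotDeriv M f x) := fun m x => by ring
  simp_rw [e]
  refine tendsto_integral_of_dominated_convergence _ (fun m => ?_) hi.norm (fun m => ?_) ?_
  · exact (Complex.continuous_ofReal.comp (cutoff_contDiff _).continuous).aestronglyMeasurable.mul
      hi.1
  · refine ae_of_all _ fun x => ?_
    rw [norm_mul, Complex.norm_real]
    exact mul_le_of_le_one_left (norm_nonneg _) (abs_cutoff_le _ x)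
  · refine ae_of_all _ fun x => tendsto_const_nhds.congr' ?_
    filter_upwards [eventually_ge_atTop ⌈‖x‖⌉₊] with m hm
    have : ‖x‖ ≤ (m : ℝ) + 1 := ((Nat.ceil_le.1 hm).trans_lt (lt_add_one _)).le
    rw [cutoff_eq_one (by positivity) this, Complex.ofReal_one, one_mul]

/-- Twice the imaginary part is the integral of `A·∇|f|²`, which vanishes as `A` is tangential to
spheres. -/
theorem angularMomentum_im (hM : Mᵀ = -M) {f : Rn n → ℂ} (hf : MemH 2 f) :
    (angularMomentum M f).im = 0 := by
  have h0 : ∀ m : ℕ,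
      (∫ x, conj (f x) * ((cutoff ((m : ℝ) + 1) x : ℂ) * rotDeriv M f x)).re = 0 := fun m => by
    simpa [rotDeriv_eq_rotSum] using re_integral_weight_eq_zero hM
      (isRadialWeight_cutoff (by positivity : (0 : ℝ) < (m : ℝ) + 1)) (θ := fun _ => 1)
      continuous_const (B := 1) (by simp) hf.1 hf.memLp_weakPartial hf.hasWeakPartial
  have h1 := (Complex.continuous_re.tendsto _).comp (tendsto_integral_cutoff_mul M hf)
  have h2 := tendsto_nhds_unique h1 ((tendsto_const_nhds (x := (0 : ℝ))).congr fun m => (h0 m).symm)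
  simpa [angularMomentum] using h2

/-- Conservation of the angular momentum, obtained by removing the cutoff. -/
theorem IsSolution.integral_conj_mul_rotDeriv_eq (hM : Mᵀ = -M) (hn : 1 ≤ n)
    (hV : IsRadialCoeff V) (hμ : IsRadialCoeff μ) (hu : IsSolution M V μ T u₀ u)
    (ht : t ∈ timeInterval T) :
    ∫ x, conj (u t x) * rotDeriv M (u t) x = ∫ x, conj (u 0 x) * rotDeriv M (u 0) x := by
  have hsub := Icc_subset_timeInterval ht
  obtain ⟨C, hC0, hC⟩ := exists_abs_defect_cutoff_le M
  have hm := fun m : ℕ => hu.integral_conj_mul_weight_sub hM hn hV hμ ht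
    (cutoff_contDiff ((m : ℝ) + 1)) (isRadialWeight_cutoff (by positivity))
  have hlhs := (tendsto_integral_cutoff_mul M (hu.mem t ht)).sub
    (tendsto_integral_cutoff_mul M (hu.mem 0 (hsub ⟨le_rfl, ht.1⟩)))
  simp_rw [fun m => (hm m).2] at hlhs
  have hrhs : Tendsto (fun m : ℕ => ∫ s in (0 : ℝ)..t,
      (defect (cutoff ((m : ℝ) + 1)) M (weakPartial (u s)) : ℂ)) atTop
      (𝓝 (∫ s in (0 : ℝ)..t, 0)) := by
    simp only [intervalIntegral.integral_of_le ht.1]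
    refine tendsto_integral_of_dominated_convergence _
      (fun m => Complex.continuous_ofReal.comp_aestronglyMeasurable (hm m).1)
      ((hu.integrableOn_sobNorm ht).const_mul C) (fun m => ?_) ?_
    · filter_upwards [hu.ae_memH ht] with s hs
      rw [Complex.norm_real]
      refine ((hC _ hs.1.memLp_weakPartial).1 _ (by positivity)).trans ?_
      refine mul_le_mul_of_nonneg_left ?_ hC0
      have h1 := pow_le_pow_left₀ (Finset.sum_nonneg fun _ _ => ENNReal.toReal_nonneg)
        (sum_toReal_eLpNorm_le_sobNorm 2 (u s)) 2
      have h2 := Real.rpow_nonneg (sobNorm_nonneg (expR n) (u s)) ((2 * n + 4) / n : ℝ)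
      linarith
    · filter_upwards [hu.ae_memH ht] with s hs
      have := (Complex.continuous_ofReal.tendsto _).comp (hC _ hs.1.memLp_weakPartial).2
      simpa [Function.comp_def] using this
  have := tendsto_nhds_unique hlhs (hrhs.const_mul _)
  rw [intervalIntegral.integral_zero, mul_zero] at this
  exact sub_eq_zero.1 this

end

theorem rotDeriv_blockMatrix (Ω : Fin (n / 2) → ℝ) (f : Rn n → ℂ) (x : Rn n) :
    rotDeriv (blockMatrix n Ω) f x = ∑ j : Fin (n / 2), (Ω j : ℂ) *
      ((x ⟨2 * j, by omega⟩ : ℂ) * weakPartial f ⟨2 * j + 1, by omega⟩ x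
        - (x ⟨2 * j + 1, by omega⟩ : ℂ) * weakPartial f ⟨2 * j, by omega⟩ x) := by
  have hentry : ∀ i : Fin n, (blockMatrix n Ω *ᵥ x.ofLp) i = ∑ j : Fin (n / 2), Ω j *
      ((if i = ⟨2 * j + 1, by omega⟩ then x ⟨2 * j, by omega⟩ else 0)
        - (if i = ⟨2 * j, by omega⟩ then x ⟨2 * j + 1, by omega⟩ else 0)) := by
    intro i
    simp only [Matrix.mulVec, dotProduct, blockMatrix, Matrix.of_apply, Finset.sum_mul]
    rw [Finset.sum_comm]
    refine Finset.sum_congr rfl fun j _ => ?_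
    simp only [mul_assoc, ← Finset.mul_sum, sub_mul, Finset.sum_sub_distrib, ite_mul, one_mul,
      zero_mul, ite_and]
    have h1 : ∀ k : Fin n, ((k : ℕ) = 2 * j) ↔ k = ⟨2 * j, by omega⟩ := fun k => by
      rw [Fin.ext_iff]
    have h2 : ∀ k : Fin n, ((k : ℕ) = 2 * j + 1) ↔ k = ⟨2 * j + 1, by omega⟩ := fun k => by
      rw [Fin.ext_iff]
    simp only [h1, h2]
    split_ifs <;> simp
  simp only [rotDeriv, hentry, Complex.ofReal_sum, Finset.sum_mul]
  rw [Finset.sum_comm]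
  refine Finset.sum_congr rfl fun j _ => ?_
  simp only [Complex.ofReal_mul, Complex.ofReal_sub, mul_assoc, ← Finset.mul_sum, sub_mul,
    Finset.sum_sub_distrib, apply_ite Complex.ofReal, Complex.ofReal_zero, ite_mul, zero_mul,
    Finset.sum_ite_eq', Finset.mem_univ, if_true]

theorem angularMomentumΩ_eq (Ω : Fin (n / 2) → ℝ) (f : Rn n → ℂ) :
    angularMomentumΩ Ω f = angularMomentum (blockMatrix n Ω) f := by
  rw [angularMomentumΩ, angularMomentum, ← integral_neg, ← integral_const_mul]
  congr 1
  ext x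
  rw [rotDeriv_blockMatrix, Finset.sum_mul, ← Finset.sum_neg_distrib, Finset.mul_sum,
    Finset.mul_sum]
  refine Finset.sum_congr rfl fun j _ => ?_
  rw [planeL]
  ring

end RNLS

theorem proposition2p2 (n : ℕ) (hn : 1 ≤ n) (M : Matrix (Fin n) (Fin n) ℝ) (hM : Mᵀ = -M)
    (V μ : RNLS.Rn n → ℝ) (hV : RNLS.IsRadialCoeff V) (hμ : RNLS.IsRadialCoeff μ)
    (T : EReal) (hT : 0 < T) (u₀ : RNLS.Rn n → ℂ) (hu₀ : RNLS.MemH 2 u₀)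
    (u : ℝ → RNLS.Rn n → ℂ) (hu : RNLS.IsSolution M V μ T u₀ u) :
    ∀ t ∈ RNLS.timeInterval T,
      Integrable (fun x => conj (u t x) * RNLS.rotDeriv M (u t) x) ∧
      (RNLS.angularMomentum M (u t)).im = 0 ∧
      RNLS.angularMomentum M (u t) = RNLS.angularMomentum M u₀ ∧
      ∀ Ω : Fin (n / 2) → ℝ, M = RNLS.blockMatrix n Ω →
        RNLS.angularMomentumΩ Ω (u t) = RNLS.angularMomentum M (u t) := by
  intro t ht
  refine ⟨RNLS.integrable_conj_mul_rotDeriv M (hu.mem t ht),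
    RNLS.angularMomentum_im hM (hu.mem t ht), ?_, fun Ω hΩ => ?_⟩
  · rw [RNLS.angularMomentum, hu.integral_conj_mul_rotDeriv_eq hM hn hV hμ ht,
      RNLS.angularMomentum]
    congr 1
    refine integral_congr_ae ?_
    filter_upwards [hu.initial] with x hx
    simp only [RNLS.rotDeriv, hx, RNLS.weakPartial_congr_ae hu.initial]
  · rw [hΩ, RNLS.angularMomentumΩ_eq]
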